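/- Let $M$ be a 3-manifold (possibly with boundary) with a triangulation $\tau$, that is, a homeomorphism from a locally finite simplicial complex, every simplex of which is a face of a tetrahedron, onto $M$. Let $f$ be a scaling function, i.e. a function assigning to each tetrahedron $\Delta$ of $\tau$ an integer $f(\Delta)\ge 0$. Let $\phi$ be the operation that replaces a tetrahedron $[a,b,c,d]$ by the four tetrahedra $[b,c,d,e],[a,c,d,e],[a,b,d,e],[a,b,c,e]$, where $e$ is a point (chosen arbitrarily for each tetrahedron) in its interior, and let $\tau'=\phi_f(\tau)$ be the refinement of $\tau$ in which each tetrahedron $\Delta$ of $\tau$ is subdivided by $f(\Delta)$ iterates of $\phi$. A subset $F\subset M$ is called normal with respect to one of these triangulations if, for every tetrahedron $\Delta$ of it, there is a homeomorphism of $\Delta$ mapping each face of $\Delta$ onto itself and taking $F\cap\Delta$ to a finite (possibly empty) union of pairwise disjoint flat normal triangles and quadrilaterals, i.e. of sections of $\Delta$ by planes that miss the vertices of $\Delta$ and have vertices of $\Delta$ on both sides. A $\tau$-normal isotopy is an isotopy $(H_u)_{u\in[0,1]}$ of $M$ with $H_0=\mathrm{id}$ such that each $H_u$ maps every simplex of $\tau$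 onto itself. Let $F\subset M$ be an embedded closed surface no component of which is a 2-sphere. Then $F$ is $\tau$-normal if and only if it is $\tau'$-normal, up to $\tau$-normal isotopy in the forward direction. Precisely: 1. if $F$ is $\tau'$-normal, then $F$ is $\tau$-normal; 2. if $F$ is $\tau$-normal, then there is a $\tau$-normal isotopy $(H_u)$ of $M$ such that $H_1(F)$ is $\tau'$-normal. -/

import Mathlib

open Set Topology
open scoped Classical in
/-- The tetrahedra of the stellar subdivision of the simplex with vertex set `t` at the point `p`:
each of them is spanned by `p` and by the vertices of `t` other than one of them. -/
def stellarSubdivision {E : Type*} (p : E) (t : Finset E) : Set (Finset E) :=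
  {s | ∃ v ∈ t, s = insert p (t.erase v)}

/-- The tetrahedra of the `n`-th iterate of the refinement function on the tetrahedron `t`; a
tetrahedron `r` that occurs on the way is subdivided at the point `e r`. -/
def iteratedSubdivision {E : Type*} (e : Finset E → E) : ℕ → Finset E → Set (Finset E)
  | 0, t => {t}
  | n + 1, t => {s | ∃ r ∈ iteratedSubdivision e n t, s ∈ stellarSubdivision (e r) r}

/-- The open simplex (the interior of the simplex) spanned by `t`: the points with positive
barycentric coordinates. -/
def openSimplex {E : Type*} [AddCommGroup E] [Module ℝ E] (t : Finset E) : Set E :=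
  {x | ∃ w : E → ℝ, (∀ v ∈ t, 0 < w v) ∧ ∑ v ∈ t, w v = 1 ∧ ∑ v ∈ t, w v • v = x}

/-- `e` picks an interior point of every nondegenerate tetrahedron of `E`. -/
def IsInteriorPointChoice {E : Type*} [AddCommGroup E] [Module ℝ E] (e : Finset E → E) : Prop :=
  ∀ t : Finset E, t.card = 4 → AffineIndependent ℝ ((↑) : t → E) → e t ∈ openSimplex t

/-- A triangulation of the space `M` as a 3-dimensional object: a locally finite simplicial
complex, all of whose maximal simplices are tetrahedra, and a homeomorphism from its underlying
space onto `M`. The vertices are points of a normed space `E` of any dimension. (The complex being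
locally finite, the topology that its underlying space inherits from `E` is the weak topology, and
every locally finite abstract complex on a vertex set `V` occurs, for instance in `ℓ²(V)`.) -/
structure Triangulation (M : Type*) [TopologicalSpace M]
    (E : Type*) [NormedAddCommGroup E] [NormedSpace ℝ E] where
  /-- the simplicial complex -/
  complex : Geometry.SimplicialComplex ℝ E
  /-- every simplex is a face of a tetrahedron -/
  exists_tetrahedron : ∀ s ∈ complex.faces, ∃ t ∈ complex.faces, s ⊆ t ∧ t.card = 4
  /-- every point has a neighbourhood that meets only finitely many simplices -/
  locallyFinite : ∀ x ∈ complex.space, ∃ U ∈ 𝓝 x,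
    {s ∈ complex.faces | (convexHull ℝ (s : Set E) ∩ U).Nonempty}.Finite
  /-- the homeomorphism of the underlying space with `M` -/
  homeo : complex.space ≃ₜ M

namespace Triangulation

variable {M : Type*} [TopologicalSpace M] {E : Type*} [NormedAddCommGroup E] [NormedSpace ℝ E]

/-- The tetrahedra of a triangulation. -/
def tetrahedra (τ : Triangulation M E) : Set (Finset E) :=
  {t ∈ τ.complex.faces | t.card = 4}

/-- A subset of `M`, seen in the underlying space of the complex. -/
def pull (τ : Triangulation M E) (F : Set M) : Set E :=
  Subtype.val '' (τ.homeo ⁻¹' F)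

/-- The (closed) simplex of `M` that corresponds to the simplex `s` of the complex. -/
def cell (τ : Triangulation M E) (s : Finset E) : Set M :=
  τ.homeo '' (Subtype.val ⁻¹' convexHull ℝ (s : Set E))

/-- The tetrahedra of the refined triangulation: each tetrahedron `t` of the triangulation
is replaced by the `f t`-th iterate of the refinement function on `t`. -/
def refinedTetrahedra (τ : Triangulation M E) (f : τ.tetrahedra → ℕ) (e : Finset E → E) :
    Set (Finset E) :=
  ⋃ t : τ.tetrahedra, iteratedSubdivision e (f t) t

/-- `H` is a normal isotopy with respect to `τ`: an isotopy of `M` that starts at the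
identity and maps every simplex of `τ` onto itself at all times. -/
structure IsNormalIsotopy (τ : Triangulation M E) (H : unitInterval → M ≃ₜ M) : Prop where
  continuous : Continuous fun p : unitInterval × M => H p.1 p.2
  zero : ∀ x, H 0 x = x
  image_cell : ∀ u, ∀ s ∈ τ.complex.faces, H u '' τ.cell s = τ.cell s

end Triangulation

/-- `D` is a flat normal disk (a flat normal triangle or a flat normal quadrilateral) of the
tetrahedron spanned by `t`: the section by a plane that misses the vertices and has vertices on both
sides. It is a triangle linking `v` if the plane separates the vertex `v` from the other three, and
a quadrilateral linking the edge `vw` if it separates `v, w` from the other two. -/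
def IsFlatNormalDisk {E : Type*} [AddCommGroup E] [Module ℝ E] (t : Finset E) (D : Set E) : Prop :=
  ∃ l : E →ᵃ[ℝ] ℝ, (∀ v ∈ t, l v ≠ 0) ∧ (∃ v ∈ t, 0 < l v) ∧ (∃ v ∈ t, l v < 0) ∧
    D = {x ∈ convexHull ℝ (t : Set E) | l x = 0}

/-- `h` maps each face of the simplex spanned by `t` onto itself. (By the Alexander trick these are
the homeomorphisms of the simplex that are isotopic to the identity through such maps.) -/
def PreservesFaces {E : Type*} [AddCommGroup E] [Module ℝ E] [TopologicalSpace E] (t : Finset E)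
    (h : convexHull ℝ (t : Set E) ≃ₜ convexHull ℝ (t : Set E)) : Prop :=
  ∀ s ⊆ t, h '' (Subtype.val ⁻¹' convexHull ℝ (s : Set E)) =
    Subtype.val ⁻¹' convexHull ℝ (s : Set E)

/-- `G` meets the tetrahedron spanned by `t` in a finite, possibly empty, disjoint union of normal
disks: up to a homeomorphism of the tetrahedron that preserves its faces, the intersection is a
finite union of pairwise disjoint flat normal triangles and quadrilaterals. -/
def MeetsInNormalDisks {E : Type*} [AddCommGroup E] [Module ℝ E] [TopologicalSpace E]
    (t : Finset E) (G : Set E) : Prop :=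
  ∃ 𝒟 : Set (Set E), 𝒟.Finite ∧ (∀ D ∈ 𝒟, IsFlatNormalDisk t D) ∧ 𝒟.PairwiseDisjoint id ∧
    ∃ h : convexHull ℝ (t : Set E) ≃ₜ convexHull ℝ (t : Set E), PreservesFaces t h ∧
      h '' (Subtype.val ⁻¹' ⋃₀ 𝒟) = Subtype.val ⁻¹' G

/-- `G` is normal with respect to a triangulation with the given set of tetrahedra. -/
def IsNormalIn {E : Type*} [AddCommGroup E] [Module ℝ E] [TopologicalSpace E]
    (tetrahedra : Set (Finset E)) (G : Set E) : Prop :=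
  ∀ t ∈ tetrahedra, MeetsInNormalDisks t G

/-!
Normality is a condition on the single tetrahedra, so both directions are statements about one
tetrahedron and its subdivision, and `f(Δ)` iterates of the subdivision are treated one at a time. A
tetrahedron is replaced by a face of the standard simplex on a finite set `V`, a plane by the
functional that has given values at the vertices, and a tetrahedron with an interior point `o` by
the union of the facets at `o` of a simplex with five vertices (`facetsAt`). The linear map
`collapse o p` sends this union bijectively onto the facet opposite to `o`, with `o` placed at `p`.
The advantage is that the point `p` may be moved without changing the complex.

*Extending homeomorphisms.* Two flat families of sections in the same position (`SamePosition`) cut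
a face into polytopes that correspond to each other. Hence a homeomorphism between the boundaries
that respects the families extends to the face: cut along the sections one after the other and cone
(`exists_extension_of_correspondingCuts`). So homeomorphisms of pairs can be built face by face,
over whole complexes (`exists_pairHomeoOn_complex`), between sets that on each tetrahedron are
images of flat families in the same position.

*Edge weights.* In a tetrahedron the numbers of points of a flat family on the six edges determine
the family up to its position (`EdgeCounts.unique`, `exists_samePosition`). Hence two sets that are
normal in each tetrahedron of a complex are homeomorphic as soon as their edge weights agree.
Elementary arithmetic shows that the weights on the ten edges of a subdivided tetrahedron are those
of a family of planes in the *large* tetrahedron together with spheres around the subdivision point,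
if this point is placed suitably (`exists_targetWeights`, `exists_targetFamily`). Therefore every
set that is normal in the four small tetrahedra is homeomorphic to such a family (`exists_model`).

*From the subdivision to the tetrahedron.* If no sphere occurs, the model is a flat family in the
large tetrahedron, so that the set is normal there (`NormalOn.of_facets`). A sphere would be open
and closed in `F`, that is, a component of `F`, which is excluded (`not_hasSphere`).

*From the tetrahedron to the subdivision.* If the subdivision point avoids the planes, then each
plane meets each of the small tetrahedra in a flat section or not at all. So it suffices to move the
subdivision point off the surface by a homeomorphism of the tetrahedron that fixes the boundary
(`NormalOn.exists_image`). Composing these over the iterated subdivision gives one homeomorphism of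
each tetrahedron that fixes its boundary (`IsTetrahedron.exists_isInnerHomeo`). By the Alexander
trick it is isotopic to the identity (`exists_alexander`), and the isotopies of the single
tetrahedra fit together to a normal isotopy of the whole space since the triangulation is locally
finite (`exists_isotopy_space`, `exists_normalIsotopy`).
-/

set_option linter.unusedSectionVars false

/-! ### Polytopes and coning -/

section Polytopes

variable {W W' : Type*} [NormedAddCommGroup W] [NormedSpace ℝ W]
  [NormedAddCommGroup W'] [NormedSpace ℝ W']

/-- The set `A` contains the line through any two of its points. -/
def LineClosed (A : Set W) : Prop := ∀ x ∈ A, ∀ y ∈ A, ∀ r : ℝ, x + r • (y - x) ∈ A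

/-- The polytope cut out of the affine subspace `A` by the functionals in `J`. -/
def polytope (A : Set W) (J : Finset (W →L[ℝ] ℝ)) : Set W := {x ∈ A | ∀ g ∈ J, 0 ≤ g x}

/-- The points of a polytope at which all its defining functionals are positive. -/
def polytopeInterior (A : Set W) (J : Finset (W →L[ℝ] ℝ)) : Set W := {x ∈ A | ∀ g ∈ J, 0 < g x}

/-- The points of a polytope at which one of its defining functionals vanishes. -/
def polytopeBoundary (A : Set W) (J : Finset (W →L[ℝ] ℝ)) : Set W :=
  {x ∈ A | (∀ g ∈ J, 0 ≤ g x) ∧ ∃ g ∈ J, g x = 0}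

/-- The gauge of a polytope with respect to an interior point `c`: on the ray from `c` through
a boundary point it grows linearly from `0` to `1`. -/
noncomputable def radialGauge (J : Finset (W →L[ℝ] ℝ)) (c x : W) : ℝ :=
  ‖fun g : J => max 0 (1 - g.1 x / g.1 c)‖

variable {A : Set W} {J : Finset (W →L[ℝ] ℝ)} {c : W}

theorem polytopeBoundary_subset : polytopeBoundary A J ⊆ polytope A J := fun _ h => ⟨h.1, h.2.1⟩

theorem polytopeInterior_subset : polytopeInterior A J ⊆ polytope A J :=
  fun _ h => ⟨h.1, fun g hg => (h.2 g hg).le⟩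

theorem radialGauge_nonneg (x : W) : 0 ≤ radialGauge J c x := norm_nonneg _

theorem continuous_radialGauge : Continuous (radialGauge J c) := by
  unfold radialGauge
  fun_prop

theorem radialGauge_homothety (hc : c ∈ polytopeInterior A J) (x : W) {r : ℝ} (hr : 0 ≤ r) :
    radialGauge J c (c + r • (x - c)) = r * radialGauge J c x := by
  unfold radialGauge
  rw [← abs_of_nonneg hr, ← Real.norm_eq_abs, ← norm_smul, Real.norm_eq_abs, abs_of_nonneg hr]
  congr 1
  ext g
  have hg := hc.2 g.1 g.2
  have : 1 - g.1 (c + r • (x - c)) / g.1 c = r * (1 - g.1 x / g.1 c) := by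
    simp only [map_add, map_smul, map_sub, smul_eq_mul]
    field_simp
    ring
  simp only [this, Pi.smul_apply, smul_eq_mul]
  rw [mul_max_of_nonneg _ _ hr, mul_zero]

theorem radialGauge_le_one_iff (hc : c ∈ polytopeInterior A J) {x : W} (hx : x ∈ A) :
    radialGauge J c x ≤ 1 ↔ x ∈ polytope A J := by
  unfold radialGauge
  rw [pi_norm_le_iff_of_nonneg zero_le_one]
  refine ⟨fun h => ⟨hx, fun g hg => ?_⟩, fun h g => ?_⟩
  · have hg' := hc.2 g hg
    have := h ⟨g, hg⟩
    rw [Real.norm_eq_abs, abs_of_nonneg (le_max_left _ _)] at this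
    have h2 := (le_max_right _ _).trans this
    have : 0 ≤ g x / g c := by simp only at h2; linarith
    by_contra hneg
    push Not at hneg
    exact absurd (div_neg_of_neg_of_pos hneg hg') (not_lt.2 this)
  · rw [Real.norm_eq_abs, abs_of_nonneg (le_max_left _ _)]
    have hg' := hc.2 g.1 g.2
    have := div_nonneg (h.2 g.1 g.2) hg'.le
    exact max_le zero_le_one (by linarith)

theorem radialGauge_eq_one_iff (hc : c ∈ polytopeInterior A J) {x : W} (hx : x ∈ polytope A J) :
    radialGauge J c x = 1 ↔ x ∈ polytopeBoundary A J := by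
  have hle := (radialGauge_le_one_iff hc hx.1).2 hx
  refine ⟨fun h => ⟨hx.1, hx.2, ?_⟩, fun ⟨_, _, g, hg, h0⟩ => le_antisymm hle ?_⟩
  · by_contra hne
    push Not at hne
    have : radialGauge J c x < 1 := by
      unfold radialGauge
      rw [pi_norm_lt_iff zero_lt_one]
      intro g
      rw [Real.norm_eq_abs, abs_of_nonneg (le_max_left _ _)]
      have hg' := hc.2 g.1 g.2
      have := div_pos (lt_of_le_of_ne (hx.2 g.1 g.2) (hne g.1 g.2).symm) hg'
      exact max_lt zero_lt_one (by linarith)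
    linarith
  · have := norm_le_pi_norm (fun g : J => max 0 (1 - g.1 x / g.1 c)) ⟨g, hg⟩
    simpa [h0, radialGauge] using this

theorem radialGauge_center (hc : c ∈ polytopeInterior A J) : radialGauge J c c = 0 := by
  simpa using radialGauge_homothety hc c (le_refl (0 : ℝ))

theorem eq_center_of_radialGauge_eq_zero (hA : LineClosed A) (hc : c ∈ polytopeInterior A J)
    (hb : Bornology.IsBounded (polytope A J)) {x : W} (hx : x ∈ A) (h : radialGauge J c x = 0) :
    x = c := by
  by_contra hne
  have hpos : 0 < ‖x - c‖ := norm_pos_iff.2 (sub_ne_zero.2 hne)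
  obtain ⟨C, hC⟩ := hb.exists_norm_le
  have hCc := hC c (polytopeInterior_subset hc)
  have hC0 : 0 ≤ C := (norm_nonneg _).trans hCc
  have key : c + ((2 * C + 1) / ‖x - c‖) • (x - c) ∈ polytope A J := by
    rw [← radialGauge_le_one_iff hc (hA _ hc.1 _ hx _),
      radialGauge_homothety hc _ (by positivity), h]
    simp
  have h1 := hC _ key
  have h2 : ‖((2 * C + 1) / ‖x - c‖) • (x - c)‖ = 2 * C + 1 := by
    rw [norm_smul, Real.norm_of_nonneg (by positivity)]
    field_simp
  have h3 : ‖((2 * C + 1) / ‖x - c‖) • (x - c)‖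
      ≤ ‖c + ((2 * C + 1) / ‖x - c‖) • (x - c)‖ + ‖c‖ := by
    simpa using norm_sub_le (c + ((2 * C + 1) / ‖x - c‖) • (x - c)) c
  linarith

theorem homothety_mem_polytope (hA : LineClosed A) (hc : c ∈ polytopeInterior A J) {x : W}
    (hx : x ∈ polytope A J) {r : ℝ} (h0 : 0 ≤ r) (h1 : r ≤ 1) :
    c + r • (x - c) ∈ polytope A J := by
  rw [← radialGauge_le_one_iff hc (hA _ hc.1 _ hx.1 _), radialGauge_homothety hc _ h0]
  exact mul_le_one₀ h1 (norm_nonneg _) ((radialGauge_le_one_iff hc hx.1).2 hx)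

theorem radial_projection_mem (hA : LineClosed A) (hc : c ∈ polytopeInterior A J) {x : W}
    (hx : x ∈ A) (h : radialGauge J c x ≠ 0) :
    c + (radialGauge J c x)⁻¹ • (x - c) ∈ polytopeBoundary A J := by
  have h1 : radialGauge J c (c + (radialGauge J c x)⁻¹ • (x - c)) = 1 := by
    rw [radialGauge_homothety hc _ (inv_nonneg.2 (radialGauge_nonneg _)), inv_mul_cancel₀ h]
  have hm := hA _ hc.1 _ hx (radialGauge J c x)⁻¹
  exact (radialGauge_eq_one_iff hc ((radialGauge_le_one_iff hc hm).1 h1.le)).1 h1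

/-- Coning: a homeomorphism between the boundaries of two polytopes extends to the polytopes. -/
theorem exists_cone_extension {A' : Set W'} {J' : Finset (W' →L[ℝ] ℝ)} {c' : W'}
    (hA : LineClosed A) (hA' : LineClosed A') (hc : c ∈ polytopeInterior A J)
    (hc' : c' ∈ polytopeInterior A' J') (hb : Bornology.IsBounded (polytope A J))
    (hb' : Bornology.IsBounded (polytope A' J')) {φ : W → W'}
    (hφ : ContinuousOn φ (polytopeBoundary A J))
    (hbij : BijOn φ (polytopeBoundary A J) (polytopeBoundary A' J')) :
    ∃ Φ : W → W', ContinuousOn Φ (polytope A J) ∧ BijOn Φ (polytope A J) (polytope A' J') ∧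
      EqOn Φ φ (polytopeBoundary A J) := by
  set ρ := radialGauge J c with hρ
  set ρ' := radialGauge J' c' with hρ'
  set π : W → W := fun x => c + (ρ x)⁻¹ • (x - c) with hπ
  set Φ : W → W' := fun x => c' + ρ x • (φ (π x) - c') with hΦ
  have hΦc : Φ c = c' := by simp [hΦ, hρ, radialGauge_center hc]
  have hρ0 : ∀ x ∈ polytope A J, ρ x = 0 → x = c := fun x hx h =>
    eq_center_of_radialGauge_eq_zero hA hc hb hx.1 h
  have hρ0' : ∀ x ∈ polytope A' J', ρ' x = 0 → x = c' := fun x hx h =>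
    eq_center_of_radialGauge_eq_zero hA' hc' hb' hx.1 h
  have hπm : ∀ x ∈ polytope A J, ρ x ≠ 0 → π x ∈ polytopeBoundary A J := fun x hx h =>
    radial_projection_mem hA hc hx.1 h
  have hmaps : MapsTo Φ (polytope A J) (polytope A' J') := by
    intro x hx
    by_cases h : ρ x = 0
    · rw [hρ0 x hx h, hΦc]; exact polytopeInterior_subset hc'
    · exact homothety_mem_polytope hA' hc' (polytopeBoundary_subset (hbij.mapsTo (hπm x hx h)))
        (radialGauge_nonneg _) ((radialGauge_le_one_iff hc hx.1).2 hx)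
  have hρΦ : ∀ x ∈ polytope A J, ρ' (Φ x) = ρ x := by
    intro x hx
    by_cases h : ρ x = 0
    · rw [hρ0 x hx h, hΦc, hρ, hρ', radialGauge_center hc, radialGauge_center hc']
    · have hm := hbij.mapsTo (hπm x hx h)
      change radialGauge J' c' (c' + ρ x • (φ (π x) - c')) = ρ x
      rw [radialGauge_homothety hc' _ (radialGauge_nonneg _),
        (radialGauge_eq_one_iff hc' (polytopeBoundary_subset hm)).2 hm, mul_one]
  have hπinv : ∀ x, ρ x ≠ 0 → x = c + ρ x • (π x - c) := by
    intro x h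
    simp [hπ, smul_smul, mul_inv_cancel₀ h]
  have heq : EqOn Φ φ (polytopeBoundary A J) := by
    intro x hx
    have h1 : ρ x = 1 := (radialGauge_eq_one_iff hc (polytopeBoundary_subset hx)).2 hx
    simp [hΦ, hπ, h1]
  refine ⟨Φ, ?_, ⟨hmaps, ?_, ?_⟩, heq⟩
  · intro x hx
    by_cases h : ρ x = 0
    · have hxc := hρ0 x hx h
      rw [hxc] at hx ⊢
      obtain ⟨C, hC⟩ := hb'.exists_norm_le
      have hbd : ∀ y ∈ polytope A J, ‖Φ y - Φ c‖ ≤ ρ y * (2 * C) := by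
        intro y hy
        rw [hΦc]
        by_cases h : ρ y = 0
        · simp [hΦ, h]
        · have h1 := hC _ (polytopeBoundary_subset (hbij.mapsTo (hπm y hy h)))
          have h2 := hC c' (polytopeInterior_subset hc')
          have h3 : Φ y - c' = ρ y • (φ (π y) - c') := by simp [hΦ]
          rw [h3, norm_smul, Real.norm_of_nonneg (radialGauge_nonneg _)]
          exact mul_le_mul_of_nonneg_left ((norm_sub_le _ _).trans (by linarith))
            (radialGauge_nonneg _)
      have h0 : Filter.Tendsto (fun y => ρ y * (2 * C)) (𝓝[polytope A J] c) (𝓝 0) := by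
        have : Filter.Tendsto (fun y => ρ y * (2 * C)) (𝓝 c) (𝓝 (ρ c * (2 * C))) :=
          (continuous_radialGauge.mul continuous_const).tendsto c
        rw [hρ, radialGauge_center hc, zero_mul] at this
        exact this.mono_left nhdsWithin_le_nhds
      have h1 : Filter.Tendsto (fun y => Φ y - Φ c) (𝓝[polytope A J] c) (𝓝 0) :=
        squeeze_zero_norm' (Filter.eventually_of_mem self_mem_nhdsWithin hbd) h0
      simpa [ContinuousWithinAt] using h1.add_const (Φ c)
    · have hρc : ContinuousAt ρ x := continuous_radialGauge.continuousAt
      have hπc : ContinuousAt π x := by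
        apply ContinuousAt.add continuousAt_const
        exact (hρc.inv₀ h).smul (by fun_prop)
      have hnhds : ∀ᶠ y in 𝓝[polytope A J] x, π y ∈ polytopeBoundary A J := by
        have : ∀ᶠ y in 𝓝[polytope A J] x, ρ y ≠ 0 :=
          (hρc.eventually_ne h).filter_mono nhdsWithin_le_nhds
        filter_upwards [this, self_mem_nhdsWithin] with y hy hy' using hπm y hy' hy
      have h2 : Filter.Tendsto (fun y => φ (π y)) (𝓝[polytope A J] x) (𝓝 (φ (π x))) := by
        refine (hφ (π x) (hπm x hx h)).tendsto.comp ?_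
        exact tendsto_nhdsWithin_iff.2 ⟨hπc.tendsto.mono_left nhdsWithin_le_nhds, hnhds⟩
      exact tendsto_const_nhds.add
        ((hρc.tendsto.mono_left nhdsWithin_le_nhds).smul (h2.sub tendsto_const_nhds))
  · intro x hx y hy hxy
    have h1 : ρ x = ρ y := by rw [← hρΦ x hx, ← hρΦ y hy, hxy]
    by_cases h : ρ x = 0
    · rw [hρ0 x hx h, hρ0 y hy (h1 ▸ h)]
    · have h' : ρ y ≠ 0 := h1 ▸ h
      have h2 : φ (π x) = φ (π y) := by
        have : ρ y • (φ (π x) - c') = ρ y • (φ (π y) - c') := by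
          simpa [hΦ, h1] using hxy
        simpa using smul_right_injective _ h' this
      have h3 := hbij.injOn (hπm x hx h) (hπm y hy h') h2
      rw [hπinv x h, hπinv y h', h3, h1]
  · intro y hy
    by_cases h : ρ' y = 0
    · exact ⟨c, polytopeInterior_subset hc, by rw [hΦc, hρ0' y hy h]⟩
    · have hb := radial_projection_mem hA' hc' hy.1 h
      obtain ⟨b, hb1, hb2⟩ := hbij.surjOn hb
      have hρb : ρ b = 1 := (radialGauge_eq_one_iff hc (polytopeBoundary_subset hb1)).2 hb1
      have hle : ρ' y ≤ 1 := (radialGauge_le_one_iff hc' hy.1).2 hy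
      refine ⟨c + ρ' y • (b - c), homothety_mem_polytope hA hc (polytopeBoundary_subset hb1)
        (radialGauge_nonneg _) hle, ?_⟩
      have h1 : ρ (c + ρ' y • (b - c)) = ρ' y := by
        rw [hρ, radialGauge_homothety hc _ (radialGauge_nonneg _), ← hρ, hρb, mul_one]
      have h2 : π (c + ρ' y • (b - c)) = b := by
        simp only [hπ]
        rw [h1]
        simp [smul_smul, inv_mul_cancel₀ h]
      simp only [hΦ]
      rw [h1, h2, hb2]
      simp only [← hρ', add_sub_cancel_left, smul_smul, mul_inv_cancel₀ h, one_smul]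
      abel

end Polytopes

/-! ### Cutting along hyperplane sections -/

section Cutting

variable {W W' : Type*} [NormedAddCommGroup W] [NormedSpace ℝ W]
  [NormedAddCommGroup W'] [NormedSpace ℝ W']

theorem BijOn.union_of_inter {α β : Type*} {f : α → β} {S T : Set α} {S' T' : Set β}
    (h₁ : BijOn f S S') (h₂ : BijOn f T T') (h : BijOn f (S ∩ T) (S' ∩ T')) :
    BijOn f (S ∪ T) (S' ∪ T') := by
  have key : ∀ x ∈ S, ∀ y ∈ T, f x = f y → x = y := by
    intro x hx y hy hxy
    obtain ⟨z, hz, hzx⟩ := h.surjOn ⟨h₁.mapsTo hx, hxy ▸ h₂.mapsTo hy⟩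
    rw [← h₁.injOn hz.1 hx hzx, h₂.injOn hz.2 hy (hzx.trans hxy)]
  refine h₁.union h₂ ?_
  rintro x (hx | hx) y (hy | hy) hxy
  · exact h₁.injOn hx hy hxy
  · exact key x hx y hy hxy
  · exact (key y hy x hx hxy.symm).symm
  · exact h₂.injOn hx hy hxy

theorem sign_eq_of_convex {S : Set W} (hS : Convex ℝ S) {l : W → ℝ} (hl : ContinuousOn l S)
    (h : ∀ x ∈ S, l x ≠ 0) {x y : W} (hx : x ∈ S) (hy : y ∈ S) :
    SignType.sign (l x) = SignType.sign (l y) := by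
  rcases lt_or_gt_of_ne (h x hx) with h1 | h1 <;> rcases lt_or_gt_of_ne (h y hy) with h2 | h2
  · rw [sign_neg h1, sign_neg h2]
  · obtain ⟨z, hz, h0⟩ := hS.isPreconnected.intermediate_value hx hy hl ⟨h1.le, h2.le⟩
    exact absurd h0 (h z hz)
  · obtain ⟨z, hz, h0⟩ := hS.isPreconnected.intermediate_value hy hx hl ⟨h2.le, h1.le⟩
    exact absurd h0 (h z hz)
  · rw [sign_pos h1, sign_pos h2]

variable {A : Set W} {J : Finset (W →L[ℝ] ℝ)} {A' : Set W'} {J' : Finset (W' →L[ℝ] ℝ)}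

theorem LineClosed.inter_zero (hA : LineClosed A) (m : W →L[ℝ] ℝ) :
    LineClosed (A ∩ {x | m x = 0}) := by
  rintro x ⟨hx, hx0⟩ y ⟨hy, hy0⟩ r
  refine ⟨hA x hx y hy r, ?_⟩
  simp only [mem_ofPred_eq] at *
  simp [hx0, hy0]

theorem LineClosed.convex_polytope (hA : LineClosed A) : Convex ℝ (polytope A J) := by
  rw [convex_iff_segment_subset]
  rintro x hx y hy z hz
  rw [segment_eq_image'] at hz
  obtain ⟨r, ⟨h0, h1⟩, rfl⟩ := hz
  refine ⟨hA x hx.1 y hy.1 r, fun g hg => ?_⟩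
  have h2 := hx.2 g hg
  have h3 := hy.2 g hg
  simp only [map_add, map_smul, map_sub, smul_eq_mul]
  nlinarith

theorem isClosed_polytope (hA : IsClosed A) : IsClosed (polytope A J) := by
  have : polytope A J = A ∩ ⋂ g ∈ J, {x | 0 ≤ g x} := by
    ext x; simp [polytope]
  rw [this]
  exact hA.inter (isClosed_biInter fun g _ => isClosed_le continuous_const g.continuous)

theorem isClosed_polytopeBoundary (hA : IsClosed A) : IsClosed (polytopeBoundary A J) := by
  have : polytopeBoundary A J = polytope A J ∩ ⋃ g ∈ J, {x | g x = 0} := by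
    ext x; simp [polytope, polytopeBoundary, and_assoc]; tauto
  rw [this]
  exact (isClosed_polytope hA).inter
    (J.finite_toSet.isClosed_biUnion fun g _ => isClosed_eq g.continuous continuous_const)

/-- The hyperplane `m = 0` passes through the interior of the polytope. -/
def CutsPolytope (A : Set W) (J : Finset (W →L[ℝ] ℝ)) (m : W →L[ℝ] ℝ) : Prop :=
  (∃ x ∈ polytopeInterior A J, 0 < m x) ∧ ∃ x ∈ polytopeInterior A J, m x < 0

theorem CutsPolytope.neg {m : W →L[ℝ] ℝ} (h : CutsPolytope A J m) : CutsPolytope A J (-m) := by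
  obtain ⟨⟨x, hx, hx'⟩, y, hy, hy'⟩ := h
  exact ⟨⟨y, hy, by simpa using hy'⟩, x, hx, by simpa using hx'⟩

theorem LineClosed.interior_segment (hA : LineClosed A) {x y : W} (hx : x ∈ polytopeInterior A J)
    (hy : y ∈ polytopeInterior A J) {r : ℝ} (h0 : 0 ≤ r) (h1 : r ≤ 1) :
    x + r • (y - x) ∈ polytopeInterior A J := by
  refine ⟨hA x hx.1 y hy.1 r, fun g hg => ?_⟩
  have h2 := hx.2 g hg
  have h3 := hy.2 g hg
  simp only [map_add, map_smul, map_sub, smul_eq_mul]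
  rcases h1.lt_or_eq with h1 | rfl
  · nlinarith [mul_nonneg h0 h3.le, mul_pos (sub_pos.2 h1) h2]
  · linarith

theorem CutsPolytope.exists_zero (hA : LineClosed A) {m : W →L[ℝ] ℝ} (h : CutsPolytope A J m) :
    ∃ x ∈ polytopeInterior A J, m x = 0 := by
  obtain ⟨⟨x, hx, hx'⟩, y, hy, hy'⟩ := h
  have hd : 0 < m x - m y := by linarith
  refine ⟨x + (m x / (m x - m y)) • (y - x), hA.interior_segment hx hy (by positivity)
    ((div_le_one hd).2 (by linarith)), ?_⟩
  simp only [map_add, map_smul, map_sub, smul_eq_mul]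
  field_simp
  ring

/-- A hyperplane that cuts a polytope also cuts its half `m ≥ 0`, if some interior point of the
section lies in `m > 0`. -/
theorem CutsPolytope.insert [DecidableEq (W →L[ℝ] ℝ)] (hA : LineClosed A) {l m : W →L[ℝ] ℝ}
    (h : CutsPolytope A J l) {z : W}
    (hz : z ∈ polytopeInterior A J) (hl : l z = 0) (hm : 0 < m z) :
    CutsPolytope A (insert m J) l := by
  have key : ∀ x ∈ polytopeInterior A J, ∃ r : ℝ, 0 < r ∧
      z + r • (x - z) ∈ polytopeInterior A (Insert.insert m J) := by
    intro x hx
    have : ∀ᶠ r in 𝓝[>] (0 : ℝ), 0 < m (z + r • (x - z)) := by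
      have hc : Filter.Tendsto (fun r : ℝ => m (z + r • (x - z))) (𝓝 0) (𝓝 (m z)) := by
        have : Continuous fun r : ℝ => m (z + r • (x - z)) := by fun_prop
        simpa using this.tendsto 0
      exact (hc.eventually (lt_mem_nhds hm)).filter_mono nhdsWithin_le_nhds
    obtain ⟨r, hr, hr0, hr1⟩ := (this.and (Ioo_mem_nhdsGT (zero_lt_one' ℝ))).exists
    refine ⟨r, hr0, ?_⟩
    have h1 := hA.interior_segment hz hx hr0.le hr1.le
    refine ⟨h1.1, fun g hg => ?_⟩
    rcases Finset.mem_insert.1 hg with rfl | hg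
    · exact hr
    · exact h1.2 g hg
  obtain ⟨⟨x, hx, hx'⟩, y, hy, hy'⟩ := h
  obtain ⟨r, hr, hr'⟩ := key x hx
  obtain ⟨s, hs, hs'⟩ := key y hy
  refine ⟨⟨_, hr', ?_⟩, _, hs', ?_⟩
  · simp only [map_add, map_smul, map_sub, smul_eq_mul, hl]
    nlinarith [mul_pos hr hx']
  · simp only [map_add, map_smul, map_sub, smul_eq_mul, hl]
    nlinarith [mul_neg_of_pos_of_neg hs hy']

variable {ι : Type*}

/-- Two polytopes with a system of hyperplane sections each. The sections of each polytope are
pairwise disjoint, and corresponding sections are situated in the same way with respect to each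
other. -/
structure CorrespondingCuts (I : Finset ι) (l : ι → W →L[ℝ] ℝ) (l' : ι → W' →L[ℝ] ℝ)
    (A : Set W) (J : Finset (W →L[ℝ] ℝ)) (A' : Set W') (J' : Finset (W' →L[ℝ] ℝ)) : Prop where
  isClosed : IsClosed A
  isClosed' : IsClosed A'
  lineClosed : LineClosed A
  lineClosed' : LineClosed A'
  isBounded : Bornology.IsBounded (polytope A J)
  isBounded' : Bornology.IsBounded (polytope A' J')
  nonempty : (polytopeInterior A J).Nonempty
  nonempty' : (polytopeInterior A' J').Nonempty
  disjoint : ∀ i ∈ I, ∀ k ∈ I, i ≠ k → ∀ x ∈ polytope A J, l k x = 0 → l i x ≠ 0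
  disjoint' : ∀ i ∈ I, ∀ k ∈ I, i ≠ k → ∀ x ∈ polytope A' J', l' k x = 0 → l' i x ≠ 0
  side : ∀ i ∈ I, ∀ k ∈ I, i ≠ k → ∀ x ∈ polytope A J, ∀ x' ∈ polytope A' J', l k x = 0 →
    l' k x' = 0 → SignType.sign (l i x) = SignType.sign (l' i x')
  cuts : ∀ i ∈ I, (∀ x ∈ polytope A J, ∀ x' ∈ polytope A' J',
      l i x ≠ 0 ∧ SignType.sign (l i x) = SignType.sign (l' i x')) ∨
    (CutsPolytope A J (l i) ∧ CutsPolytope A' J' (l' i))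

theorem mem_polytope_inter_zero {m : W →L[ℝ] ℝ} {x : W} :
    x ∈ polytope (A ∩ {x | m x = 0}) J ↔ x ∈ polytope A J ∧ m x = 0 := by
  simp only [polytope, mem_ofPred_eq, mem_inter_iff]; tauto

theorem mem_polytopeBoundary_inter_zero {m : W →L[ℝ] ℝ} {x : W} :
    x ∈ polytopeBoundary (A ∩ {x | m x = 0}) J ↔ x ∈ polytopeBoundary A J ∧ m x = 0 := by
  simp only [polytopeBoundary, mem_ofPred_eq, mem_inter_iff]; tauto

/-- `φ` maps `S` homeomorphically onto `S'` and matches the signs of the functionals. -/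
structure SignHomeoOn (I : Finset ι) (l : ι → W →L[ℝ] ℝ) (l' : ι → W' →L[ℝ] ℝ)
    (S : Set W) (S' : Set W') (φ : W → W') : Prop where
  continuousOn : ContinuousOn φ S
  bijOn : BijOn φ S S'
  sign : ∀ x ∈ S, ∀ i ∈ I, SignType.sign (l i x) = SignType.sign (l' i (φ x))

theorem SignHomeoOn.bijOn_restrict {I : Finset ι} {l : ι → W →L[ℝ] ℝ} {l' : ι → W' →L[ℝ] ℝ}
    {S : Set W} {S' : Set W'} {φ : W → W'} (h : SignHomeoOn I l l' S S' φ) {i : ι} (hi : i ∈ I)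
    (p : SignType → Prop) :
    BijOn φ (S ∩ {x | p (SignType.sign (l i x))}) (S' ∩ {x | p (SignType.sign (l' i x))}) := by
  refine ⟨fun x hx => ⟨h.bijOn.mapsTo hx.1, ?_⟩, h.bijOn.injOn.mono inter_subset_left, ?_⟩
  · have := hx.2
    rwa [mem_ofPred_eq, h.sign x hx.1 i hi] at this
  · rintro y ⟨hy, hy'⟩
    obtain ⟨x, hx, rfl⟩ := h.bijOn.surjOn hy
    refine ⟨x, ⟨hx, ?_⟩, rfl⟩
    rwa [mem_ofPred_eq, h.sign x hx i hi]

variable [DecidableEq (W →L[ℝ] ℝ)] [DecidableEq (W' →L[ℝ] ℝ)]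

theorem polytope_insert_subset {m : W →L[ℝ] ℝ} : polytope A (insert m J) ⊆ polytope A J :=
  fun _ hx => ⟨hx.1, fun g hg => hx.2 g (Finset.mem_insert_of_mem hg)⟩

theorem polytopeInterior_insert {m : W →L[ℝ] ℝ} {x : W} (hx : x ∈ polytopeInterior A J)
    (h : 0 < m x) : x ∈ polytopeInterior A (insert m J) :=
  ⟨hx.1, fun g hg => (Finset.mem_insert.1 hg).elim (fun e => e ▸ h) (hx.2 g)⟩

theorem mem_polytope_insert {m : W →L[ℝ] ℝ} {x : W} :
    x ∈ polytope A (insert m J) ↔ x ∈ polytope A J ∧ 0 ≤ m x := by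
  simp [polytope, and_assoc, and_comm (a := 0 ≤ m x)]

theorem polytopeBoundary_insert {m : W →L[ℝ] ℝ} :
    polytopeBoundary A (insert m J) =
      (polytopeBoundary A J ∩ {x | 0 ≤ m x}) ∪ polytope (A ∩ {x | m x = 0}) J := by
  ext x
  simp only [polytopeBoundary, polytope, Finset.forall_mem_insert, Finset.exists_mem_insert,
    mem_ofPred_eq, mem_inter_iff, mem_union]
  constructor
  · rintro ⟨hx, ⟨h1, h2⟩, h3 | h3⟩
    · exact Or.inr ⟨⟨hx, h3⟩, h2⟩
    · exact Or.inl ⟨⟨hx, h2, h3⟩, h1⟩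
  · rintro (⟨⟨hx, h1, h2⟩, h3⟩ | ⟨⟨hx, h1⟩, h2⟩)
    · exact ⟨hx, ⟨h3, h1⟩, Or.inr h2⟩
    · exact ⟨hx, ⟨h1.ge, h2⟩, Or.inl h1⟩

/-- Corresponding cuts of two polytopes restrict to corresponding cuts of the halves `m ≥ 0` and
`m' ≥ 0`, if these hyperplanes miss all the cuts and lie on corresponding sides of them. -/
theorem CorrespondingCuts.insert {I : Finset ι} {l : ι → W →L[ℝ] ℝ} {l' : ι → W' →L[ℝ] ℝ}
    (H : CorrespondingCuts I l l' A J A' J') {m : W →L[ℝ] ℝ} {m' : W' →L[ℝ] ℝ}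
    (hm : CutsPolytope A J m) (hm' : CutsPolytope A' J' m')
    (hd : ∀ i ∈ I, ∀ x ∈ polytope A J, l i x = 0 → m x ≠ 0)
    (hd' : ∀ i ∈ I, ∀ x ∈ polytope A' J', l' i x = 0 → m' x ≠ 0)
    (hs : ∀ i ∈ I, ∀ x ∈ polytope A J, ∀ x' ∈ polytope A' J', m x = 0 → m' x' = 0 →
      SignType.sign (l i x) = SignType.sign (l' i x'))
    (hs' : ∀ i ∈ I, ∀ x ∈ polytope A J, ∀ x' ∈ polytope A' J', l i x = 0 → l' i x' = 0 →
      SignType.sign (m x) = SignType.sign (m' x')) :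
    CorrespondingCuts I l l' A (insert m J) A' (insert m' J') where
  isClosed := H.isClosed
  isClosed' := H.isClosed'
  lineClosed := H.lineClosed
  lineClosed' := H.lineClosed'
  isBounded := H.isBounded.subset polytope_insert_subset
  isBounded' := H.isBounded'.subset polytope_insert_subset
  nonempty := by obtain ⟨⟨x, hx, hx'⟩, -⟩ := hm; exact ⟨x, polytopeInterior_insert hx hx'⟩
  nonempty' := by obtain ⟨⟨x, hx, hx'⟩, -⟩ := hm'; exact ⟨x, polytopeInterior_insert hx hx'⟩
  disjoint i hi k hk hik x hx := H.disjoint i hi k hk hik x (polytope_insert_subset hx)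
  disjoint' i hi k hk hik x hx := H.disjoint' i hi k hk hik x (polytope_insert_subset hx)
  side i hi k hk hik x hx x' hx' := H.side i hi k hk hik x (polytope_insert_subset hx) x'
    (polytope_insert_subset hx')
  cuts i hi := by
    rcases H.cuts i hi with h | ⟨h, h'⟩
    · exact Or.inl fun x hx x' hx' => h x (polytope_insert_subset hx) x'
        (polytope_insert_subset hx')
    obtain ⟨z, hz, hz0⟩ := h.exists_zero H.lineClosed
    obtain ⟨z', hz', hz0'⟩ := h'.exists_zero H.lineClosed'
    have hzz := hs' i hi z (polytopeInterior_subset hz) z' (polytopeInterior_subset hz') hz0 hz0'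
    rcases lt_or_gt_of_ne (hd i hi z (polytopeInterior_subset hz) hz0) with hneg | hpos
    · left
      -- the sections by `l i` and `l' i` lie on the negative sides of `m` and `m'`
      have hneg' : m' z' < 0 := by
        rw [sign_neg hneg, eq_comm, sign_eq_neg_one_iff] at hzz; exact hzz
      have key : ∀ x ∈ polytope A (Insert.insert m J), l i x ≠ 0 := by
        intro x hx hx0
        rw [mem_polytope_insert] at hx
        have := sign_eq_of_convex (S := polytope (A ∩ {x | l i x = 0}) J) (l := m)
          (H.lineClosed.inter_zero _).convex_polytope m.continuous.continuousOn
          (fun y hy => hd i hi y (mem_polytope_inter_zero.1 hy).1 (mem_polytope_inter_zero.1 hy).2)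
          (mem_polytope_inter_zero.2 ⟨hx.1, hx0⟩)
          (mem_polytope_inter_zero.2 ⟨polytopeInterior_subset hz, hz0⟩)
        rw [sign_neg hneg, sign_eq_neg_one_iff] at this
        linarith [hx.2]
      have key' : ∀ x ∈ polytope A' (Insert.insert m' J'), l' i x ≠ 0 := by
        intro x hx hx0
        rw [mem_polytope_insert] at hx
        have := sign_eq_of_convex (S := polytope (A' ∩ {x | l' i x = 0}) J') (l := m')
          (H.lineClosed'.inter_zero _).convex_polytope m'.continuous.continuousOn
          (fun y hy => hd' i hi y (mem_polytope_inter_zero.1 hy).1 (mem_polytope_inter_zero.1 hy).2)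
          (mem_polytope_inter_zero.2 ⟨hx.1, hx0⟩)
          (mem_polytope_inter_zero.2 ⟨polytopeInterior_subset hz', hz0'⟩)
        rw [sign_neg hneg', sign_eq_neg_one_iff] at this
        linarith [hx.2]
      obtain ⟨d, hd1, hd2⟩ := hm.exists_zero H.lineClosed
      obtain ⟨d', hd1', hd2'⟩ := hm'.exists_zero H.lineClosed'
      intro x hx x' hx'
      refine ⟨key x hx, ?_⟩
      rw [sign_eq_of_convex H.lineClosed.convex_polytope (l i).continuous.continuousOn key hx
          (mem_polytope_insert.2 ⟨polytopeInterior_subset hd1, hd2.ge⟩),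
        sign_eq_of_convex H.lineClosed'.convex_polytope (l' i).continuous.continuousOn key' hx'
          (mem_polytope_insert.2 ⟨polytopeInterior_subset hd1', hd2'.ge⟩)]
      exact hs i hi d (polytopeInterior_subset hd1) d' (polytopeInterior_subset hd1') hd2 hd2'
    · right
      have hpos' : 0 < m' z' := by rw [sign_pos hpos, eq_comm, sign_eq_one_iff] at hzz; exact hzz
      exact ⟨h.insert H.lineClosed hz hz0 hpos, h'.insert H.lineClosed' hz' hz0' hpos'⟩

/-- A homeomorphism of the boundaries of two polytopes and of their sections by `m` and `m'`
restricts to one of the boundaries of the halves `m ≥ 0` and `m' ≥ 0`. -/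
theorem SignHomeoOn.boundary_half {I : Finset ι} {l : ι → W →L[ℝ] ℝ}
    {l' : ι → W' →L[ℝ] ℝ} (H : CorrespondingCuts I l l' A J A' J')
    {m : W →L[ℝ] ℝ} {m' : W' →L[ℝ] ℝ} {φ : W → W'}
    (hφ : SignHomeoOn I l l' (polytopeBoundary A J) (polytopeBoundary A' J') φ)
    (hφm : ∀ x ∈ polytopeBoundary A J, SignType.sign (m x) = SignType.sign (m' (φ x)))
    (hD : SignHomeoOn I l l' (polytope (A ∩ {x | m x = 0}) J)
      (polytope (A' ∩ {x | m' x = 0}) J') φ) :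
    SignHomeoOn I l l' (polytopeBoundary A (insert m J)) (polytopeBoundary A' (insert m' J'))
      φ := by
  have h1 : BijOn φ (polytopeBoundary A J ∩ {x | 0 ≤ m x})
      (polytopeBoundary A' J' ∩ {x | 0 ≤ m' x}) := by
    have := (SignHomeoOn.bijOn_restrict (I := {()}) (l := fun _ => m) (l' := fun _ => m')
      ⟨hφ.continuousOn, hφ.bijOn, fun x hx _ _ => hφm x hx⟩ (Finset.mem_singleton_self _)
      (fun s => 0 ≤ s))
    simpa [sign_nonneg_iff] using this
  have h2 : BijOn φ (polytopeBoundary A J ∩ {x | m x = 0})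
      (polytopeBoundary A' J' ∩ {x | m' x = 0}) := by
    have := (SignHomeoOn.bijOn_restrict (I := {()}) (l := fun _ => m) (l' := fun _ => m')
      ⟨hφ.continuousOn, hφ.bijOn, fun x hx _ _ => hφm x hx⟩ (Finset.mem_singleton_self _)
      (fun s => s = 0))
    simpa using this
  rw [polytopeBoundary_insert, polytopeBoundary_insert]
  refine ⟨?_, ?_, ?_⟩
  · refine ContinuousOn.union_of_isClosed (hφ.continuousOn.mono inter_subset_left)
      hD.continuousOn ?_ ?_
    · exact (isClosed_polytopeBoundary H.isClosed).inter
        (isClosed_le continuous_const m.continuous)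
    · exact isClosed_polytope (H.isClosed.inter (isClosed_eq m.continuous continuous_const))
  · refine BijOn.union_of_inter h1 hD.bijOn ?_
    convert h2 using 1 <;>
    · ext x
      simp only [mem_inter_iff, mem_polytope_inter_zero, mem_ofPred_eq]
      exact ⟨fun h => ⟨h.1.1, h.2.2⟩, fun h => ⟨⟨h.1, h.2.ge⟩, polytopeBoundary_subset h.1, h.2⟩⟩
  · rintro x (hx | hx) i hi
    · exact hφ.sign x hx.1 i hi
    · exact hD.sign x hx i hi

/-- A homeomorphism between the boundaries of two polytopes that matches the traces of two
corresponding systems of hyperplane sections extends to a homeomorphism between the polytopes that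
matches the sections: extend it over one section by coning, and go on with the two halves. -/
theorem exists_extension_of_correspondingCuts {I : Finset ι} :
    ∀ {A : Set W} {J : Finset (W →L[ℝ] ℝ)} {A' : Set W'} {J' : Finset (W' →L[ℝ] ℝ)}
      {l : ι → W →L[ℝ] ℝ} {l' : ι → W' →L[ℝ] ℝ}, CorrespondingCuts I l l' A J A' J' →
      ∀ {φ : W → W'}, SignHomeoOn I l l' (polytopeBoundary A J) (polytopeBoundary A' J') φ →
      ∃ Φ : W → W', SignHomeoOn I l l' (polytope A J) (polytope A' J') Φ ∧
        EqOn Φ φ (polytopeBoundary A J) := by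
  classical
  induction I using Finset.induction_on with
  | empty =>
    intro A J A' J' l l' H φ hφ
    obtain ⟨c, hc⟩ := H.nonempty
    obtain ⟨c', hc'⟩ := H.nonempty'
    obtain ⟨Φ, h1, h2, h3⟩ := exists_cone_extension H.lineClosed H.lineClosed' hc hc' H.isBounded
      H.isBounded' hφ.continuousOn hφ.bijOn
    exact ⟨Φ, ⟨h1, h2, by simp⟩, h3⟩
  | insert k I hk ih =>
    intro A J A' J' l l' H φ hφ
    have hne : ∀ i ∈ I, i ≠ k := fun i hi h => hk (h ▸ hi)
    have hkI : k ∈ insert k I := Finset.mem_insert_self _ _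
    have hII : ∀ i ∈ I, i ∈ insert k I := fun i hi => Finset.mem_insert_of_mem hi
    have HI : CorrespondingCuts I l l' A J A' J' :=
      { H with
        disjoint := fun i hi j hj => H.disjoint i (hII i hi) j (hII j hj)
        disjoint' := fun i hi j hj => H.disjoint' i (hII i hi) j (hII j hj)
        side := fun i hi j hj => H.side i (hII i hi) j (hII j hj)
        cuts := fun i hi => H.cuts i (hII i hi) }
    have hφI : SignHomeoOn I l l' (polytopeBoundary A J) (polytopeBoundary A' J') φ :=
      ⟨hφ.continuousOn, hφ.bijOn, fun x hx i hi => hφ.sign x hx i (hII i hi)⟩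
    rcases H.cuts k hkI with hnc | ⟨hck, hck'⟩
    · obtain ⟨Φ, h, heq⟩ := ih HI hφI
      refine ⟨Φ, ⟨h.continuousOn, h.bijOn, fun x hx i hi => ?_⟩, heq⟩
      rcases Finset.mem_insert.1 hi with rfl | hi
      · exact (hnc x hx _ (h.bijOn.mapsTo hx)).2
      · exact h.sign x hx i hi
    -- extend over the section by `l k`
    obtain ⟨c, hc, hc0⟩ := hck.exists_zero H.lineClosed
    obtain ⟨c', hc', hc0'⟩ := hck'.exists_zero H.lineClosed'
    have hbd : BijOn φ (polytopeBoundary (A ∩ {x | l k x = 0}) J)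
        (polytopeBoundary (A' ∩ {x | l' k x = 0}) J') := by
      have := hφ.bijOn_restrict hkI (fun s => s = 0)
      convert this using 1 <;>
      · ext x
        simp [mem_polytopeBoundary_inter_zero]
    have hsub : ∀ x, x ∈ polytopeBoundary (A ∩ {x | l k x = 0}) J ↔
      x ∈ polytopeBoundary A J ∧ l k x = 0 := fun x => mem_polytopeBoundary_inter_zero
    obtain ⟨ψ, hψ1, hψ2, hψ3⟩ := exists_cone_extension (c := c) (c' := c')
      (H.lineClosed.inter_zero (l k)) (H.lineClosed'.inter_zero (l' k))
      ⟨⟨hc.1, hc0⟩, hc.2⟩ ⟨⟨hc'.1, hc0'⟩, hc'.2⟩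
      (H.isBounded.subset fun x hx => (mem_polytope_inter_zero.1 hx).1)
      (H.isBounded'.subset fun x hx => (mem_polytope_inter_zero.1 hx).1)
      (hφ.continuousOn.mono fun x hx => ((hsub x).1 hx).1) hbd
    set χ : W → W' := fun x => if l k x = 0 then ψ x else φ x with hχ
    have hχφ : EqOn χ φ (polytopeBoundary A J) := by
      intro x hx
      by_cases h : l k x = 0
      · simp only [hχ, h, if_true]; exact hψ3 ((hsub x).2 ⟨hx, h⟩)
      · simp [hχ, h]
    have hχψ : EqOn χ ψ (polytope (A ∩ {x | l k x = 0}) J) := by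
      intro x hx
      simp [hχ, (mem_polytope_inter_zero.1 hx).2]
    have hχ1 : SignHomeoOn I l l' (polytopeBoundary A J) (polytopeBoundary A' J') χ :=
      ⟨hφI.continuousOn.congr hχφ, hφI.bijOn.congr hχφ.symm, fun x hx i hi => by
        rw [hχφ hx]; exact hφI.sign x hx i hi⟩
    have hχ2 : SignHomeoOn I l l' (polytope (A ∩ {x | l k x = 0}) J)
        (polytope (A' ∩ {x | l' k x = 0}) J') χ := by
      refine ⟨hψ1.congr hχψ, hψ2.congr hχψ.symm, fun x hx i hi => ?_⟩
      rw [hχψ hx]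
      have h1 := mem_polytope_inter_zero.1 hx
      have h2 := mem_polytope_inter_zero.1 (hψ2.mapsTo hx)
      exact H.side i (hII i hi) k hkI (hne i hi) x h1.1 _ h2.1 h1.2 h2.2
    have hχk : ∀ x ∈ polytopeBoundary A J,
        SignType.sign (l k x) = SignType.sign (l' k (χ x)) := fun x hx => by
      rw [hχφ hx]; exact hφ.sign x hx k hkI
    have hd : ∀ i ∈ I, ∀ x ∈ polytope A J, l i x = 0 → l k x ≠ 0 := fun i hi x hx h h' =>
      H.disjoint i (hII i hi) k hkI (hne i hi) x hx h' h
    have hd' : ∀ i ∈ I, ∀ x ∈ polytope A' J', l' i x = 0 → l' k x ≠ 0 := fun i hi x hx h h' =>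
      H.disjoint' i (hII i hi) k hkI (hne i hi) x hx h' h
    have hs : ∀ i ∈ I, ∀ x ∈ polytope A J, ∀ x' ∈ polytope A' J', l i x = 0 → l' i x' = 0 →
        SignType.sign (l k x) = SignType.sign (l' k x') := fun i hi =>
      H.side k hkI i (hII i hi) (hne i hi).symm
    have Hp : CorrespondingCuts I l l' A (insert (l k) J) A' (insert (l' k) J') :=
      HI.insert hck hck' hd hd' (fun i hi => H.side i (hII i hi) k hkI (hne i hi)) hs
    have Hm : CorrespondingCuts I l l' A (insert (-l k) J) A' (insert (-l' k) J') := by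
      refine HI.insert hck.neg hck'.neg ?_ ?_ ?_ ?_
      · simpa using hd
      · simpa using hd'
      · simpa using fun i hi => H.side i (hII i hi) k hkI (hne i hi)
      · simpa [Left.sign_neg] using hs
    obtain ⟨Φp, hp, hpe⟩ := ih Hp (SignHomeoOn.boundary_half HI hχ1 hχk hχ2)
    obtain ⟨Φm, hm, hme⟩ := ih Hm (SignHomeoOn.boundary_half HI hχ1
      (by simpa [Left.sign_neg] using hχk) (by simpa using hχ2))
    have hDp : ∀ x ∈ polytope A J, l k x = 0 → Φp x = χ x := fun x hx h0 =>
      hpe (by rw [polytopeBoundary_insert]; exact Or.inr (mem_polytope_inter_zero.2 ⟨hx, h0⟩))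
    have hDm : ∀ x ∈ polytope A J, l k x = 0 → Φm x = χ x := fun x hx h0 =>
      hme (by
        rw [polytopeBoundary_insert]
        exact Or.inr (mem_polytope_inter_zero.2 ⟨hx, by simpa using h0⟩))
    set Φ : W → W' := fun x => if 0 ≤ l k x then Φp x else Φm x with hΦ
    have hΦp : EqOn Φ Φp (polytope A (insert (l k) J)) := by
      intro x hx
      simp [hΦ, (mem_polytope_insert.1 hx).2]
    have hΦm : EqOn Φ Φm (polytope A (insert (-l k) J)) := by
      intro x hx
      have hx := mem_polytope_insert.1 hx
      have hle : l k x ≤ 0 := by simpa using hx.2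
      rcases hle.lt_or_eq with h | h
      · simp [hΦ, not_le.2 h]
      · simp only [hΦ, h, le_refl, if_true]
        rw [hDp x hx.1 h, hDm x hx.1 h]
    have hΦD : EqOn Φ χ (polytope (A ∩ {x | l k x = 0}) J) := by
      intro x hx
      have hx := mem_polytope_inter_zero.1 hx
      rw [hΦp (mem_polytope_insert.2 ⟨hx.1, hx.2.ge⟩), hDp x hx.1 hx.2]
    have hun : polytope A J = polytope A (insert (l k) J) ∪ polytope A (insert (-l k) J) := by
      ext x
      simp only [mem_union, mem_polytope_insert, ← and_or_left]
      simp [le_total]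
    have hun' : polytope A' J' = polytope A' (insert (l' k) J') ∪
        polytope A' (insert (-l' k) J') := by
      ext x
      simp only [mem_union, mem_polytope_insert, ← and_or_left]
      simp [le_total]
    have hin : polytope A (insert (l k) J) ∩ polytope A (insert (-l k) J) =
        polytope (A ∩ {x | l k x = 0}) J := by
      ext x
      simp only [mem_inter_iff, mem_polytope_insert, mem_polytope_inter_zero]
      simp only [neg_apply, Left.nonneg_neg_iff]
      exact ⟨fun h => ⟨h.1.1, le_antisymm h.2.2 h.1.2⟩, fun h => ⟨⟨h.1, h.2.ge⟩, h.1, h.2.le⟩⟩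
    have hin' : polytope A' (insert (l' k) J') ∩ polytope A' (insert (-l' k) J') =
        polytope (A' ∩ {x | l' k x = 0}) J' := by
      ext x
      simp only [mem_inter_iff, mem_polytope_insert, mem_polytope_inter_zero]
      simp only [neg_apply, Left.nonneg_neg_iff]
      exact ⟨fun h => ⟨h.1.1, le_antisymm h.2.2 h.1.2⟩, fun h => ⟨⟨h.1, h.2.ge⟩, h.1, h.2.le⟩⟩
    have hb : BijOn Φ (polytope A J) (polytope A' J') := by
      rw [hun, hun']
      refine BijOn.union_of_inter (hp.bijOn.congr hΦp.symm) (hm.bijOn.congr hΦm.symm) ?_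
      rw [hin, hin']
      exact hχ2.bijOn.congr hΦD.symm
    have hzero : ∀ x ∈ polytope A J, l' k (Φ x) = 0 → l k x = 0 := by
      intro x hx h
      obtain ⟨y, hy, hyx⟩ := (hχ2.bijOn.congr hΦD.symm).surjOn
        (mem_polytope_inter_zero.2 ⟨hb.mapsTo hx, h⟩)
      have hy := mem_polytope_inter_zero.1 hy
      exact hb.injOn hy.1 hx hyx ▸ hy.2
    refine ⟨Φ, ⟨?_, hb, ?_⟩, ?_⟩
    · rw [hun]
      exact (hp.continuousOn.congr hΦp).union_of_isClosed (hm.continuousOn.congr hΦm)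
        (isClosed_polytope H.isClosed) (isClosed_polytope H.isClosed)
    · intro x hx i hi
      rcases Finset.mem_insert.1 hi with rfl | hi
      · rcases lt_trichotomy (l i x) 0 with h | h | h
        · have hx' : x ∈ polytope A (insert (-l i) J) :=
            mem_polytope_insert.2 ⟨hx, by simpa using h.le⟩
          have h1 := (mem_polytope_insert.1 (hm.bijOn.mapsTo hx')).2
          rw [← hΦm hx'] at h1
          have h1 : l' i (Φ x) ≤ 0 := by simpa using h1
          rw [sign_neg h, sign_neg (lt_of_le_of_ne h1 fun h2 => h.ne (hzero x hx h2))]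
        · have h1 := (mem_polytope_inter_zero.1
            (hχ2.bijOn.mapsTo (mem_polytope_inter_zero.2 ⟨hx, h⟩))).2
          rw [← hΦD (mem_polytope_inter_zero.2 ⟨hx, h⟩)] at h1
          rw [h, h1]
        · have hx' : x ∈ polytope A (insert (l i) J) := mem_polytope_insert.2 ⟨hx, h.le⟩
          have h1 := (mem_polytope_insert.1 (hp.bijOn.mapsTo hx')).2
          rw [← hΦp hx'] at h1
          rw [sign_pos h, sign_pos (lt_of_le_of_ne h1 fun h2 => h.ne' (hzero x hx h2.symm))]
      · rcases le_total 0 (l k x) with h | h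
        · have hx' : x ∈ polytope A (insert (l k) J) := mem_polytope_insert.2 ⟨hx, h⟩
          rw [hΦp hx']
          exact hp.sign x hx' i hi
        · have hx' : x ∈ polytope A (insert (-l k) J) :=
            mem_polytope_insert.2 ⟨hx, by simpa using h⟩
          rw [hΦm hx']
          exact hm.sign x hx' i hi
    · intro x hx
      rw [← hχφ hx]
      have hx1 := polytopeBoundary_subset hx
      rcases le_total 0 (l k x) with h | h
      · rw [hΦp (mem_polytope_insert.2 ⟨hx1, h⟩)]
        exact hpe (by rw [polytopeBoundary_insert]; exact Or.inl ⟨hx, h⟩)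
      · rw [hΦm (mem_polytope_insert.2 ⟨hx1, by simpa using h⟩)]
        exact hme (by rw [polytopeBoundary_insert]; exact Or.inl ⟨hx, by simpa using h⟩)

end Cutting

/-! ### Faces of the standard simplex and homeomorphisms of pairs -/

section Faces

open scoped Matrix

variable {V : Type*} [Fintype V] [DecidableEq V] {ι : Type*}

/-- The face with vertex set `s` of the standard simplex on the vertex set `V`. -/
def face (s : Finset V) : Set (V → ℝ) :=
  {x | (∀ v, 0 ≤ x v) ∧ ∑ v, x v = 1 ∧ ∀ v, v ∉ s → x v = 0}

/-- The union of the proper faces of a face. -/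
def faceBoundary (s : Finset V) : Set (V → ℝ) := {x ∈ face s | ∃ v ∈ s, x v = 0}

/-- The union of the sections of the standard simplex by the functionals `l i`; a functional is
given by its values at the vertices. -/
def zeros (l : ι → V → ℝ) : Set (V → ℝ) := {x | ∃ i, l i ⬝ᵥ x = 0}

/-- The functionals `l i` cut the face `s` in pairwise disjoint sections that miss the vertices. -/
structure FlatFamily (s : Finset V) (l : ι → V → ℝ) : Prop where
  ne_zero : ∀ i, ∀ v ∈ s, l i v ≠ 0
  disjoint : ∀ i k, i ≠ k → ∀ x ∈ face s, l k ⬝ᵥ x = 0 → l i ⬝ᵥ x ≠ 0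

/-- Two families of disjoint flat sections of the face `s` in the same combinatorial position:
they separate the vertices in the same way, and they separate each other in the same way. -/
structure SamePosition (s : Finset V) (l l' : ι → V → ℝ) : Prop where
  flat : FlatFamily s l
  flat' : FlatFamily s l'
  sign : ∀ i, ∀ v ∈ s, SignType.sign (l i v) = SignType.sign (l' i v)
  side : ∀ i k, i ≠ k → ∀ x ∈ face s, ∀ x' ∈ face s, l k ⬝ᵥ x = 0 → l' k ⬝ᵥ x' = 0 →
    SignType.sign (l i ⬝ᵥ x) = SignType.sign (l' i ⬝ᵥ x')

/-- `φ` is a homeomorphism of `X` that preserves the open faces of the standard simplex and maps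
`G' ∩ X` onto `G ∩ X`. -/
structure PairHomeoOn (G' G X : Set (V → ℝ)) (φ : (V → ℝ) → V → ℝ) : Prop where
  continuousOn : ContinuousOn φ X
  bijOn : BijOn φ X X
  sign : ∀ x ∈ X, ∀ v, SignType.sign (φ x v) = SignType.sign (x v)
  mem : ∀ x ∈ X, (x ∈ G' ↔ φ x ∈ G)

theorem face_mono {r s : Finset V} (h : r ⊆ s) : face r ⊆ face s :=
  fun _ hx => ⟨hx.1, hx.2.1, fun v hv => hx.2.2 v fun h' => hv (h h')⟩

theorem face_subset_univ (s : Finset V) : face s ⊆ face (Finset.univ : Finset V) :=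
  face_mono (Finset.subset_univ s)

theorem mem_face_iff_of_sign {s : Finset V} {x y : V → ℝ} (hy : y ∈ face (Finset.univ : Finset V))
    (h : ∀ v, SignType.sign (x v) = SignType.sign (y v)) (hx : x ∈ face s) : y ∈ face s :=
  ⟨hy.1, hy.2.1, fun v hv => by
    have := h v
    rw [hx.2.2 v hv, sign_zero, eq_comm, sign_eq_zero_iff] at this
    exact this⟩

theorem faceBoundary_subset {s : Finset V} : faceBoundary s ⊆ face s := fun _ h => h.1

theorem mem_faceBoundary_iff_of_sign {s : Finset V} {x y : V → ℝ}
    (hy : y ∈ face (Finset.univ : Finset V))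
    (h : ∀ v, SignType.sign (x v) = SignType.sign (y v)) (hx : x ∈ faceBoundary s) :
    y ∈ faceBoundary s := by
  obtain ⟨hx, v, hv, h0⟩ := hx
  refine ⟨mem_face_iff_of_sign hy h hx, v, hv, ?_⟩
  have := h v
  rw [h0, sign_zero, eq_comm, sign_eq_zero_iff] at this
  exact this

theorem isCompact_face (s : Finset V) : IsCompact (face s) := by
  have : face s = stdSimplex ℝ V ∩ ⋂ v, ⋂ (_ : v ∉ s), {x | x v = 0} := by
    ext x; simp [face, stdSimplex, and_assoc]
  rw [this]
  exact (isCompact_stdSimplex ℝ V).inter_right (isClosed_iInter fun v => isClosed_iInter fun _ =>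
    isClosed_eq (continuous_apply v) continuous_const)

theorem convex_face (s : Finset V) : Convex ℝ (face s) := by
  rw [convex_iff_forall_pos]
  intro x hx y hy a b ha hb hab
  refine ⟨fun v => ?_, ?_, fun v hv => ?_⟩
  · have := hx.1 v; have := hy.1 v
    simp only [Pi.add_apply, Pi.smul_apply, smul_eq_mul]; positivity
  · simp [Finset.sum_add_distrib, ← Finset.mul_sum, hx.2.1, hy.2.1, hab]
  · simp [hx.2.2 v hv, hy.2.2 v hv]

theorem single_mem_face {s : Finset V} {v : V} (hv : v ∈ s) : Pi.single v (1 : ℝ) ∈ face s := by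
  refine ⟨fun w => ?_, by simp, fun w hw => ?_⟩
  · by_cases h : w = v
    · subst h; simp
    · simp [h]
  · have : w ≠ v := fun h => hw (h ▸ hv)
    simp [this]

theorem dotProduct_face {s : Finset V} {l x : V → ℝ} (hx : x ∈ face s) :
    l ⬝ᵥ x = ∑ v ∈ s, l v * x v := by
  rw [dotProduct]
  symm
  exact Finset.sum_subset (Finset.subset_univ s) fun v _ hv => by rw [hx.2.2 v hv, mul_zero]

theorem face_exists_pos {s : Finset V} {x : V → ℝ} (hx : x ∈ face s) : ∃ v ∈ s, 0 < x v := by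
  by_contra h
  push Not at h
  have h0 : ∀ v, x v = 0 := fun v => by
    by_cases hv : v ∈ s
    · exact le_antisymm (h v hv) (hx.1 v)
    · exact hx.2.2 v hv
  have := hx.2.1
  simp [h0] at this

theorem dotProduct_pos_of_face {s : Finset V} {l x : V → ℝ} (hx : x ∈ face s)
    (hl : ∀ v ∈ s, 0 < l v) : 0 < l ⬝ᵥ x := by
  rw [dotProduct_face hx]
  obtain ⟨v, hv, hv'⟩ := face_exists_pos hx
  exact Finset.sum_pos' (fun v hv => mul_nonneg (hl v hv).le (hx.1 v))
    ⟨v, hv, mul_pos (hl v hv) hv'⟩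

theorem FlatFamily.mono {r s : Finset V} (h : r ⊆ s) {l : ι → V → ℝ} (hl : FlatFamily s l) :
    FlatFamily r l :=
  ⟨fun i v hv => hl.ne_zero i v (h hv), fun i k hik x hx => hl.disjoint i k hik x (face_mono h hx)⟩

theorem SamePosition.mono {r s : Finset V} (h : r ⊆ s) {l l' : ι → V → ℝ}
    (hl : SamePosition s l l') : SamePosition r l l' :=
  ⟨hl.flat.mono h, hl.flat'.mono h, fun i v hv => hl.sign i v (h hv), fun i k hik x hx x' hx' =>
    hl.side i k hik x (face_mono h hx) x' (face_mono h hx')⟩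

theorem ContinuousOn.continuousOn_of_leftInvOn {X Y : Type*} [TopologicalSpace X]
    [TopologicalSpace Y] [T2Space Y] {f : X → Y} {g : Y → X} {K : Set X} {L : Set Y}
    (hf : ContinuousOn f K) (hK : IsCompact K) (hfL : BijOn f K L) (hg : LeftInvOn g f K) :
    ContinuousOn g L := by
  rw [continuousOn_iff_isClosed]
  intro t ht
  refine ⟨f '' (K ∩ t), ((hK.inter_right ht).image_of_continuousOn
    (hf.mono inter_subset_left)).isClosed, ?_⟩
  ext y
  constructor
  · rintro ⟨hy, hyL⟩
    obtain ⟨x, hx, rfl⟩ := hfL.surjOn hyL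
    refine ⟨⟨x, ⟨hx, ?_⟩, rfl⟩, hyL⟩
    rwa [mem_preimage, hg hx] at hy
  · rintro ⟨⟨x, ⟨hx, hxt⟩, rfl⟩, hyL⟩
    refine ⟨?_, hyL⟩
    rwa [mem_preimage, hg hx]

namespace PairHomeoOn

variable {G₁ G₂ G₃ X Y : Set (V → ℝ)} {φ ψ : (V → ℝ) → V → ℝ}

theorem exists_inverse (h : PairHomeoOn G₁ G₂ X φ) (hX : IsCompact X) :
    ∃ ψ, PairHomeoOn G₂ G₁ X ψ ∧ LeftInvOn ψ φ X ∧ RightInvOn ψ φ X := by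
  rcases X.eq_empty_or_nonempty with rfl | hne
  · exact ⟨id, ⟨continuousOn_empty _, by simp, by simp, by simp⟩, by simp [LeftInvOn],
      by simp [RightInvOn, LeftInvOn]⟩
  have h' := hne
  obtain ⟨x₀, -⟩ := h'
  have hl : LeftInvOn (Function.invFunOn φ X) φ X := h.bijOn.injOn.leftInvOn_invFunOn
  have hr : RightInvOn (Function.invFunOn φ X) φ X := h.bijOn.surjOn.rightInvOn_invFunOn
  have hm : MapsTo (Function.invFunOn φ X) X X := h.bijOn.surjOn.mapsTo_invFunOn
  refine ⟨Function.invFunOn φ X, ⟨h.continuousOn.continuousOn_of_leftInvOn hX h.bijOn hl,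
    (BijOn.symm ⟨hr, hl⟩ h.bijOn), fun x hx v => ?_, fun x hx => ?_⟩, hl, hr⟩
  · have := h.sign _ (hm hx) v
    rw [hr hx] at this
    exact this.symm
  · have := h.mem _ (hm hx)
    rw [hr hx] at this
    exact this.symm

theorem comp (h : PairHomeoOn G₁ G₂ X φ) (h' : PairHomeoOn G₂ G₃ X ψ) :
    PairHomeoOn G₁ G₃ X (ψ ∘ φ) :=
  ⟨h'.continuousOn.comp h.continuousOn h.bijOn.mapsTo, h'.bijOn.comp h.bijOn,
    fun x hx v => (h'.sign _ (h.bijOn.mapsTo hx) v).trans (h.sign x hx v),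
    fun x hx => (h.mem x hx).trans (h'.mem _ (h.bijOn.mapsTo hx))⟩

theorem congr (h : PairHomeoOn G₁ G₂ X φ) (he : EqOn ψ φ X) : PairHomeoOn G₁ G₂ X ψ :=
  ⟨h.continuousOn.congr he, h.bijOn.congr he.symm, fun x hx v => by rw [he hx]; exact h.sign x hx v,
    fun x hx => by rw [he hx]; exact h.mem x hx⟩

theorem congr_sets (h : PairHomeoOn G₁ G₂ X φ) {G₁' G₂' : Set (V → ℝ)}
    (h₁ : ∀ x ∈ X, (x ∈ G₁' ↔ x ∈ G₁)) (h₂ : ∀ x ∈ X, (x ∈ G₂' ↔ x ∈ G₂)) :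
    PairHomeoOn G₁' G₂' X φ :=
  ⟨h.continuousOn, h.bijOn, h.sign, fun x hx => by
    rw [h₁ x hx, h.mem x hx, h₂ _ (h.bijOn.mapsTo hx)]⟩

/-- Restriction to a union of open faces. -/
theorem restrict (h : PairHomeoOn G₁ G₂ X φ) (hYX : Y ⊆ X)
    (hY : ∀ x ∈ X, ∀ y ∈ X, (∀ v, SignType.sign (x v) = SignType.sign (y v)) → x ∈ Y → y ∈ Y) :
    PairHomeoOn G₁ G₂ Y φ := by
  refine ⟨h.continuousOn.mono hYX, ⟨?_, h.bijOn.injOn.mono hYX, ?_⟩,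
    fun x hx => h.sign x (hYX hx), fun x hx => h.mem x (hYX hx)⟩
  · intro x hx
    exact hY x (hYX hx) _ (h.bijOn.mapsTo (hYX hx)) (fun v => (h.sign x (hYX hx) v).symm) hx
  · intro y hy
    obtain ⟨x, hx, rfl⟩ := h.bijOn.surjOn (hYX hy)
    exact ⟨x, hY _ (hYX hy) x hx (h.sign x hx) hy, rfl⟩

theorem restrict_face (h : PairHomeoOn G₁ G₂ X φ) (hX : X ⊆ face (Finset.univ : Finset V))
    {s : Finset V} (hs : face s ⊆ X) : PairHomeoOn G₁ G₂ (face s) φ :=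
  h.restrict hs fun _ _ _ hy hxy hx => mem_face_iff_of_sign (hX hy) hxy hx

theorem restrict_faceBoundary (h : PairHomeoOn G₁ G₂ X φ)
    (hX : X ⊆ face (Finset.univ : Finset V)) {s : Finset V} (hs : faceBoundary s ⊆ X) :
    PairHomeoOn G₁ G₂ (faceBoundary s) φ :=
  h.restrict hs fun _ _ _ hy hxy hx => mem_faceBoundary_iff_of_sign (hX hy) hxy hx

end PairHomeoOn

/-- The functional on `V → ℝ` with given values at the vertices. -/
noncomputable def vertexFunctional (l : V → ℝ) : (V → ℝ) →L[ℝ] ℝ :=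
  ∑ v, l v • ContinuousLinearMap.proj (R := ℝ) (φ := fun _ : V => ℝ) v

theorem vertexFunctional_apply (l x : V → ℝ) : vertexFunctional l x = l ⬝ᵥ x := by
  simp [vertexFunctional, dotProduct]

theorem continuous_dotProduct_left (l : V → ℝ) : Continuous fun x : V → ℝ => l ⬝ᵥ x :=
  (vertexFunctional l).continuous.congr fun x => vertexFunctional_apply l x

/-- The affine span of a face. -/
def faceSpan (s : Finset V) : Set (V → ℝ) := {x | ∑ v, x v = 1 ∧ ∀ v, v ∉ s → x v = 0}

open scoped Classical in
/-- The barycentric coordinates of the face `s`. -/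
noncomputable def faceCoords (s : Finset V) : Finset ((V → ℝ) →L[ℝ] ℝ) :=
  s.image fun v => ContinuousLinearMap.proj (R := ℝ) (φ := fun _ : V => ℝ) v

theorem polytope_face (s : Finset V) : polytope (faceSpan s) (faceCoords s) = face s := by
  ext x
  simp only [polytope, faceCoords, Finset.forall_mem_image, ContinuousLinearMap.proj_apply,
    mem_ofPred_eq, face, faceSpan]
  constructor
  · rintro ⟨⟨h1, h2⟩, h3⟩
    refine ⟨fun v => ?_, h1, h2⟩
    by_cases hv : v ∈ s
    · exact h3 hv
    · exact (h2 v hv).ge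
  · rintro ⟨h1, h2, h3⟩
    exact ⟨⟨h2, h3⟩, fun v _ => h1 v⟩

theorem polytopeBoundary_face (s : Finset V) :
    polytopeBoundary (faceSpan s) (faceCoords s) = faceBoundary s := by
  ext x
  rw [faceBoundary, ← polytope_face]
  simp only [polytope, polytopeBoundary, faceCoords, Finset.forall_mem_image,
    Finset.exists_mem_image, ContinuousLinearMap.proj_apply, mem_ofPred_eq]
  tauto

theorem mem_polytopeInterior_face {s : Finset V} {x : V → ℝ} :
    x ∈ polytopeInterior (faceSpan s) (faceCoords s) ↔ x ∈ face s ∧ ∀ v ∈ s, 0 < x v := by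
  rw [← polytope_face]
  simp only [polytope, polytopeInterior, faceCoords, Finset.forall_mem_image,
    ContinuousLinearMap.proj_apply, mem_ofPred_eq]
  exact ⟨fun h => ⟨⟨h.1, fun v hv => (h.2 hv).le⟩, fun v hv => h.2 hv⟩,
    fun h => ⟨h.1.1, fun v hv => h.2 hv⟩⟩

theorem lineClosed_faceSpan (s : Finset V) : LineClosed (faceSpan s) := by
  rintro x ⟨hx, hx'⟩ y ⟨hy, hy'⟩ r
  refine ⟨?_, fun v hv => by simp [hx' v hv, hy' v hv]⟩
  simp [Finset.sum_add_distrib, ← Finset.mul_sum, hx, hy]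

theorem isClosed_faceSpan (s : Finset V) : IsClosed (faceSpan s) := by
  have : faceSpan s = {x | ∑ v, x v = 1} ∩ ⋂ v, ⋂ (_ : v ∉ s), {x : V → ℝ | x v = 0} := by
    ext x; simp [faceSpan]
  rw [this]
  exact (isClosed_eq (by fun_prop) continuous_const).inter
    (isClosed_iInter fun v => isClosed_iInter fun _ =>
      isClosed_eq (continuous_apply v) continuous_const)

/-- The barycenter of a face. -/
noncomputable def barycenter (s : Finset V) : V → ℝ := fun v => if v ∈ s then (s.card : ℝ)⁻¹ else 0

theorem barycenter_mem {s : Finset V} (hs : s.Nonempty) : barycenter s ∈ face s := by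
  have h0 : (s.card : ℝ) ≠ 0 := by exact_mod_cast hs.card_pos.ne'
  refine ⟨fun v => ?_, ?_, fun v hv => by simp [barycenter, hv]⟩
  · unfold barycenter; split_ifs <;> positivity
  · simp [barycenter, Finset.sum_ite_mem, h0]

theorem barycenter_pos {s : Finset V} {v : V} (hv : v ∈ s) : 0 < barycenter s v := by
  have : 0 < s.card := Finset.card_pos.2 ⟨v, hv⟩
  simp only [barycenter, hv, if_true]
  positivity

/-- Interior points of a face close to a given vertex. -/
theorem exists_interior_near_vertex {s : Finset V} {u : V} (hu : u ∈ s) {p : (V → ℝ) → Prop}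
    (hp : ∀ᶠ x in 𝓝 (Pi.single u (1 : ℝ)), p x) : ∃ x ∈ face s, (∀ v ∈ s, 0 < x v) ∧ p x := by
  have hc : Filter.Tendsto (fun r : ℝ => (1 - r) • Pi.single u (1 : ℝ) + r • barycenter s) (𝓝 0)
      (𝓝 (Pi.single u (1 : ℝ))) := by
    have : Continuous fun r : ℝ => (1 - r) • (Pi.single u (1 : ℝ) : V → ℝ) + r • barycenter s := by
      fun_prop
    simpa using this.tendsto 0
  obtain ⟨r, hr, hr0, hr1⟩ := (((hc.eventually hp).filter_mono nhdsWithin_le_nhds).and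
    (Ioo_mem_nhdsGT (zero_lt_one' ℝ))).exists
  refine ⟨_, convex_face s (single_mem_face hu) (barycenter_mem ⟨u, hu⟩) (by linarith) hr0.le
    (by ring), fun v hv => ?_, hr⟩
  have h1 : 0 ≤ (Pi.single u (1 : ℝ) : V → ℝ) v := (single_mem_face hu).1 v
  have h2 := barycenter_pos hv
  simp only [Pi.add_apply, Pi.smul_apply, smul_eq_mul]
  have := mul_pos hr0 h2
  have := mul_nonneg (sub_nonneg.2 hr1.le) h1
  linarith

/-- Flat families in the same position cut a face, as a polytope, in corresponding ways. -/
theorem SamePosition.correspondingCuts [Fintype ι] {s : Finset V} (hs : s.Nonempty)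
    {l l' : ι → V → ℝ} (h : SamePosition s l l') :
    CorrespondingCuts Finset.univ (fun i => vertexFunctional (l i))
      (fun i => vertexFunctional (l' i)) (faceSpan s) (faceCoords s) (faceSpan s)
      (faceCoords s) where
  isClosed := isClosed_faceSpan s
  isClosed' := isClosed_faceSpan s
  lineClosed := lineClosed_faceSpan s
  lineClosed' := lineClosed_faceSpan s
  isBounded := by rw [polytope_face]; exact (isCompact_face s).isBounded
  isBounded' := by rw [polytope_face]; exact (isCompact_face s).isBounded
  nonempty := ⟨_, mem_polytopeInterior_face.2 ⟨barycenter_mem hs, fun _ => barycenter_pos⟩⟩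
  nonempty' := ⟨_, mem_polytopeInterior_face.2 ⟨barycenter_mem hs, fun _ => barycenter_pos⟩⟩
  disjoint i _ k _ hik x hx := by
    simp only [vertexFunctional_apply]
    exact h.flat.disjoint i k hik x (polytope_face s ▸ hx)
  disjoint' i _ k _ hik x hx := by
    simp only [vertexFunctional_apply]
    exact h.flat'.disjoint i k hik x (polytope_face s ▸ hx)
  side i _ k _ hik x hx x' hx' := by
    simp only [vertexFunctional_apply]
    exact h.side i k hik x (polytope_face s ▸ hx) x' (polytope_face s ▸ hx')
  cuts i _ := by
    have key : ∀ m : V → ℝ, ∀ u ∈ s, 0 < m u →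
        ∃ x ∈ polytopeInterior (faceSpan s) (faceCoords s), 0 < m ⬝ᵥ x := by
      intro m u hu hmu
      have : ∀ᶠ x in 𝓝 (Pi.single u (1 : ℝ)), 0 < m ⬝ᵥ x := by
        refine (continuous_dotProduct_left m).continuousAt.eventually (lt_mem_nhds ?_)
        simpa using hmu
      obtain ⟨x, hx, hx', hx''⟩ := exists_interior_near_vertex hu this
      exact ⟨x, mem_polytopeInterior_face.2 ⟨hx, hx'⟩, hx''⟩
    have key' : ∀ m : V → ℝ, ∀ u ∈ s, m u < 0 →
        ∃ x ∈ polytopeInterior (faceSpan s) (faceCoords s), m ⬝ᵥ x < 0 := by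
      intro m u hu hmu
      obtain ⟨x, hx, hx'⟩ := key (-m) u hu (by simpa using hmu)
      exact ⟨x, hx, by simpa using hx'⟩
    have hsgn : ∀ v ∈ s, (0 < l i v ↔ 0 < l' i v) ∧ (l i v < 0 ↔ l' i v < 0) := fun v hv => by
      have := h.sign i v hv
      constructor
      · rw [← sign_eq_one_iff, this, sign_eq_one_iff]
      · rw [← sign_eq_neg_one_iff, this, sign_eq_neg_one_iff]
    by_cases hpos : ∃ u ∈ s, 0 < l i u
    · by_cases hneg : ∃ u ∈ s, l i u < 0
      · right
        obtain ⟨u, hu, hu'⟩ := hpos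
        obtain ⟨w, hw, hw'⟩ := hneg
        simp only [CutsPolytope, vertexFunctional_apply]
        exact ⟨⟨key _ u hu hu', key' _ w hw hw'⟩, key _ u hu ((hsgn u hu).1.1 hu'),
          key' _ w hw ((hsgn w hw).2.1 hw')⟩
      · left
        push Not at hneg
        have h1 : ∀ v ∈ s, 0 < l i v := fun v hv =>
          lt_of_le_of_ne (hneg v hv) (h.flat.ne_zero i v hv).symm
        intro x hx x' hx'
        rw [polytope_face] at hx hx'
        simp only [vertexFunctional_apply]
        have h2 := dotProduct_pos_of_face hx h1
        have h3 := dotProduct_pos_of_face hx' fun v hv => (hsgn v hv).1.1 (h1 v hv)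
        exact ⟨h2.ne', by rw [sign_pos h2, sign_pos h3]⟩
    · left
      push Not at hpos
      have h1 : ∀ v ∈ s, l i v < 0 := fun v hv =>
        lt_of_le_of_ne (hpos v hv) (h.flat.ne_zero i v hv)
      intro x hx x' hx'
      rw [polytope_face] at hx hx'
      simp only [vertexFunctional_apply]
      have h2 : 0 < -l i ⬝ᵥ x := dotProduct_pos_of_face hx (l := -l i) fun v hv => by
        simpa using h1 v hv
      have h3 : 0 < -l' i ⬝ᵥ x' := dotProduct_pos_of_face hx' (l := -l' i) fun v hv => by
        simpa using (hsgn v hv).2.1 (h1 v hv)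
      rw [neg_dotProduct, neg_pos] at h2 h3
      exact ⟨h2.ne, by rw [sign_neg h2, sign_neg h3]⟩

end Faces

/-! ### Gluing over complexes -/

section Complexes

open scoped Matrix

variable {V : Type*} [Fintype V] [DecidableEq V] {ι : Type*}

/-- Gluing over two closed unions of open faces. -/
theorem PairHomeoOn.union {G₁ G₂ X Y : Set (V → ℝ)} {φ : (V → ℝ) → V → ℝ}
    (hX : PairHomeoOn G₁ G₂ X φ) (hY : PairHomeoOn G₁ G₂ Y φ)
    (hXY : PairHomeoOn G₁ G₂ (X ∩ Y) φ) (hXc : IsClosed X) (hYc : IsClosed Y) :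
    PairHomeoOn G₁ G₂ (X ∪ Y) φ :=
  ⟨hX.continuousOn.union_of_isClosed hY.continuousOn hXc hYc,
    BijOn.union_of_inter hX.bijOn hY.bijOn hXY.bijOn,
    fun x hx => hx.elim (hX.sign x) (hY.sign x), fun x hx => hx.elim (hX.mem x) (hY.mem x)⟩

/-- If homeomorphisms of pairs extend from the boundary of every face to the face, then they extend
from a subcomplex to the whole complex. -/
theorem exists_pairHomeoOn_relative {G₁ G₂ : Set (V → ℝ)} {C₀ : Finset (Finset V)}
    (hC₀ : ∀ s ∈ C₀, ∀ r ⊆ s, r ∈ C₀) {φ₀ : (V → ℝ) → V → ℝ}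
    (hφ₀ : PairHomeoOn G₁ G₂ (⋃ s ∈ C₀, face s) φ₀) (C : Finset (Finset V)) :
    C₀ ⊆ C → (∀ s ∈ C, ∀ r ⊆ s, r ∈ C) →
    (∀ s ∈ C, ∀ φ, PairHomeoOn G₁ G₂ (faceBoundary s) φ →
      ∃ Φ, PairHomeoOn G₁ G₂ (face s) Φ ∧ EqOn Φ φ (faceBoundary s)) →
    ∃ φ, PairHomeoOn G₁ G₂ (⋃ s ∈ C, face s) φ ∧ EqOn φ φ₀ (⋃ s ∈ C₀, face s) := by
  classical
  induction C using Finset.strongInduction with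
  | H C ih =>
  intro hCC hC hext
  rcases (C \ C₀).eq_empty_or_nonempty with h0 | hne
  · obtain rfl : C = C₀ := Finset.Subset.antisymm (Finset.sdiff_eq_empty_iff_subset.1 h0) hCC
    exact ⟨φ₀, hφ₀, fun _ _ => rfl⟩
  obtain ⟨s, hs', hmax⟩ := (C \ C₀).exists_max_image Finset.card hne
  obtain ⟨hs, hs0⟩ := Finset.mem_sdiff.1 hs'
  have hmax' : ∀ r ∈ C, s ⊆ r → r = s := fun r hr hsr =>
    (Finset.eq_of_subset_of_card_le hsr (hmax r (Finset.mem_sdiff.2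
      ⟨hr, fun h => hs0 (hC₀ r h s hsr)⟩))).symm
  obtain ⟨φ, hφ, hφe⟩ := ih (C.erase s) (Finset.erase_ssubset hs)
    (Finset.subset_erase.2 ⟨hCC, hs0⟩)
    (fun r hr q hq => Finset.mem_erase.2 ⟨fun h =>
      (Finset.mem_erase.1 hr).1 (hmax' r (Finset.mem_erase.1 hr).2 (h ▸ hq)),
      hC r (Finset.mem_erase.1 hr).2 q hq⟩)
    (fun r hr => hext r (Finset.mem_erase.1 hr).2)
  set X : Set (V → ℝ) := ⋃ r ∈ C.erase s, face r with hX
  have hXu : X ⊆ face (Finset.univ : Finset V) := by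
    intro x hx
    obtain ⟨r, -, hr⟩ := mem_iUnion₂.1 hx
    exact face_subset_univ r hr
  have hbX : faceBoundary s ⊆ X := by
    rintro x ⟨hx, v, hv, h0⟩
    refine mem_iUnion₂.2 ⟨s.erase v, Finset.mem_erase.2 ⟨fun h => ?_, hC s hs _
      (Finset.erase_subset _ _)⟩, hx.1, hx.2.1, fun w hw => ?_⟩
    · exact Finset.notMem_erase v s (h.symm ▸ hv)
    · by_cases hwv : w = v
      · rw [hwv, h0]
      · exact hx.2.2 w fun h => hw (Finset.mem_erase.2 ⟨hwv, h⟩)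
  have hXs : X ∩ face s = faceBoundary s := by
    refine Subset.antisymm ?_ fun x hx => ⟨hbX hx, hx.1⟩
    rintro x ⟨hx, hxs⟩
    refine ⟨hxs, ?_⟩
    by_contra hne
    push Not at hne
    obtain ⟨r, hr, hxr⟩ := mem_iUnion₂.1 hx
    refine (Finset.mem_erase.1 hr).1 (hmax' r (Finset.mem_erase.1 hr).2 fun v hv => ?_)
    by_contra hvr
    exact hne v hv (hxr.2.2 v hvr)
  have hφb := hφ.restrict_faceBoundary hXu hbX
  obtain ⟨ψ, hψ, hψe⟩ := hext s hs φ hφb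
  have hun : (⋃ r ∈ C, face r) = X ∪ face s := by
    rw [hX, ← Finset.insert_erase hs, Finset.set_biUnion_insert, Finset.erase_insert_eq_erase,
      Finset.erase_idem, union_comm]
  set Φ : (V → ℝ) → V → ℝ := fun x => if x ∈ face s then ψ x else φ x with hΦ
  have h1 : EqOn Φ ψ (face s) := fun x hx => by simp [hΦ, hx]
  have h2 : EqOn Φ φ X := by
    intro x hx
    by_cases h : x ∈ face s
    · rw [h1 h]
      exact hψe (hXs ▸ ⟨hx, h⟩)
    · simp [hΦ, h]
  have hC₀X : (⋃ r ∈ C₀, face r) ⊆ X :=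
    biUnion_subset_biUnion_left fun r hr => Finset.subset_erase.2 ⟨hCC, hs0⟩ hr
  refine ⟨Φ, ?_, (h2.mono hC₀X).trans hφe⟩
  rw [hun]
  refine (hφ.congr h2).union (hψ.congr h1) ?_ ?_ (isCompact_face s).isClosed
  · rw [hXs]
    exact (hφ.congr h2).restrict_faceBoundary hXu hbX
  · exact (C.erase s).finite_toSet.isClosed_biUnion fun r _ => (isCompact_face r).isClosed

/-- If homeomorphisms of pairs extend from the boundary of every face to the face, then there is
one of the whole complex. -/
theorem exists_pairHomeoOn_complex {G₁ G₂ : Set (V → ℝ)} (C : Finset (Finset V))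
    (hC : ∀ s ∈ C, ∀ r ⊆ s, r ∈ C)
    (hext : ∀ s ∈ C, ∀ φ, PairHomeoOn G₁ G₂ (faceBoundary s) φ →
      ∃ Φ, PairHomeoOn G₁ G₂ (face s) Φ ∧ EqOn Φ φ (faceBoundary s)) :
    ∃ φ, PairHomeoOn G₁ G₂ (⋃ s ∈ C, face s) φ := by
  obtain ⟨φ, hφ, -⟩ := exists_pairHomeoOn_relative (C₀ := ∅) (φ₀ := id) (by simp)
    ⟨by simp [continuousOn_empty], by simp, by simp, by simp⟩ C (by simp) hC hext
  exact ⟨φ, hφ⟩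

theorem zeros_congr_sign {l l' : ι → V → ℝ} {x x' : V → ℝ}
    (h : ∀ i, SignType.sign (l i ⬝ᵥ x) = SignType.sign (l' i ⬝ᵥ x')) :
    x ∈ zeros l ↔ x' ∈ zeros l' := by
  refine exists_congr fun i => ?_
  rw [← sign_eq_zero_iff, h i, sign_eq_zero_iff]


end Complexes

/-! ### Rigidity of flat sections -/

section Rigidity

open scoped Matrix

variable {V : Type*} [Fintype V] [DecidableEq V] {ι : Type*}

/-- The point of the edge `uv` that divides it in the ratio `r : 1 - r`. -/
noncomputable def edgePoint (u v : V) (r : ℝ) : V → ℝ := Pi.single u (1 - r) + Pi.single v r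

/-- The parameter of the point at which the functional `l` vanishes on the edge `uv`. -/
noncomputable def crossing (l : V → ℝ) (u v : V) : ℝ := l u / (l u - l v)

theorem dotProduct_edgePoint (l : V → ℝ) (u v : V) (r : ℝ) :
    l ⬝ᵥ edgePoint u v r = (1 - r) * l u + r * l v := by
  simp [edgePoint, dotProduct_add, mul_comm]

theorem edgePoint_apply_right {u v : V} (huv : u ≠ v) (r : ℝ) : edgePoint u v r v = r := by
  simp [edgePoint, huv.symm]

theorem edgePoint_apply_left {u v : V} (huv : u ≠ v) (r : ℝ) : edgePoint u v r u = 1 - r := by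
  simp [edgePoint, huv]

theorem edgePoint_mem {u v : V} {r : ℝ} (hr : r ∈ Icc (0 : ℝ) 1) :
    edgePoint u v r ∈ face ({u, v} : Finset V) := by
  have : edgePoint u v r = (1 - r) • Pi.single u (1 : ℝ) + r • Pi.single v (1 : ℝ) := by
    ext w; simp [edgePoint, Pi.single_apply]
  rw [this]
  exact convex_face _ (single_mem_face (by simp)) (single_mem_face (by simp)) (by linarith [hr.2])
    hr.1 (by ring)

theorem eq_edgePoint {u v : V} (huv : u ≠ v) {x : V → ℝ} (hx : x ∈ face ({u, v} : Finset V)) :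
    x = edgePoint u v (x v) := by
  have h := hx.2.1
  rw [← Finset.sum_subset (Finset.subset_univ ({u, v} : Finset V)) fun w _ hw => hx.2.2 w hw,
    Finset.sum_pair huv] at h
  ext w
  by_cases h1 : w = u
  · subst h1; rw [edgePoint_apply_left huv]; linarith
  by_cases h2 : w = v
  · subst h2; rw [edgePoint_apply_right huv]
  · rw [hx.2.2 w (by simp [h1, h2])]; simp [edgePoint, h1, h2]

theorem apply_mem_Icc {s : Finset V} {x : V → ℝ} (hx : x ∈ face s) (v : V) :
    x v ∈ Icc (0 : ℝ) 1 :=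
  ⟨hx.1 v, hx.2.1 ▸ Finset.single_le_sum (fun w _ => hx.1 w) (Finset.mem_univ v)⟩

theorem sub_ne_zero_of_mul_neg {a b : ℝ} (h : a * b < 0) : a - b ≠ 0 := by
  intro h0
  rw [sub_eq_zero.1 h0] at h
  nlinarith [mul_self_nonneg b]

theorem crossing_mem {l : V → ℝ} {u v : V} (h : l u * l v < 0) :
    crossing l u v ∈ Ioo (0 : ℝ) 1 := by
  unfold crossing
  rcases mul_neg_iff.1 h with ⟨h1, h2⟩ | ⟨h1, h2⟩
  · exact ⟨div_pos h1 (by linarith), (div_lt_one (by linarith)).2 (by linarith)⟩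
  · refine ⟨div_pos_of_neg_of_neg h1 (by linarith),
      (div_lt_one_of_neg (by linarith)).2 (by linarith)⟩

theorem dotProduct_edgePoint' {l : V → ℝ} {u v : V} (h : l u * l v < 0) (r : ℝ) :
    l ⬝ᵥ edgePoint u v r = (l u - l v) * (crossing l u v - r) := by
  have := sub_ne_zero_of_mul_neg h
  rw [dotProduct_edgePoint, crossing]
  field_simp
  ring

theorem dotProduct_crossing {l : V → ℝ} {u v : V} (h : l u * l v < 0) :
    l ⬝ᵥ edgePoint u v (crossing l u v) = 0 := by
  rw [dotProduct_edgePoint' h, sub_self, mul_zero]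

theorem mul_neg_of_dotProduct_edgePoint {l : V → ℝ} {u v : V} (hu : l u ≠ 0) (hv : l v ≠ 0) {r : ℝ}
    (hr : r ∈ Icc (0 : ℝ) 1) (h : l ⬝ᵥ edgePoint u v r = 0) :
    l u * l v < 0 ∧ r = crossing l u v := by
  have h1 : l u * l v < 0 := by
    rw [dotProduct_edgePoint] at h
    by_contra hneg
    have hp : 0 < l u * l v := lt_of_le_of_ne (not_lt.1 hneg) (mul_ne_zero hu hv).symm
    rcases mul_pos_iff.1 hp with ⟨ha, hb⟩ | ⟨ha, hb⟩
    · rcases hr.1.eq_or_lt with h0 | h0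
      · rw [← h0] at h; linarith
      · nlinarith [mul_pos h0 hb, mul_nonneg (sub_nonneg.2 hr.2) ha.le]
    · rcases hr.1.eq_or_lt with h0 | h0
      · rw [← h0] at h; linarith
      · nlinarith [mul_pos h0 (neg_pos.2 hb), mul_nonneg (sub_nonneg.2 hr.2) (neg_pos.2 ha).le]
  refine ⟨h1, ?_⟩
  rw [dotProduct_edgePoint' h1, mul_eq_zero] at h
  rcases h with h | h
  · exact absurd h (sub_ne_zero_of_mul_neg h1)
  · linarith

theorem mul_neg_iff_of_sign {a b a' b' : ℝ} (ha : SignType.sign a = SignType.sign a')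
    (hb : SignType.sign b = SignType.sign b') : a * b < 0 ↔ a' * b' < 0 := by
  rw [← sign_eq_neg_one_iff, sign_mul, ha, hb, ← sign_mul, sign_eq_neg_one_iff]

theorem sign_sub_of_mul_neg {a b : ℝ} (h : a * b < 0) :
    SignType.sign (a - b) = SignType.sign a := by
  rcases mul_neg_iff.1 h with ⟨h1, h2⟩ | ⟨h1, h2⟩
  · rw [sign_pos h1, sign_pos (by linarith)]
  · rw [sign_neg h1, sign_neg (by linarith)]

/-- The order of the crossing points on an edge is determined by the relative position. -/
theorem SamePosition.crossing_lt_iff {u v : V} {m m' : ι → V → ℝ}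
    (h : SamePosition ({u, v} : Finset V) m m') {i k : ι} (hi : m i u * m i v < 0)
    (hk : m k u * m k v < 0) :
    crossing (m i) u v < crossing (m k) u v ↔ crossing (m' i) u v < crossing (m' k) u v := by
  by_cases hik : i = k
  · subst hik; simp
  have hi' := (mul_neg_iff_of_sign (h.sign i u (by simp)) (h.sign i v (by simp))).1 hi
  have hk' := (mul_neg_iff_of_sign (h.sign k u (by simp)) (h.sign k v (by simp))).1 hk
  have := h.side i k hik _ (edgePoint_mem (Ioo_subset_Icc_self (crossing_mem hk))) _
    (edgePoint_mem (Ioo_subset_Icc_self (crossing_mem hk'))) (dotProduct_crossing hk)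
    (dotProduct_crossing hk')
  rw [dotProduct_edgePoint' hi, dotProduct_edgePoint' hi', sign_mul, sign_mul,
    sign_sub_of_mul_neg hi, sign_sub_of_mul_neg hi', h.sign i u (by simp)] at this
  have h0 : SignType.sign (m' i u) ≠ 0 := sign_ne_zero.2 (h.flat'.ne_zero i u (by simp))
  have := mul_left_cancel₀ h0 this
  rw [← sub_neg, ← sign_eq_neg_one_iff, this, sign_eq_neg_one_iff, sub_neg]

theorem eq_id_of_strictMono_of_finite {α : Type*} [Finite α] {r : α → ℝ}
    (hr : Function.Injective r) {π : α → α} (h : ∀ j k, r j < r k → r (π j) < r (π k)) (k : α) :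
    π k = k := by
  let _ : LinearOrder α := LinearOrder.lift' r hr
  have hm : StrictMono π := fun a b hab => h a b hab
  exact le_antisymm (hm.apply_le) (hm.le_apply)

/-- A homeomorphism of an edge that matches two families of points in the same position matches the
points one by one. -/
theorem SamePosition.map_crossing [Finite ι] {u v : V} (huv : u ≠ v) {m m' : ι → V → ℝ}
    (h : SamePosition ({u, v} : Finset V) m m') {φ : (V → ℝ) → V → ℝ}
    (hφ : PairHomeoOn (zeros m) (zeros m') (face ({u, v} : Finset V)) φ) {i : ι}
    (hi : m i u * m i v < 0) :
    φ (edgePoint u v (crossing (m i) u v)) = edgePoint u v (crossing (m' i) u v) := by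
  set f : ℝ → ℝ := fun r => φ (edgePoint u v r) v with hf
  have hE : Continuous (edgePoint u v) := by
    refine continuous_pi fun w => ?_
    simp only [edgePoint, Pi.add_apply, Pi.single_apply]
    split_ifs <;> fun_prop
  have hfc : ContinuousOn f (Icc 0 1) := by
    have h1 : ContinuousOn (fun r => φ (edgePoint u v r)) (Icc 0 1) :=
      hφ.continuousOn.comp hE.continuousOn fun r hr => edgePoint_mem hr
    exact (continuous_apply v).comp_continuousOn h1
  have hφE : ∀ r ∈ Icc (0 : ℝ) 1, φ (edgePoint u v r) = edgePoint u v (f r) := fun r hr =>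
    eq_edgePoint huv (hφ.bijOn.mapsTo (edgePoint_mem hr))
  have hfi : InjOn f (Icc 0 1) := by
    intro a ha b hb hab
    have : φ (edgePoint u v a) = φ (edgePoint u v b) := by rw [hφE a ha, hφE b hb, hab]
    have := congrFun (hφ.bijOn.injOn (edgePoint_mem ha) (edgePoint_mem hb) this) v
    rwa [edgePoint_apply_right huv, edgePoint_apply_right huv] at this
  have hf01 : ∀ r ∈ Icc (0 : ℝ) 1, f r ∈ Icc (0 : ℝ) 1 := fun r hr =>
    apply_mem_Icc (hφ.bijOn.mapsTo (edgePoint_mem hr)) v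
  have hf0 : f 0 = 0 := by
    have := hφ.sign _ (edgePoint_mem (u := u) (v := v) (left_mem_Icc.2 zero_le_one)) v
    rw [edgePoint_apply_right huv, sign_zero, sign_eq_zero_iff] at this
    exact this
  have hmono : StrictMonoOn f (Icc 0 1) :=
    hfc.strictMonoOn_of_injOn_Icc zero_le_one
      (by rw [hf0]; exact (hf01 1 (right_mem_Icc.2 zero_le_one)).1) hfi
  have hmem : ∀ k : {i // m i u * m i v < 0}, crossing (m k.1) u v ∈ Icc (0 : ℝ) 1 := fun k =>
    Ioo_subset_Icc_self (crossing_mem k.2)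
  have hex : ∀ k : {i // m i u * m i v < 0}, ∃ j : {i // m i u * m i v < 0},
      f (crossing (m k.1) u v) = crossing (m' j.1) u v := by
    intro k
    obtain ⟨j, hj⟩ := (hφ.mem _ (edgePoint_mem (hmem k))).1 ⟨k.1, dotProduct_crossing k.2⟩
    rw [hφE _ (hmem k)] at hj
    have := mul_neg_of_dotProduct_edgePoint (h.flat'.ne_zero j u (by simp))
      (h.flat'.ne_zero j v (by simp)) (hf01 _ (hmem k)) hj
    exact ⟨⟨j, (mul_neg_iff_of_sign (h.sign j u (by simp)) (h.sign j v (by simp))).2 this.1⟩,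
      this.2⟩
  choose π hπ using hex
  have hinj : Function.Injective fun k : {i // m i u * m i v < 0} => crossing (m k.1) u v := by
    intro j k hjk
    by_contra hne
    refine h.flat.disjoint j.1 k.1 (fun h => hne (Subtype.ext h)) _ (edgePoint_mem (hmem k))
      (dotProduct_crossing k.2) ?_
    simp only at hjk
    rw [← hjk]
    exact dotProduct_crossing j.2
  have := eq_id_of_strictMono_of_finite hinj (π := π) (fun j k hjk => by
    have h1 := hmono (hmem j) (hmem k) hjk
    rw [hπ, hπ, ← h.crossing_lt_iff (π j).2 (π k).2] at h1
    exact h1) ⟨i, hi⟩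
  rw [hφE _ (hmem ⟨i, hi⟩), hπ ⟨i, hi⟩, this]

theorem edge_subset {s : Finset V} {u v : V} (hu : u ∈ s) (hv : v ∈ s) : ({u, v} : Finset V) ⊆ s :=
  Finset.insert_subset hu (Finset.singleton_subset_iff.2 hv)

theorem exists_pos_vertex {s : Finset V} {l x : V → ℝ} (hx : x ∈ face s) (h : 0 < l ⬝ᵥ x) :
    ∃ v ∈ s, 0 < l v := by
  by_contra hne
  push Not at hne
  rw [dotProduct_face hx] at h
  exact absurd h (not_lt.2 (Finset.sum_nonpos fun v hv =>
    mul_nonpos_of_nonpos_of_nonneg (hne v hv) (hx.1 v)))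

theorem exists_crossed_edge {s : Finset V} {l x : V → ℝ} (hx : x ∈ face s) (h : l ⬝ᵥ x = 0)
    (hl : ∀ v ∈ s, l v ≠ 0) : ∃ u ∈ s, ∃ v ∈ s, l u * l v < 0 := by
  by_contra hne
  push Not at hne
  obtain ⟨u, hu⟩ := face_exists_pos hx
  rcases lt_or_gt_of_ne (hl u hu.1) with h1 | h1
  · have := dotProduct_pos_of_face hx (l := -l) fun v hv => by
      have h2 := hne u hu.1 v hv
      have : l v < 0 := lt_of_le_of_ne (by
        by_contra hc; push Not at hc; exact absurd (mul_neg_of_neg_of_pos h1 hc) (not_lt.2 h2))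
        (hl v hv)
      simpa using this
    rw [neg_dotProduct, h] at this
    simp at this
  · have := dotProduct_pos_of_face hx (l := l) fun v hv => by
      have h2 := hne u hu.1 v hv
      exact lt_of_le_of_ne (by
        by_contra hc; push Not at hc; exact absurd (mul_neg_of_pos_of_neg h1 hc) (not_lt.2 h2))
        (hl v hv).symm
    exact absurd h this.ne'

/-- The section of a face by one functional. -/
theorem convex_section (s : Finset V) (l : V → ℝ) : Convex ℝ {x ∈ face s | l ⬝ᵥ x = 0} := by
  have : {x ∈ face s | l ⬝ᵥ x = 0} = face s ∩ {x | vertexFunctional l x = 0} := by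
    ext x; simp [vertexFunctional_apply]
  rw [this]
  exact (convex_face s).inter (convex_hyperplane (vertexFunctional l).isLinear 0)

/-- A homeomorphism of a face that matches the unions of two families of sections in the same
position matches the sections one by one, and the sides of each of them. -/
theorem SamePosition.sign_map [Finite ι] {s : Finset V} {m m' : ι → V → ℝ}
    (h : SamePosition s m m') {φ : (V → ℝ) → V → ℝ}
    (hφ : PairHomeoOn (zeros m) (zeros m') (face s) φ) {x : V → ℝ} (hx : x ∈ face s) (i : ι) :
    SignType.sign (m i ⬝ᵥ x) = SignType.sign (m' i ⬝ᵥ φ x) := by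
  -- the section by `m k` is mapped into one section, and an edge point shows which one
  have hD : ∀ k, ∀ y ∈ face s, m k ⬝ᵥ y = 0 → m' k ⬝ᵥ φ y = 0 := by
    intro k y hy hy0
    obtain ⟨u, hu, v, hv, huv⟩ := exists_crossed_edge hy hy0 (h.flat.ne_zero k)
    have hne : u ≠ v := by
      rintro rfl; nlinarith [mul_self_nonneg (m k u)]
    have hes := edge_subset hu hv
    have h1 := (h.mono hes).map_crossing hne
      (hφ.restrict_face (face_subset_univ s) (face_mono hes)) huv
    have huv' := (mul_neg_iff_of_sign (h.sign k u hu) (h.sign k v hv)).1 huv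
    set p := edgePoint u v (crossing (m k) u v) with hp
    have hps : p ∈ face s := face_mono hes (edgePoint_mem (Ioo_subset_Icc_self (crossing_mem huv)))
    set D := {x ∈ face s | m k ⬝ᵥ x = 0} with hDdef
    have hDc : IsPreconnected (φ '' D) :=
      (convex_section s (m k)).isPreconnected.image φ (hφ.continuousOn.mono fun x hx => hx.1)
    by_contra hne0
    -- otherwise the image of the section meets two disjoint closed sets that cover it
    set U := {x ∈ face s | m' k ⬝ᵥ x = 0} with hU
    set Z := ⋃ j ∈ {j | j ≠ k}, {x ∈ face s | m' j ⬝ᵥ x = 0} with hZ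
    have hcl : ∀ j, IsClosed {x ∈ face s | m' j ⬝ᵥ x = 0} := fun j =>
      (isCompact_face s).isClosed.inter
        (isClosed_eq (continuous_dotProduct_left (m' j)) continuous_const)
    have hZc : IsClosed Z := (Set.toFinite _).isClosed_biUnion fun j _ => hcl j
    have hcov : φ '' D ⊆ U ∪ Z := by
      rintro _ ⟨z, hz, rfl⟩
      obtain ⟨j, hj⟩ := (hφ.mem z hz.1).1 ⟨k, hz.2⟩
      by_cases hjk : j = k
      · subst hjk; exact Or.inl ⟨hφ.bijOn.mapsTo hz.1, hj⟩
      · exact Or.inr (mem_biUnion (x := j) hjk ⟨hφ.bijOn.mapsTo hz.1, hj⟩)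
    have hUne : (φ '' D ∩ U).Nonempty :=
      ⟨φ p, mem_image_of_mem _ ⟨hps, dotProduct_crossing huv⟩, hφ.bijOn.mapsTo hps, by
        rw [h1]; exact dotProduct_crossing huv'⟩
    have hZne : (φ '' D ∩ Z).Nonempty := by
      have hyD : φ y ∈ φ '' D := mem_image_of_mem _ ⟨hy, hy0⟩
      rcases hcov hyD with hc | hc
      · exact absurd hc.2 hne0
      · exact ⟨φ y, hyD, hc⟩
    obtain ⟨z, -, hzU, hzZ⟩ := isPreconnected_closed_iff.1 hDc U Z (hcl k) hZc hcov hUne hZne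
    obtain ⟨j, hj, hzj⟩ := mem_iUnion₂.1 hzZ
    exact h.flat'.disjoint k j (Ne.symm hj) z hzj.1 hzj.2 hzU.2
  have hD' : ∀ y ∈ face s, m' i ⬝ᵥ φ y = 0 → m i ⬝ᵥ y = 0 := by
    intro y hy hy0
    obtain ⟨k, hk⟩ := (hφ.mem y hy).2 ⟨i, hy0⟩
    by_cases hki : k = i
    · exact hki ▸ hk
    · exact absurd (hD k y hy hk) (h.flat'.disjoint k i hki _ (hφ.bijOn.mapsTo hy) hy0)
  -- a point on the positive side of a section is joined to a vertex within that side
  have key : ∀ l l' : V → ℝ, (∀ v ∈ s, SignType.sign (l v) = SignType.sign (l' v)) →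
      (∀ y ∈ face s, l' ⬝ᵥ φ y = 0 → l ⬝ᵥ y = 0) → 0 < l ⬝ᵥ x → 0 < l' ⬝ᵥ φ x := by
    intro l l' hsgn hz hpos
    obtain ⟨v, hv, hlv⟩ := exists_pos_vertex hx hpos
    have hφv : φ (Pi.single v 1) = Pi.single v 1 := by
      have h1 : φ (Pi.single v 1) ∈ face {v} := by
        refine mem_face_iff_of_sign (face_subset_univ s (hφ.bijOn.mapsTo (single_mem_face hv)))
          (fun w => (hφ.sign _ (single_mem_face hv) w).symm)
          (single_mem_face (Finset.mem_singleton_self v))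
      ext w
      by_cases hw : w = v
      · subst hw
        have := h1.2.1
        rw [Finset.sum_eq_single w (fun b _ hb => h1.2.2 b (by simpa using hb)) (by simp)] at this
        simpa using this
      · rw [h1.2.2 w (by simpa using hw)]; simp [hw]
    set S := segment ℝ (Pi.single v (1 : ℝ)) x with hS
    have hSs : S ⊆ face s := (convex_face s).segment_subset (single_mem_face hv) hx
    have hSpos : ∀ y ∈ S, 0 < l ⬝ᵥ y := by
      have : Convex ℝ {y | 0 < vertexFunctional l y} :=
        convex_halfSpace_gt (vertexFunctional l).isLinear 0
      have := this.segment_subset (x := Pi.single v (1 : ℝ)) (y := x)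
        (by simpa [vertexFunctional_apply] using hlv)
        (by simpa [vertexFunctional_apply] using hpos)
      intro y hy
      simpa [vertexFunctional_apply] using this hy
    have hc : ContinuousOn (fun y => l' ⬝ᵥ φ y) S :=
      (continuous_dotProduct_left l').comp_continuousOn (hφ.continuousOn.mono hSs)
    have := sign_eq_of_convex (convex_segment _ _) hc
      (fun y hy h0 => (hSpos y hy).ne' (hz y (hSs hy) h0))
      (left_mem_segment ℝ _ _) (right_mem_segment ℝ _ _)
    simp only [hφv, dotProduct_single_one] at this
    rw [← hsgn v hv, sign_pos hlv, eq_comm, sign_eq_one_iff] at this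
    exact this
  rcases lt_trichotomy (m i ⬝ᵥ x) 0 with h1 | h1 | h1
  · have := key (-m i) (-m' i) (fun v hv => by simp [Left.sign_neg, h.sign i v hv])
      (fun y hy h0 => by simpa using hD' y hy (by simpa using h0)) (by simpa using h1)
    rw [sign_neg h1, sign_neg (by simpa using this)]
  · rw [h1, hD i x hx h1]
  · rw [sign_pos h1, sign_pos (key _ _ (h.sign i) hD' h1)]

end Rigidity

/-! ### Extension over a face and normal subsets -/

section Matching

open scoped Matrix

variable {V : Type*} [Fintype V] [DecidableEq V] {ι : Type*}

/-- Extension of a homeomorphism of pairs over a face, if on the face `S` around it both sets are,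
up to homeomorphism, families of flat sections in the same position. -/
theorem exists_pairHomeoOn_face [Fintype ι] {S s : Finset V} (hsS : s ⊆ S) {m m' : ι → V → ℝ}
    (h : SamePosition S m m') {G' G : Set (V → ℝ)} (hG' : ∀ x ∈ face S, (x ∈ G' ↔ x ∈ zeros m))
    {h₀ : (V → ℝ) → V → ℝ} (hh : PairHomeoOn (zeros m') G (face S) h₀) {φ : (V → ℝ) → V → ℝ}
    (hφ : PairHomeoOn G' G (faceBoundary s) φ) :
    ∃ Φ, PairHomeoOn G' G (face s) Φ ∧ EqOn Φ φ (faceBoundary s) := by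
  classical
  rcases s.eq_empty_or_nonempty with rfl | hs
  · have h0 : face (∅ : Finset V) = ∅ := by
      ext x
      simp only [mem_empty_iff_false, iff_false]
      intro hx
      obtain ⟨v, hv, -⟩ := face_exists_pos hx
      simp at hv
    refine ⟨φ, ?_, fun _ _ => rfl⟩
    rw [h0]
    exact ⟨continuousOn_empty _, by simp, by simp, by simp⟩
  obtain ⟨k, hk, hk1, hk2⟩ := hh.exists_inverse (isCompact_face S)
  have hbS : faceBoundary s ⊆ face S := faceBoundary_subset.trans (face_mono hsS)
  have hkb : PairHomeoOn G (zeros m') (faceBoundary s) k :=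
    hk.restrict_faceBoundary (face_subset_univ S) hbS
  have hks : PairHomeoOn G (zeros m') (face s) k :=
    hk.restrict_face (face_subset_univ S) (face_mono hsS)
  have hhs : PairHomeoOn (zeros m') G (face s) h₀ :=
    hh.restrict_face (face_subset_univ S) (face_mono hsS)
  have hkφ : PairHomeoOn (zeros m) (zeros m') (faceBoundary s) (k ∘ φ) :=
    (hφ.comp hkb).congr_sets (fun x hx => (hG' x (hbS hx)).symm) fun _ _ => Iff.rfl
  have hbu : faceBoundary s ⊆ face (Finset.univ : Finset V) :=
    faceBoundary_subset.trans (face_subset_univ s)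
  have hsign : SignHomeoOn Finset.univ (fun i => vertexFunctional (m i))
      (fun i => vertexFunctional (m' i)) (faceBoundary s) (faceBoundary s) (k ∘ φ) := by
    refine ⟨hkφ.continuousOn, hkφ.bijOn, fun x hx i _ => ?_⟩
    obtain ⟨hxs, v, hv, h0⟩ := hx
    have hxr : x ∈ face (s.erase v) := by
      refine ⟨hxs.1, hxs.2.1, fun w hw => ?_⟩
      by_cases hwv : w = v
      · rw [hwv, h0]
      · exact hxs.2.2 w fun hh => hw (Finset.mem_erase.2 ⟨hwv, hh⟩)
    have hrb : face (s.erase v) ⊆ faceBoundary s := fun y hy =>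
      ⟨face_mono (Finset.erase_subset v s) hy, v, hv, hy.2.2 v (Finset.notMem_erase v s)⟩
    simp only [vertexFunctional_apply]
    exact (h.mono ((Finset.erase_subset v s).trans hsS)).sign_map
      (hkφ.restrict_face hbu hrb) hxr i
  have hcuts := (h.mono hsS).correspondingCuts hs
  rw [← polytopeBoundary_face] at hsign
  obtain ⟨Ψ, hΨ, hΨe⟩ := exists_extension_of_correspondingCuts hcuts hsign
  rw [polytopeBoundary_face] at hΨe hsign
  rw [polytope_face] at hΨ
  have hΨb : BijOn Ψ (faceBoundary s) (faceBoundary s) := hsign.bijOn.congr hΨe.symm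
  have hΨp : PairHomeoOn G' (zeros m') (face s) Ψ := by
    refine ⟨hΨ.continuousOn, hΨ.bijOn, fun x hx v => ?_, fun x hx => ?_⟩
    · by_cases hxb : x ∈ faceBoundary s
      · rw [hΨe hxb]; exact hkφ.sign x hxb v
      · have hyb : Ψ x ∉ faceBoundary s := by
          intro hyb
          obtain ⟨z, hz, hzx⟩ := hΨb.surjOn hyb
          exact hxb (hΨ.bijOn.injOn hz.1 hx hzx ▸ hz)
        have hy := hΨ.bijOn.mapsTo hx
        by_cases hv : v ∈ s
        · have h1 : 0 < x v := lt_of_le_of_ne (hx.1 v) fun h0 => hxb ⟨hx, v, hv, h0.symm⟩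
          have h2 : 0 < Ψ x v := lt_of_le_of_ne (hy.1 v) fun h0 => hyb ⟨hy, v, hv, h0.symm⟩
          rw [sign_pos h1, sign_pos h2]
        · rw [hx.2.2 v hv, hy.2.2 v hv]
    · rw [hG' x (face_mono hsS hx)]
      refine zeros_congr_sign fun i => ?_
      simpa only [vertexFunctional_apply] using hΨ.sign x hx i (Finset.mem_univ i)
  refine ⟨h₀ ∘ Ψ, hΨp.comp hhs, fun x hx => ?_⟩
  change h₀ (Ψ x) = φ x
  rw [hΨe hx]
  exact hk2 (hbS (hφ.bijOn.mapsTo hx))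

/-- On the face `s` the set `G` is, up to a homeomorphism that preserves the faces, a finite union
of disjoint flat sections that miss the vertices. -/
def NormalOn (s : Finset V) (G : Set (V → ℝ)) : Prop :=
  ∃ (n : ℕ) (l : Fin n → V → ℝ), FlatFamily s l ∧ ∃ h, PairHomeoOn (zeros l) G (face s) h

theorem FlatFamily.comp {κ : Type*} {s : Finset V} {l : ι → V → ℝ} (hl : FlatFamily s l) {g : κ → ι}
    (hg : Function.Injective g) : FlatFamily s (l ∘ g) :=
  ⟨fun i => hl.ne_zero (g i), fun i k hik => hl.disjoint (g i) (g k) (hg.ne hik)⟩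

theorem NormalOn.of_finite [Finite ι] {s : Finset V} {G : Set (V → ℝ)} {l : ι → V → ℝ}
    (hl : FlatFamily s l) {h : (V → ℝ) → V → ℝ} (hh : PairHomeoOn (zeros l) G (face s) h) :
    NormalOn s G := by
  obtain ⟨n, ⟨e⟩⟩ := Finite.exists_equiv_fin ι
  refine ⟨n, l ∘ e.symm, hl.comp e.symm.injective, h, hh.congr_sets (fun x _ => ?_)
    fun _ _ => Iff.rfl⟩
  simp only [zeros, mem_ofPred_eq, Function.comp]
  exact ⟨fun ⟨i, hi⟩ => ⟨_, hi⟩, fun ⟨i, hi⟩ => ⟨e i, by simpa using hi⟩⟩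

/-- The number of points of a flat family on an edge is the number of functionals that separate the
ends of the edge. -/
theorem FlatFamily.ncard_edge [Finite ι] {s : Finset V} {l : ι → V → ℝ} (hl : FlatFamily s l)
    {u v : V} (hu : u ∈ s) (hv : v ∈ s) (huv : u ≠ v) :
    (zeros l ∩ face ({u, v} : Finset V)).ncard = Nat.card {i // l i u * l i v < 0} := by
  have hf := hl.mono (edge_subset hu hv)
  rw [← Nat.card_coe_set_eq]
  symm
  have hmem : ∀ i : {i // l i u * l i v < 0}, edgePoint u v (crossing (l i.1) u v) ∈
      face ({u, v} : Finset V) := fun i => edgePoint_mem (Ioo_subset_Icc_self (crossing_mem i.2))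
  refine Nat.card_congr (Equiv.ofBijective (fun i => ⟨edgePoint u v (crossing (l i.1) u v),
    ⟨i.1, dotProduct_crossing i.2⟩, hmem i⟩) ⟨?_, ?_⟩)
  · intro i k hik
    have hik : edgePoint u v (crossing (l i.1) u v) = edgePoint u v (crossing (l k.1) u v) :=
      congrArg Subtype.val hik
    by_contra hne
    refine hf.disjoint i.1 k.1 (fun h => hne (Subtype.ext h)) _ (hmem k)
      (dotProduct_crossing k.2) ?_
    rw [← hik]
    exact dotProduct_crossing i.2
  · rintro ⟨x, ⟨i, hi⟩, hx⟩
    have hx' := eq_edgePoint huv hx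
    rw [hx'] at hi
    have := mul_neg_of_dotProduct_edgePoint (hf.ne_zero i u (by simp)) (hf.ne_zero i v (by simp))
      (apply_mem_Icc hx v) hi
    refine ⟨⟨i, this.1⟩, Subtype.ext ?_⟩
    change edgePoint u v (crossing (l i) u v) = x
    rw [← this.2]
    exact hx'.symm

theorem PairHomeoOn.ncard_edge {G₁ G₂ : Set (V → ℝ)} {s : Finset V} {φ : (V → ℝ) → V → ℝ}
    (h : PairHomeoOn G₁ G₂ (face s) φ) {r : Finset V} (hr : r ⊆ s) :
    (G₂ ∩ face r).ncard = (G₁ ∩ face r).ncard := by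
  have h' := h.restrict_face (face_subset_univ s) (face_mono hr)
  rw [← (h'.bijOn.injOn.mono (inter_subset_right (s := G₁))).ncard_image]
  congr 1
  ext y
  constructor
  · intro hy
    obtain ⟨x, hx, rfl⟩ := h'.bijOn.surjOn hy.2
    exact ⟨x, ⟨(h'.mem x hx).2 hy.1, hx⟩, rfl⟩
  · rintro ⟨x, hx, rfl⟩
    exact ⟨(h'.mem x hx.2).1 hx.1, h'.bijOn.mapsTo hx.2⟩

/-- The sign of a functional is constant on the section by another one. -/
theorem FlatFamily.sign_const {s : Finset V} {l : ι → V → ℝ} (hl : FlatFamily s l) {i k : ι}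
    (hik : i ≠ k) {x y : V → ℝ} (hx : x ∈ face s) (hy : y ∈ face s) (hx0 : l k ⬝ᵥ x = 0)
    (hy0 : l k ⬝ᵥ y = 0) : SignType.sign (l i ⬝ᵥ x) = SignType.sign (l i ⬝ᵥ y) :=
  sign_eq_of_convex (convex_section s (l k)) (continuous_dotProduct_left (l i)).continuousOn
    (fun z hz => hl.disjoint i k hik z hz.1 hz.2) ⟨hx, hx0⟩ ⟨hy, hy0⟩

/-- An edge that is crossed by one functional, but not by the other. -/
theorem sign_at_crossing {u v : V} {a b : V → ℝ} (hb : b u * b v < 0) (ha : 0 < a u * a v) :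
    SignType.sign (a ⬝ᵥ edgePoint u v (crossing b u v)) = SignType.sign (a u) := by
  have hr := crossing_mem hb
  rw [dotProduct_edgePoint]
  rcases mul_pos_iff.1 ha with ⟨h1, h2⟩ | ⟨h1, h2⟩
  · rw [sign_pos h1, sign_pos]
    have := mul_pos (sub_pos.2 hr.2) h1
    have := mul_pos hr.1 h2
    linarith
  · rw [sign_neg h1, sign_neg]
    have := mul_neg_of_pos_of_neg (sub_pos.2 hr.2) h1
    have := mul_neg_of_pos_of_neg hr.1 h2
    linarith

end Matching

/-! ### Counting disks by edge weights -/

section Counting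

open scoped Matrix

variable {V : Type*} [Fintype V] [DecidableEq V] {ι : Type*}

/-- Two planes in a tetrahedron that separate the vertices in crossing ways intersect. -/
theorem FlatFamily.not_crossing {s : Finset V} {l : ι → V → ℝ} (hl : FlatFamily s l) {i k : ι}
    (hik : i ≠ k) {p q r w : V} (hp : p ∈ s) (hq : q ∈ s) (hr : r ∈ s) (hw : w ∈ s)
    (hip : 0 < l i p) (hiq : 0 < l i q) (hir : l i r < 0) (hiw : l i w < 0)
    (hkp : 0 < l k p) (hkq : l k q < 0) (hkr : 0 < l k r) (hkw : l k w < 0) : False := by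
  have h1 := mul_neg_of_pos_of_neg hip hir
  have h2 := mul_neg_of_pos_of_neg hiq hiw
  have h := hl.sign_const hik.symm
    (face_mono (edge_subset hp hr) (edgePoint_mem (Ioo_subset_Icc_self (crossing_mem h1))))
    (face_mono (edge_subset hq hw) (edgePoint_mem (Ioo_subset_Icc_self (crossing_mem h2))))
    (dotProduct_crossing h1) (dotProduct_crossing h2)
  rw [sign_at_crossing h1 (mul_pos hkp hkr), sign_at_crossing h2 (mul_pos_of_neg_of_neg hkq hkw),
    sign_pos hkp, sign_neg hkq] at h
  exact absurd h (by decide)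

/-- A flat family can be replaced by one all of whose members meet the face and are negative at a
given vertex. -/
theorem FlatFamily.exists_normalized {ι : Type} [Finite ι] {s : Finset V} {l : ι → V → ℝ}
    (hl : FlatFamily s l) {o : V} (ho : o ∈ s) :
    ∃ (κ : Type) (_ : Finite κ) (m : κ → V → ℝ), FlatFamily s m ∧ (∀ i, m i o < 0) ∧
      (∀ i, ∃ v ∈ s, 0 < m i v) ∧ ∀ x ∈ face s, (x ∈ zeros l ↔ x ∈ zeros m) := by
  set m : {i // ∃ v ∈ s, l i o * l i v < 0} → V → ℝ := fun i => -l i.1 o • l i.1 with hm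
  have hne : ∀ i : {i // ∃ v ∈ s, l i o * l i v < 0}, -l i.1 o ≠ 0 := fun i =>
    neg_ne_zero.2 (hl.ne_zero i.1 o ho)
  have hz : ∀ i x, m i ⬝ᵥ x = 0 ↔ l i.1 ⬝ᵥ x = 0 := fun i x => by
    simp only [hm, smul_dotProduct, smul_eq_mul, mul_eq_zero, hne i, false_or]
  refine ⟨_, inferInstance, m, ⟨fun i v hv => mul_ne_zero (hne i) (hl.ne_zero i.1 v hv),
    fun i k hik x hx h => ?_⟩, fun i => ?_, fun i => ?_, fun x hx => ⟨?_, ?_⟩⟩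
  · rw [Ne, hz]
    exact hl.disjoint i.1 k.1 (fun h => hik (Subtype.ext h)) x hx ((hz k x).1 h)
  · have := mul_self_pos.2 (hl.ne_zero i.1 o ho)
    simp only [hm, Pi.smul_apply, smul_eq_mul, neg_mul]
    linarith
  · obtain ⟨v, hv, hv'⟩ := i.2
    exact ⟨v, hv, by simp only [hm, Pi.smul_apply, smul_eq_mul, neg_mul]; linarith⟩
  · rintro ⟨i, hi⟩
    obtain ⟨u, hu, v, hv, huv⟩ := exists_crossed_edge hx hi (hl.ne_zero i)
    have : ∃ v ∈ s, l i o * l i v < 0 := by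
      rcases lt_or_gt_of_ne (hl.ne_zero i o ho) with h | h
      · rcases mul_neg_iff.1 huv with h' | h'
        · exact ⟨u, hu, mul_neg_of_neg_of_pos h h'.1⟩
        · exact ⟨v, hv, mul_neg_of_neg_of_pos h h'.2⟩
      · rcases mul_neg_iff.1 huv with h' | h'
        · exact ⟨v, hv, mul_neg_of_pos_of_neg h h'.2⟩
        · exact ⟨u, hu, mul_neg_of_pos_of_neg h h'.1⟩
    exact ⟨⟨i, this⟩, (hz _ x).2 hi⟩
  · rintro ⟨i, hi⟩
    exact ⟨i.1, (hz i x).1 hi⟩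

/-- The edge weights `W` of the tetrahedron `oabc` are those of a system of normal disks of which
`N` lists the numbers of disks of the different types: `N α β γ` is the number of disks that
separate from `o` those of the vertices `a`, `b`, `c` whose flag is `true`. -/
structure EdgeCounts (W : V → V → ℕ) (o a b c : V) (N : Bool → Bool → Bool → ℕ) : Prop where
  trivial : N false false false = 0
  quad₁ : N true true false = 0 ∨ N true false true = 0
  quad₂ : N true true false = 0 ∨ N false true true = 0
  quad₃ : N true false true = 0 ∨ N false true true = 0
  oa : W o a = N true false false + N true true false + N true false true + N true true true
  ob : W o b = N false true false + N true true false + N false true true + N true true true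
  oc : W o c = N false false true + N true false true + N false true true + N true true true
  ab : W a b = N true false false + N false true false + N true false true + N false true true
  ac : W a c = N true false false + N false false true + N true true false + N false true true
  bc : W b c = N false true false + N false false true + N true true false + N true false true

/-- The edge weights of a tetrahedron determine the numbers of disks. -/
theorem EdgeCounts.unique {W : V → V → ℕ} {o a b c : V} {N N' : Bool → Bool → Bool → ℕ}
    (h : EdgeCounts W o a b c N) (h' : EdgeCounts W o a b c N') (α β γ : Bool) :
    N α β γ = N' α β γ := by
  obtain ⟨h0, h1, h2, h3, e1, e2, e3, e4, e5, e6⟩ := h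
  obtain ⟨h0', h1', h2', h3', e1', e2', e3', e4', e5', e6'⟩ := h'
  have key : ∀ x y z p q r t x' y' z' p' q' r' t' : ℕ, (p = 0 ∨ q = 0) → (p = 0 ∨ r = 0) →
      (q = 0 ∨ r = 0) → (p' = 0 ∨ q' = 0) → (p' = 0 ∨ r' = 0) → (q' = 0 ∨ r' = 0) →
      x + p + q + t = x' + p' + q' + t' → y + p + r + t = y' + p' + r' + t' →
      z + q + r + t = z' + q' + r' + t' → x + y + q + r = x' + y' + q' + r' →
      x + z + p + r = x' + z' + p' + r' → y + z + p + q = y' + z' + p' + q' →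
      x = x' ∧ y = y' ∧ z = z' ∧ p = p' ∧ q = q' ∧ r = r' ∧ t = t' := by
    clear * -
    intro x y z p q r t x' y' z' p' q' r' t' h1 h2 h3 h1' h2' h3' e1 e2 e3 e4 e5 e6
    refine ⟨?_, ?_, ?_, ?_, ?_, ?_, ?_⟩ <;> omega
  obtain ⟨k1, k2, k3, k4, k5, k6, k7⟩ := key _ _ _ _ _ _ _ _ _ _ _ _ _ _ h1 h2 h3 h1' h2' h3'
    (e1.symm.trans e1') (e2.symm.trans e2') (e3.symm.trans e3') (e4.symm.trans e4')
    (e5.symm.trans e5') (e6.symm.trans e6')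
  cases α <;> cases β <;> cases γ
  · rw [h0, h0']
  all_goals assumption

open scoped Classical in
/-- Which of the vertices `a`, `b`, `c` lie on the positive side of the functional `l`. -/
noncomputable def sideType (a b c : V) (l : V → ℝ) : Bool × Bool × Bool :=
  (decide (0 < l a), decide (0 < l b), decide (0 < l c))

theorem card_subtype_comp [Finite ι] {τ : Type*} [Fintype τ] (T : ι → τ) (P : τ → Bool) :
    Nat.card {i // P (T i) = true} = ∑ t, if P t = true then Nat.card {i // T i = t} else 0 := by
  classical
  have := Fintype.ofFinite ι
  simp only [Nat.card_eq_fintype_card, Fintype.card_subtype]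
  rw [Finset.card_eq_sum_card_fiberwise (f := T) (t := Finset.univ) (fun _ _ => Finset.mem_univ _)]
  refine Finset.sum_congr rfl fun t _ => ?_
  rw [Finset.filter_filter]
  split_ifs with h
  · congr 1
    ext i
    simp only [Finset.mem_filter, Finset.mem_univ, true_and]
    exact ⟨fun h => h.2, fun h' => ⟨h' ▸ h, h'⟩⟩
  · rw [Finset.card_eq_zero, Finset.filter_eq_empty_iff]
    rintro i - ⟨h1, h2⟩
    exact h (h2 ▸ h1)

/-- A flat family that is negative at `o` has the edge weights of a system of disks: the sections
are disks of the type given by the signs at the other vertices. -/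
theorem edgeCounts_of_normalized [Finite ι] {o a b c : V} {m : ι → V → ℝ}
    (hm : FlatFamily {o, a, b, c} m) (ho : ∀ i, m i o < 0)
    (hex : ∀ i, ∃ v ∈ ({o, a, b, c} : Finset V), 0 < m i v)
    {W : V → V → ℕ}
    (hW : ∀ u ∈ ({o, a, b, c} : Finset V), ∀ v ∈ ({o, a, b, c} : Finset V), u ≠ v →
      W u v = Nat.card {i // m i u * m i v < 0})
    (hoa : o ≠ a) (hob : o ≠ b) (hoc : o ≠ c) (hab : a ≠ b) (hac : a ≠ c) (hbc : b ≠ c) :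
    EdgeCounts W o a b c fun α β γ => Nat.card {i // sideType a b c (m i) = (α, β, γ)} := by
  have hT : ∀ i α β γ, sideType a b c (m i) = (α, β, γ) →
      ((α = true ↔ 0 < m i a) ∧ (β = true ↔ 0 < m i b) ∧ (γ = true ↔ 0 < m i c)) := by
    rintro i α β γ h
    simp only [sideType, Prod.mk.injEq] at h
    obtain ⟨rfl, rfl, rfl⟩ := h
    simp
  have hneg : ∀ i, ∀ v ∈ ({o, a, b, c} : Finset V), ¬ 0 < m i v → m i v < 0 := fun i v hv h =>
    lt_of_le_of_ne (not_lt.1 h) (hm.ne_zero i v hv)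
  have hne : ∀ i k, ∀ t t' : Bool × Bool × Bool, t ≠ t' → sideType a b c (m i) = t →
      sideType a b c (m k) = t' → i ≠ k := by
    rintro i k t t' htt rfl rfl rfl
    exact htt rfl
  have hao : a ∈ ({o, a, b, c} : Finset V) := by simp
  have hbo : b ∈ ({o, a, b, c} : Finset V) := by simp
  have hco : c ∈ ({o, a, b, c} : Finset V) := by simp
  have hoo : o ∈ ({o, a, b, c} : Finset V) := by simp
  have hquad : ∀ t t' : Bool × Bool × Bool,
      (∀ i k, sideType a b c (m i) = t → sideType a b c (m k) = t' → False) →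
      Nat.card {i // sideType a b c (m i) = t} = 0 ∨
        Nat.card {i // sideType a b c (m i) = t'} = 0 := by
    intro t t' h
    by_cases hi : Nonempty {i // sideType a b c (m i) = t}
    · right
      obtain ⟨i⟩ := hi
      have : IsEmpty {i // sideType a b c (m i) = t'} := ⟨fun k => h i.1 k.1 i.2 k.2⟩
      exact Nat.card_of_isEmpty
    · left
      rw [not_nonempty_iff] at hi
      exact Nat.card_of_isEmpty
  have hcross_o : ∀ v ∈ ({o, a, b, c} : Finset V), ∀ i, m i o * m i v < 0 ↔ 0 < m i v := by
    intro v hv i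
    have := ho i
    constructor
    · intro h
      by_contra hc
      have := mul_pos_of_neg_of_neg (ho i) (hneg i v hv hc)
      linarith
    · exact fun h => mul_neg_of_neg_of_pos (ho i) h
  have hcross : ∀ u ∈ ({o, a, b, c} : Finset V), ∀ v ∈ ({o, a, b, c} : Finset V), ∀ i,
      m i u * m i v < 0 ↔ ¬ (0 < m i u ↔ 0 < m i v) := by
    intro u hu v hv i
    have h1 := hneg i u hu
    have h2 := hneg i v hv
    rw [mul_neg_iff]
    by_cases h : 0 < m i u <;> by_cases h' : 0 < m i v
    · simp [h, h', h.le, h'.le]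
    · simp [h, h', h2 h']
    · simp [h, h', h1 h]
    · simp [h, h']
  have hsum : ∀ (P : Bool × Bool × Bool → Bool) (u v : V), u ∈ ({o, a, b, c} : Finset V) →
      v ∈ ({o, a, b, c} : Finset V) → u ≠ v →
      (∀ i, m i u * m i v < 0 ↔ P (sideType a b c (m i)) = true) →
      W u v = ∑ t, if P t = true then Nat.card {i // sideType a b c (m i) = t} else 0 := by
    intro P u v hu hv huv h
    rw [hW u hu v hv huv, ← card_subtype_comp]
    exact Nat.card_congr (Equiv.subtypeEquivRight h)
  refine ⟨?_, hquad _ _ ?_, hquad _ _ ?_, hquad _ _ ?_, ?_, ?_, ?_, ?_, ?_, ?_⟩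
  · have : IsEmpty {i // sideType a b c (m i) = (false, false, false)} := by
      refine ⟨fun i => ?_⟩
      have := hT _ _ _ _ i.2
      obtain ⟨v, hv, hv'⟩ := hex i.1
      simp only [Finset.mem_insert, Finset.mem_singleton] at hv
      rcases hv with rfl | rfl | rfl | rfl
      · exact absurd hv' (ho i.1).not_gt
      · exact absurd (this.1.2 hv') (by simp)
      · exact absurd (this.2.1.2 hv') (by simp)
      · exact absurd (this.2.2.2 hv') (by simp)
    exact Nat.card_of_isEmpty
  · intro i k hi hk
    obtain ⟨h1, h2, h3⟩ := hT _ _ _ _ hi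
    obtain ⟨h1', h2', h3'⟩ := hT _ _ _ _ hk
    exact hm.not_crossing (hne i k _ _ (by simp) hi hk) hao hbo hco hoo (by simpa using h1)
      (by simpa using h2) (hneg i c hco (by simpa using h3)) (ho i) (by simpa using h1')
      (hneg k b hbo (by simpa using h2')) (by simpa using h3') (ho k)
  · intro i k hi hk
    obtain ⟨h1, h2, h3⟩ := hT _ _ _ _ hi
    obtain ⟨h1', h2', h3'⟩ := hT _ _ _ _ hk
    exact hm.not_crossing (hne i k _ _ (by simp) hi hk) hbo hao hco hoo (by simpa using h2)
      (by simpa using h1) (hneg i c hco (by simpa using h3)) (ho i) (by simpa using h2')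
      (hneg k a hao (by simpa using h1')) (by simpa using h3') (ho k)
  · intro i k hi hk
    obtain ⟨h1, h2, h3⟩ := hT _ _ _ _ hi
    obtain ⟨h1', h2', h3'⟩ := hT _ _ _ _ hk
    exact hm.not_crossing (hne i k _ _ (by simp) hi hk) hco hao hbo hoo (by simpa using h3)
      (by simpa using h1) (hneg i b hbo (by simpa using h2)) (ho i) (by simpa using h3')
      (hneg k a hao (by simpa using h1')) (by simpa using h2') (ho k)
  · rw [hsum (fun t => t.1) o a hoo hao hoa fun i => by simp [hcross_o a hao, sideType]]
    simp [Fintype.sum_prod_type]; ring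
  · rw [hsum (fun t => t.2.1) o b hoo hbo hob fun i => by simp [hcross_o b hbo, sideType]]
    simp [Fintype.sum_prod_type]; ring
  · rw [hsum (fun t => t.2.2) o c hoo hco hoc fun i => by simp [hcross_o c hco, sideType]]
    simp [Fintype.sum_prod_type]; ring
  · rw [hsum (fun t => t.1 ^^ t.2.1) a b hao hbo hab fun i => by
      simp only [hcross a hao b hbo, sideType, bne_iff_ne, ne_eq, decide_eq_decide]]
    simp [Fintype.sum_prod_type]; ring
  · rw [hsum (fun t => t.1 ^^ t.2.2) a c hao hco hac fun i => by
      simp only [hcross a hao c hco, sideType, bne_iff_ne, ne_eq, decide_eq_decide]]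
    simp [Fintype.sum_prod_type]; ring
  · rw [hsum (fun t => t.2.1 ^^ t.2.2) b c hbo hco hbc fun i => by
      simp only [hcross b hbo c hco, sideType, bne_iff_ne, ne_eq, decide_eq_decide]]
    simp [Fintype.sum_prod_type]; ring

end Counting

/-! ### Families with equal edge weights -/

section Matching

open scoped Matrix

variable {V : Type*} [Fintype V] [DecidableEq V] {ι : Type*}

theorem exists_equiv_lt_iff {α β : Type*} [Finite α] [Finite β] (h : Nat.card α = Nat.card β)
    {r : α → ℝ} {r' : β → ℝ} (hr : Function.Injective r) (hr' : Function.Injective r') :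
    ∃ e : α ≃ β, ∀ i k, r i < r k ↔ r' (e i) < r' (e k) := by
  have := Fintype.ofFinite α
  have := Fintype.ofFinite β
  let _ : LinearOrder α := LinearOrder.lift' r hr
  let _ : LinearOrder β := LinearOrder.lift' r' hr'
  rw [Nat.card_eq_fintype_card, Nat.card_eq_fintype_card] at h
  let e₁ := Fintype.orderIsoFinOfCardEq α h
  let e₂ := Fintype.orderIsoFinOfCardEq β (rfl : Fintype.card β = Fintype.card β)
  exact ⟨(e₁.symm.trans e₂).toEquiv,
    fun i k => ((e₁.symm.trans e₂).lt_iff_lt (x := i) (y := k)).symm⟩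

/-- Bijections between the fibers of two maps that respect given orders of the fibers. -/
theorem exists_equiv_fiberwise {α β τ : Type*} [Finite α] [Finite β] {T : α → τ} {T' : β → τ}
    (h : ∀ t, Nat.card {i // T i = t} = Nat.card {i // T' i = t}) {r : α → ℝ} {r' : β → ℝ}
    (hr : ∀ i k, T i = T k → r i = r k → i = k) (hr' : ∀ i k, T' i = T' k → r' i = r' k → i = k) :
    ∃ e : α ≃ β, (∀ i, T' (e i) = T i) ∧ ∀ i k, T i = T k → (r i < r k ↔ r' (e i) < r' (e k)) := by
  have hex : ∀ t, ∃ e : {i // T i = t} ≃ {i // T' i = t},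
      ∀ i k, r i.1 < r k.1 ↔ r' (e i).1 < r' (e k).1 := fun t =>
    exists_equiv_lt_iff (h t) (r := fun i : {i // T i = t} => r i.1)
      (r' := fun i : {i // T' i = t} => r' i.1)
      (fun i k hik => Subtype.ext (hr _ _ (i.2.trans k.2.symm) hik))
      (fun i k hik => Subtype.ext (hr' _ _ (i.2.trans k.2.symm) hik))
  choose e he using hex
  set E : α ≃ β := (Equiv.sigmaFiberEquiv T).symm.trans
    ((Equiv.sigmaCongrRight e).trans (Equiv.sigmaFiberEquiv T')) with hE
  have hEe : ∀ t (i : {i // T i = t}), E i.1 = (e t i).1 := by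
    rintro t ⟨i, rfl⟩
    rfl
  refine ⟨E, fun i => ?_, fun i k hik => ?_⟩
  · rw [hEe (T i) ⟨i, rfl⟩]
    exact (e (T i) ⟨i, rfl⟩).2
  · rw [hEe (T k) ⟨i, hik⟩, hEe (T k) ⟨k, rfl⟩]
    exact he (T k) ⟨i, hik⟩ ⟨k, rfl⟩

/-- The relative position of two flat families is determined by the sides of the vertices and by
the order of the sections that separate the vertices in the same way. -/
theorem samePosition_of_order {s : Finset V} {o : V} (hos : o ∈ s) {m m' : ι → V → ℝ}
    (hm : FlatFamily s m) (hm' : FlatFamily s m') (ho : ∀ i, m i o < 0)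
    (hex : ∀ i, ∃ v ∈ s, 0 < m i v)
    (hsign : ∀ i, ∀ v ∈ s, SignType.sign (m i v) = SignType.sign (m' i v)) (w : ι → V)
    (hw : ∀ i, w i ∈ s) (hw' : ∀ i, 0 < m i (w i))
    (hwc : ∀ i k, (∀ v ∈ s, SignType.sign (m i v) = SignType.sign (m k v)) → w i = w k)
    (horder : ∀ i k, (∀ v ∈ s, SignType.sign (m i v) = SignType.sign (m k v)) →
      (crossing (m i) o (w i) < crossing (m k) o (w k) ↔
        crossing (m' i) o (w i) < crossing (m' k) o (w k))) :
    SamePosition s m m' := by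
  refine ⟨hm, hm', hsign, fun i k hik x hx x' hx' h0 h0' => ?_⟩
  have hpt : ∀ u ∈ s, ∀ v ∈ s, ∀ l : V → ℝ, l u * l v < 0 →
      edgePoint u v (crossing l u v) ∈ face s := fun u hu v hv l hl =>
    face_mono (edge_subset hu hv) (edgePoint_mem (Ioo_subset_Icc_self (crossing_mem hl)))
  by_cases hE : ∃ u ∈ s, ∃ v ∈ s, m k u * m k v < 0 ∧ 0 < m i u * m i v
  · obtain ⟨u, hu, v, hv, hk, hi⟩ := hE
    have hk' := (mul_neg_iff_of_sign (hsign k u hu) (hsign k v hv)).1 hk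
    have hi' : 0 < m' i u * m' i v := by
      rw [← sign_eq_one_iff, sign_mul, ← hsign i u hu, ← hsign i v hv, ← sign_mul, sign_eq_one_iff]
      exact hi
    rw [hm.sign_const hik hx (hpt u hu v hv _ hk) h0 (dotProduct_crossing hk),
      hm'.sign_const hik hx' (hpt u hu v hv _ hk') h0' (dotProduct_crossing hk'),
      sign_at_crossing hk hi, sign_at_crossing hk' hi', hsign i u hu]
  · push Not at hE
    have hE' : ∀ u ∈ s, ∀ v ∈ s, m k u * m k v < 0 → m i u * m i v < 0 := fun u hu v hv h =>
      lt_of_le_of_ne (hE u hu v hv h) (mul_ne_zero (hm.ne_zero i u hu) (hm.ne_zero i v hv))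
    -- the two functionals separate the vertices in the same way
    have hpos : ∀ v ∈ s, 0 < m k v → 0 < m i v := fun v hv h =>
      pos_of_mul_neg_right (hE' o hos v hv (mul_neg_of_neg_of_pos (ho k) h)) (ho i).le
    have hneg : ∀ v ∈ s, m k v < 0 → m i v < 0 := fun v hv h => by
      obtain ⟨p, hp, hp'⟩ := hex k
      exact neg_of_mul_neg_right (hE' p hp v hv (mul_neg_of_pos_of_neg hp' h)) (hpos p hp hp').le
    have hss : ∀ v ∈ s, SignType.sign (m i v) = SignType.sign (m k v) := fun v hv => by
      rcases lt_or_gt_of_ne (hm.ne_zero k v hv) with h | h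
      · rw [sign_neg h, sign_neg (hneg v hv h)]
      · rw [sign_pos h, sign_pos (hpos v hv h)]
    have hwik := hwc i k hss
    have hki : m k o * m k (w k) < 0 := mul_neg_of_neg_of_pos (ho k) (hw' k)
    have hii : m i o * m i (w k) < 0 := mul_neg_of_neg_of_pos (ho i) (hwik ▸ hw' i)
    have hki' := (mul_neg_iff_of_sign (hsign k o hos) (hsign k _ (hw k))).1 hki
    have hii' := (mul_neg_iff_of_sign (hsign i o hos) (hsign i _ (hw k))).1 hii
    have e1 := hm.sign_const hik hx (hpt o hos _ (hw k) _ hki) h0 (dotProduct_crossing hki)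
    have e2 := hm'.sign_const hik hx' (hpt o hos _ (hw k) _ hki') h0' (dotProduct_crossing hki')
    have n1 := hm.disjoint i k hik _ (hpt o hos _ (hw k) _ hki) (dotProduct_crossing hki)
    have n2 := hm'.disjoint i k hik _ (hpt o hos _ (hw k) _ hki') (dotProduct_crossing hki')
    rw [dotProduct_edgePoint' hii] at e1 n1
    rw [dotProduct_edgePoint' hii'] at e2 n2
    rw [e1, e2, sign_mul, sign_mul, sign_sub_of_mul_neg hii, sign_sub_of_mul_neg hii',
      hsign i o hos]
    congr 1
    have := horder i k hss
    rw [hwik] at this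
    have n1 := right_ne_zero_of_mul n1
    have n2 := right_ne_zero_of_mul n2
    by_cases hlt : crossing (m i) o (w k) < crossing (m k) o (w k)
    · rw [sign_neg (sub_neg.2 hlt), sign_neg (sub_neg.2 (this.1 hlt))]
    · have h1 : 0 < crossing (m i) o (w k) - crossing (m k) o (w k) :=
        lt_of_le_of_ne (sub_nonneg.2 (not_lt.1 hlt)) n1.symm
      have h2 : 0 < crossing (m' i) o (w k) - crossing (m' k) o (w k) :=
        lt_of_le_of_ne (sub_nonneg.2 (not_lt.1 fun h => hlt (this.2 h))) n2.symm
      rw [sign_pos h1, sign_pos h2]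

/-- Two flat families in a tetrahedron that have equally many points on each edge can be indexed
such that they are in the same position. -/
theorem exists_samePosition {ι ι' : Type} [Finite ι] [Finite ι'] {o a b c : V} {l : ι → V → ℝ}
    {l' : ι' → V → ℝ} (hl : FlatFamily {o, a, b, c} l) (hl' : FlatFamily {o, a, b, c} l')
    (hoa : o ≠ a) (hob : o ≠ b) (hoc : o ≠ c) (hab : a ≠ b) (hac : a ≠ c) (hbc : b ≠ c)
    (hW : ∀ u ∈ ({o, a, b, c} : Finset V), ∀ v ∈ ({o, a, b, c} : Finset V), u ≠ v →
      (zeros l ∩ face ({u, v} : Finset V)).ncard = (zeros l' ∩ face ({u, v} : Finset V)).ncard) :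
    ∃ (κ : Type) (_ : Finite κ) (m m' : κ → V → ℝ), SamePosition {o, a, b, c} m m' ∧
      (∀ x ∈ face ({o, a, b, c} : Finset V), (x ∈ zeros l ↔ x ∈ zeros m)) ∧
      ∀ x ∈ face ({o, a, b, c} : Finset V), (x ∈ zeros l' ↔ x ∈ zeros m') := by
  have hos : o ∈ ({o, a, b, c} : Finset V) := by simp
  obtain ⟨κ, _, m, hm, ho, hex, hz⟩ := hl.exists_normalized hos
  obtain ⟨κ', _, m', hm', ho', hex', hz'⟩ := hl'.exists_normalized hos
  have hedge : ∀ {G G' : Set (V → ℝ)}, (∀ x ∈ face ({o, a, b, c} : Finset V), (x ∈ G ↔ x ∈ G')) →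
      ∀ u ∈ ({o, a, b, c} : Finset V), ∀ v ∈ ({o, a, b, c} : Finset V),
      G ∩ face ({u, v} : Finset V) = G' ∩ face ({u, v} : Finset V) := by
    intro G G' h u hu v hv
    ext x
    exact and_congr_left fun hx => h x (face_mono (edge_subset hu hv) hx)
  have hc := edgeCounts_of_normalized hm ho hex
    (W := fun u v => (zeros l ∩ face ({u, v} : Finset V)).ncard) (fun u hu v hv huv => by
      rw [hedge hz u hu v hv, hm.ncard_edge hu hv huv]) hoa hob hoc hab hac hbc
  have hc' := edgeCounts_of_normalized hm' ho' hex'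
    (W := fun u v => (zeros l ∩ face ({u, v} : Finset V)).ncard) (fun u hu v hv huv => by
      rw [hW u hu v hv huv, hedge hz' u hu v hv, hm'.ncard_edge hu hv huv])
    hoa hob hoc hab hac hbc
  -- a vertex on the positive side that depends only on the type
  set far : Bool × Bool × Bool → V := fun t => if t.1 then a else if t.2.1 then b else c with hfar
  have hfar_mem : ∀ t, far t ∈ ({o, a, b, c} : Finset V) := by
    intro t
    simp only [hfar]
    split_ifs <;> simp
  have hfar_pos : ∀ l : V → ℝ, l o < 0 → (∃ v ∈ ({o, a, b, c} : Finset V), 0 < l v) →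
      0 < l (far (sideType a b c l)) := by
    rintro l h0 ⟨v, hv, hv'⟩
    simp only [hfar, sideType, decide_eq_true_eq]
    simp only [Finset.mem_insert, Finset.mem_singleton] at hv
    split_ifs with h1 h2
    · exact h1
    · exact h2
    · rcases hv with rfl | rfl | rfl | rfl
      · exact absurd hv' h0.not_gt
      · exact absurd hv' h1
      · exact absurd hv' h2
      · exact hv'
  have hinj : ∀ {κ : Type} {m : κ → V → ℝ}, FlatFamily {o, a, b, c} m → (∀ i, m i o < 0) →
      (∀ i, ∃ v ∈ ({o, a, b, c} : Finset V), 0 < m i v) → ∀ i k,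
      sideType a b c (m i) = sideType a b c (m k) →
      crossing (m i) o (far (sideType a b c (m i))) =
        crossing (m k) o (far (sideType a b c (m k))) → i = k := by
    intro κ m hm ho hex i k hT hr
    by_contra hik
    rw [hT] at hr
    have h1 : m i o * m i (far (sideType a b c (m k))) < 0 :=
      mul_neg_of_neg_of_pos (ho i) (hT ▸ hfar_pos _ (ho i) (hex i))
    have h2 := mul_neg_of_neg_of_pos (ho k) (hfar_pos _ (ho k) (hex k))
    refine hm.disjoint i k hik _ (face_mono (edge_subset hos (hfar_mem _))
      (edgePoint_mem (Ioo_subset_Icc_self (crossing_mem h2)))) (dotProduct_crossing h2) ?_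
    rw [← hr]
    exact dotProduct_crossing h1
  obtain ⟨e, he1, he2⟩ := exists_equiv_fiberwise (T := fun i => sideType a b c (m i))
    (T' := fun i => sideType a b c (m' i)) (fun t => hc.unique hc' t.1 t.2.1 t.2.2)
    (r := fun i => crossing (m i) o (far (sideType a b c (m i))))
    (r' := fun i => crossing (m' i) o (far (sideType a b c (m' i))))
    (hinj hm ho hex) (hinj hm' ho' hex')
  have hTsign : ∀ {l l' : V → ℝ}, (∀ v ∈ ({o, a, b, c} : Finset V), l v ≠ 0) →
      (∀ v ∈ ({o, a, b, c} : Finset V), l' v ≠ 0) → l o < 0 → l' o < 0 →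
      sideType a b c l = sideType a b c l' →
      ∀ v ∈ ({o, a, b, c} : Finset V), SignType.sign (l v) = SignType.sign (l' v) := by
    intro l l' h h' h0 h0' hT v hv
    have key : ∀ v, l v ≠ 0 → l' v ≠ 0 → (0 < l v ↔ 0 < l' v) →
        SignType.sign (l v) = SignType.sign (l' v) := by
      intro v h1 h2 h3
      by_cases hp : 0 < l v
      · rw [sign_pos hp, sign_pos (h3.1 hp)]
      · rw [sign_neg (lt_of_le_of_ne (not_lt.1 hp) h1),
          sign_neg (lt_of_le_of_ne (not_lt.1 fun hh => hp (h3.2 hh)) h2)]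
    simp only [sideType, Prod.mk.injEq, decide_eq_decide] at hT
    refine key v (h v hv) (h' v hv) ?_
    simp only [Finset.mem_insert, Finset.mem_singleton] at hv
    rcases hv with rfl | rfl | rfl | rfl
    · simp [h0.not_gt, h0'.not_gt]
    · exact hT.1
    · exact hT.2.1
    · exact hT.2.2
  have hsT : ∀ i k, (∀ v ∈ ({o, a, b, c} : Finset V),
      SignType.sign (m i v) = SignType.sign (m k v)) →
      sideType a b c (m i) = sideType a b c (m k) := by
    intro i k h
    have key : ∀ v ∈ ({o, a, b, c} : Finset V), (0 < m i v ↔ 0 < m k v) := fun v hv => by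
      rw [← sign_eq_one_iff, h v hv, sign_eq_one_iff]
    simp only [sideType, Prod.mk.injEq, decide_eq_decide]
    exact ⟨key a (by simp), key b (by simp), key c (by simp)⟩
  refine ⟨κ, inferInstance, m, m' ∘ e, ?_, hz, fun x hx => ?_⟩
  · refine samePosition_of_order hos hm (hm'.comp e.injective) ho hex
      (fun i => hTsign (hm.ne_zero i) (hm'.ne_zero (e i)) (ho i) (ho' (e i)) (he1 i).symm)
      (fun i => far (sideType a b c (m i))) (fun i => hfar_mem _)
      (fun i => hfar_pos _ (ho i) (hex i)) (fun i k h => by rw [hsT i k h]) fun i k h => ?_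
    have := he2 i k (hsT i k h)
    rw [he1 i, he1 k] at this
    exact this
  · rw [hz' x hx]
    simp only [zeros, mem_ofPred_eq, Function.comp]
    exact ⟨fun ⟨i, hi⟩ => ⟨e.symm i, by simpa using hi⟩, fun ⟨i, hi⟩ => ⟨_, hi⟩⟩

end Matching

/-! ### Edge weights of a subdivided tetrahedron -/

section Weights

open scoped Matrix

variable {V : Type*} [Fintype V] [DecidableEq V] {ι : Type*}

theorem edgeWeight_comm (G : Set (V → ℝ)) (u v : V) :
    (G ∩ face ({u, v} : Finset V)).ncard = (G ∩ face ({v, u} : Finset V)).ncard := by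
  rw [Finset.pair_comm]

theorem NormalOn.exists_edgeCounts {o a b c : V} {G : Set (V → ℝ)}
    (h : NormalOn {o, a, b, c} G) (hoa : o ≠ a) (hob : o ≠ b) (hoc : o ≠ c) (hab : a ≠ b)
    (hac : a ≠ c) (hbc : b ≠ c) :
    ∃ N, EdgeCounts (fun u v => (G ∩ face ({u, v} : Finset V)).ncard) o a b c N := by
  obtain ⟨n, l, hl, φ, hφ⟩ := h
  obtain ⟨κ, _, m, hm, ho, hex, hz⟩ := hl.exists_normalized (o := o) (by simp)
  refine ⟨_, edgeCounts_of_normalized hm ho hex (fun u hu v hv huv => ?_) hoa hob hoc hab hac hbc⟩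
  rw [hφ.ncard_edge (edge_subset hu hv), ← hm.ncard_edge hu hv huv]
  congr 1
  ext x
  exact and_congr_left fun hx => hz x (face_mono (edge_subset hu hv) hx)

/-- The edge weights `W` of the subdivision of the tetrahedron `abcd` at `o` are those of a system
of disks and spheres of the following types: `xa`, `xb`, `xc`, `xd` triangles that cut off a vertex
without `o`, further `m` triangles that cut off `a` together with `o`, `k₁` and `k₂` quadrilaterals
that separate `a, b` from `c, d`, with `o` on the side of `c, d` and of `a, b` respectively, and
`s` spheres around `o`. There cannot be disks of both types counted by `m` and `k₁`. -/
def TargetWeights (W : V → V → ℕ) (o a b c d : V) : Prop :=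
  ∃ xa xb xc xd s m k₁ k₂ : ℕ, (m = 0 ∨ k₁ = 0) ∧
    W o a = s + xa + k₁ ∧ W o b = s + xb + m + k₁ ∧
    W o c = s + xc + m + k₂ ∧ W o d = s + xd + m + k₂ ∧
    W a b = xa + xb + m ∧ W a c = xa + xc + m + k₁ + k₂ ∧ W a d = xa + xd + m + k₁ + k₂ ∧
    W b c = xb + xc + k₁ + k₂ ∧ W b d = xb + xd + k₁ + k₂ ∧ W c d = xc + xd

/-- The arcs that cut off `o` in the triangle `oab`. -/
theorem EdgeCounts.arcs_ab {W : V → V → ℕ} {o a b c : V} {N : Bool → Bool → Bool → ℕ}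
    (h : EdgeCounts W o a b c N) :
    W o a + W o b = W a b + 2 * (N true true true + N true true false) := by
  have := h.oa; have := h.ob; have := h.ab
  clear h
  omega

theorem EdgeCounts.arcs_ac {W : V → V → ℕ} {o a b c : V} {N : Bool → Bool → Bool → ℕ}
    (h : EdgeCounts W o a b c N) :
    W o a + W o c = W a c + 2 * (N true true true + N true false true) := by
  have := h.oa; have := h.oc; have := h.ac
  clear h
  omega

theorem EdgeCounts.arcs_bc {W : V → V → ℕ} {o a b c : V} {N : Bool → Bool → Bool → ℕ}
    (h : EdgeCounts W o a b c N) :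
    W o b + W o c = W b c + 2 * (N true true true + N false true true) := by
  have := h.ob; have := h.oc; have := h.bc
  clear h
  omega

set_option maxHeartbeats 1000000 in
/-- The case of `exists_targetWeights` in which the tetrahedron `oabc` has the fewest triangles that
cut off `o`, and these triangles are counted as spheres. If it has quadrilaterals, they separate
`o, c` from `a, b`. -/
theorem targetWeights_aux {W : V → V → ℕ} {o a b c d : V} (hW : ∀ u v, W u v = W v u)
    {Na Nb Nc Nd : Bool → Bool → Bool → ℕ} (ha : EdgeCounts W o b c d Na)
    (hb : EdgeCounts W o a c d Nb) (hc : EdgeCounts W o a b d Nc) (hd : EdgeCounts W o a b c Nd)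
    (hda : Nd true true true ≤ Na true true true) (hdb : Nd true true true ≤ Nb true true true)
    (hdc : Nd true true true ≤ Nc true true true) (h₁ : Nd false true true = 0)
    (h₂ : Nd true false true = 0) :
    TargetWeights W o a b c d ∨ TargetWeights W o c a b d ∨ TargetWeights W o c b a d ∨
      TargetWeights W o c d a b := by
  -- the numbers of arcs around `o` in the six triangles at `o`, seen from both sides
  have had : Na true true true + Na true true false = Nd true true true + Nd false true true := by
    have := ha.arcs_ab; have := hd.arcs_bc; omega
  have hbd : Nb true true true + Nb true true false = Nd true true true + Nd true false true := by
    have := hb.arcs_ab; have := hd.arcs_ac; omega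
  have hcd : Nc true true true + Nc true true false = Nd true true true + Nd true true false := by
    have := hc.arcs_ab; have := hd.arcs_ab; omega
  have hab : Na true true true + Na false true true = Nb true true true + Nb false true true := by
    have := ha.arcs_bc; have := hb.arcs_bc; omega
  have hac : Na true true true + Na true false true = Nc true true true + Nc false true true := by
    have := ha.arcs_ac; have := hc.arcs_bc; omega
  have hbc : Nb true true true + Nb true false true = Nc true true true + Nc true false true := by
    have := hb.arcs_ac; have := hc.arcs_ac; omega
  have e1 : Na true true true = Nd true true true := by clear * - had h₁ hda; omega
  have e2 : Na true true false = 0 := by clear * - had h₁ hda; omega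
  have e3 : Nb true true true = Nd true true true := by clear * - hbd h₂ hdb; omega
  have e4 : Nb true true false = 0 := by clear * - hbd h₂ hdb; omega
  have w1 := hW c a
  have w2 := hW c b
  have w3 := hW b a
  have w4 := hW d a
  have w5 := hW d b
  have qa := ha.quad₃
  have qb := hb.quad₃
  have qc₁ := hc.quad₁
  have qc₂ := hc.quad₂
  have qc₃ := hc.quad₃
  obtain ⟨-, -, -, -, a4, a5, a6, a7, a8, a9⟩ := ha
  obtain ⟨-, -, -, -, b4, b5, b6, b7, b8, b9⟩ := hb
  obtain ⟨-, -, -, -, c4, c5, c6, c7, c8, c9⟩ := hc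
  obtain ⟨-, -, -, -, d4, d5, d6, d7, d8, d9⟩ := hd
  -- Since the quadrilaterals of a tetrahedron are all of one type, one of four combinations of
  -- types occurs; in each of them the counts are read off from the small tetrahedra.
  by_cases hI : Na true false true = 0 ∧ Nb true false true = 0
  · left
    obtain ⟨f1, f2⟩ := hI
    have f3 : Nc false true true = 0 := by clear * - hac f1 e1 hdc; omega
    have f4 : Nc true false true = 0 := by clear * - hbc f2 e3 hdc; omega
    clear qa qb qc₁ qc₂ qc₃ hda hdb hdc
    refine ⟨Nd true false false, Nd false true false, Na false true false, Na false false true,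
      Nd true true true, 0, Nd true true false, Na false true true, Or.inl rfl, ?_⟩
    refine ⟨?_, ?_, ?_, ?_, ?_, ?_, ?_, ?_, ?_, ?_⟩
    · linarith only [d4, h₂]
    · linarith only [d5, h₁]
    · linarith only [a5, e1, e2]
    · linarith only [a6, f1, e1]
    · linarith only [d7, h₁, h₂]
    · linarith only [d8, h₁, d6, h₂, a5, e1, e2]
    · linarith only [b8, b4, b6, d4, h₂, a6, f1, e1, e3, e4, f2]
    · linarith only [a7, a4, e2, f1, e1, d5, h₁]
    · linarith only [a8, a4, d5, h₁, e1, e2, f1]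
    · linarith only [a9, e2, f1]
  · have f1 : Na false true true = 0 := by clear * - hI qa qb hab e1 e3; omega
    have f2 : Nb false true true = 0 := by clear * - f1 hab e1 e3; omega
    clear hI qa qb
    right
    by_cases hca : Nc true false true = 0 ∧ Nc true true false = 0
    · left
      obtain ⟨f3, f4⟩ := hca
      clear qc₁ qc₂ qc₃ hda hdb hdc
      have z : Na true false true = Nb true false true + Nc false true true := by
        clear * - hac hbc e1 e3 f3
        omega
      refine ⟨Na false true false, Nb true false false, Na true false false, Na false false true,
        Nd true true true, Nb true false true, 0, Nc false true true, Or.inr rfl, ?_⟩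
      refine ⟨?_, ?_, ?_, ?_, ?_, ?_, ?_, ?_, ?_, ?_⟩
      · linarith only [a5, e1, e2, f1]
      · linarith only [b4, e3, e4]
      · linarith only [a4, e1, e2, z]
      · linarith only [a6, e1, f1, z]
      · linarith only [w1, b7, b5, a5, e1, e2, e3, e4, f1, f2]
      · linarith only [w2, a7, f1, z]
      · linarith only [a9, e2, z]
      · linarith only [c7, c4, c5, b4, a4, hbc, f3, f4, e1, e2, e3, e4, z]
      · linarith only [b8, b6, a6, f1, f2, e1, e2, e3, e4, z]
      · linarith only [a8, e2, f1]
    · right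
      by_cases hcb : Nc false true true = 0 ∧ Nc true true false = 0
      · left
        obtain ⟨f3, f4⟩ := hcb
        clear hca qc₁ qc₂ qc₃ hda hdb hdc
        have z : Nb true false true = Na true false true + Nc true false true := by
          clear * - hac hbc e1 e3 f3
          omega
        refine ⟨Na false true false, Na true false false, Nb true false false,
          Nb false false true, Nd true true true, Na true false true, 0, Nc true false true,
          Or.inr rfl, ?_⟩
        refine ⟨?_, ?_, ?_, ?_, ?_, ?_, ?_, ?_, ?_, ?_⟩
        · linarith only [a5, e1, e2, f1]
        · linarith only [a4, e1, e2]
        · linarith only [b4, e3, e4, z]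
        · linarith only [b6, e3, f2, z]
        · linarith only [w2, a7, f1]
        · linarith only [w1, b7, b5, a5, f1, f2, e1, e2, e3, e4, z]
        · linarith only [b9, b5, a5, f1, f2, e1, e2, e3, e4, z]
        · linarith only [w3, c7, c4, c5, a4, b4, hac, f3, f4, e1, e2, e3, e4, z]
        · linarith only [a8, a6, b6, f1, f2, e1, e2, e3, e4, z]
        · linarith only [b8, e4, f2]
      · right
        have f3 : Nc false true true = 0 := by clear * - hca hcb qc₁ qc₂ qc₃; omega
        have f4 : Nc true false true = 0 := by clear * - hca hcb qc₁ qc₂ qc₃; omega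
        clear hca hcb qc₁ qc₂ qc₃ hda hdb hdc
        have z : Nd true true false = Na true false true + Nc true true false := by
          clear * - hac hcd e1 f3
          omega
        refine ⟨Na false true false, Na false false true, Nd true false false,
          Nd false true false, Nd true true true, Na true false true, 0, Nc true true false,
          Or.inr rfl, ?_⟩
        refine ⟨?_, ?_, ?_, ?_, ?_, ?_, ?_, ?_, ?_, ?_⟩
        · linarith only [a5, e1, e2, f1]
        · linarith only [a6, e1, f1]
        · linarith only [d4, h₂, z]
        · linarith only [d5, h₁, z]
        · linarith only [a9, e2]
        · linarith only [w1, d8, d6, a5, h₁, h₂, e1, e2, f1, z]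
        · linarith only [w2, d9, d6, a5, h₁, h₂, e1, e2, f1, z]
        · linarith only [w4, b8, b4, b6, a6, d4, h₂, e1, e2, e3, e4, f1, f2, z, hbc, hac, f3, f4]
        · linarith only [w5, a8, a4, d5, h₁, e1, e2, f1, z]
        · linarith only [d7, h₁, h₂]

theorem EdgeCounts.swap_ab {W : V → V → ℕ} (hW : ∀ u v, W u v = W v u) {o a b c : V}
    {N : Bool → Bool → Bool → ℕ} (h : EdgeCounts W o a b c N) :
    EdgeCounts W o b a c fun α β γ => N β α γ where
  trivial := h.trivial
  quad₁ := h.quad₂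
  quad₂ := h.quad₁
  quad₃ := h.quad₃.symm
  oa := by have := h.ob; clear h; omega
  ob := by have := h.oa; clear h; omega
  oc := by have := h.oc; clear h; omega
  ab := by have := h.ab; have := hW a b; clear h; omega
  ac := by have := h.bc; clear h; omega
  bc := by have := h.ac; clear h; omega

theorem EdgeCounts.swap_bc {W : V → V → ℕ} (hW : ∀ u v, W u v = W v u) {o a b c : V}
    {N : Bool → Bool → Bool → ℕ} (h : EdgeCounts W o a b c N) :
    EdgeCounts W o a c b fun α β γ => N α γ β where
  trivial := h.trivial
  quad₁ := h.quad₁.symm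
  quad₂ := h.quad₃
  quad₃ := h.quad₂
  oa := by have := h.oa; clear h; omega
  ob := by have := h.oc; clear h; omega
  oc := by have := h.ob; clear h; omega
  ab := by have := h.ac; clear h; omega
  ac := by have := h.ab; clear h; omega
  bc := by have := h.bc; have := hW b c; clear h; omega

/-- The edge weights of the tetrahedron `oabc` are those of a system of normal disks of which `t`
are triangles that cut off `o`. -/
def ApexCount (W : V → V → ℕ) (o a b c : V) (t : ℕ) : Prop :=
  ∃ N, EdgeCounts W o a b c N ∧ N true true true = t

theorem ApexCount.swap_ab {W : V → V → ℕ} (hW : ∀ u v, W u v = W v u) {o a b c : V} {t : ℕ}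
    (h : ApexCount W o a b c t) : ApexCount W o b a c t := by
  obtain ⟨N, h, ht⟩ := h
  exact ⟨_, h.swap_ab hW, ht⟩

theorem ApexCount.swap_bc {W : V → V → ℕ} (hW : ∀ u v, W u v = W v u) {o a b c : V} {t : ℕ}
    (h : ApexCount W o a b c t) : ApexCount W o a c b t := by
  obtain ⟨N, h, ht⟩ := h
  exact ⟨_, h.swap_bc hW, ht⟩

/-- The case of `exists_targetWeights` in which the tetrahedron `oabc` has the fewest triangles that
cut off `o`. It has quadrilaterals of at most one type, and by symmetry their type can be chosen. -/
theorem exists_targetWeights_of_min {W : V → V → ℕ} (hW : ∀ u v, W u v = W v u) {o a b c d : V}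
    {ta tb tc td : ℕ} (ha : ApexCount W o b c d ta) (hb : ApexCount W o a c d tb)
    (hc : ApexCount W o a b d tc) (hd : ApexCount W o a b c td) (hda : td ≤ ta) (hdb : td ≤ tb)
    (hdc : td ≤ tc) :
    ∃ p q r t, [p, q, r, t].Perm [a, b, c, d] ∧ TargetWeights W o p q r t := by
  have key : ∀ {a b c : V} {ta tb tc : ℕ}, ApexCount W o b c d ta → ApexCount W o a c d tb →
      ApexCount W o a b d tc → td ≤ ta → td ≤ tb → td ≤ tc →
      ∀ Nd, EdgeCounts W o a b c Nd → Nd true true true = td → Nd false true true = 0 →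
      Nd true false true = 0 →
      ∃ p q r t, [p, q, r, t].Perm [a, b, c, d] ∧ TargetWeights W o p q r t := by
    rintro a b c ta tb tc ⟨Na, ha, rfl⟩ ⟨Nb, hb, rfl⟩ ⟨Nc, hc, rfl⟩ hda hdb hdc Nd hN rfl h1 h2
    rcases targetWeights_aux hW ha hb hc hN hda hdb hdc h1 h2 with h | h | h | h
    · exact ⟨_, _, _, _, List.Perm.refl _, h⟩
    · refine ⟨_, _, _, _, ?_, h⟩
      exact (List.Perm.swap _ _ _).trans ((List.Perm.swap _ _ _).cons _)
    · refine ⟨_, _, _, _, ?_, h⟩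
      exact ((List.Perm.swap _ _ _).trans ((List.Perm.swap _ _ _).cons _)).trans
        (List.Perm.swap _ _ _)
    · refine ⟨_, _, _, _, ?_, h⟩
      exact List.perm_append_comm (l₁ := [c, d]) (l₂ := [a, b])
  obtain ⟨Nd, hd, htd⟩ := hd
  by_cases h1 : Nd false true true = 0
  · by_cases h2 : Nd true false true = 0
    · exact key ha hb hc hda hdb hdc Nd hd htd h1 h2
    · have h3 : Nd true true false = 0 := hd.quad₁.resolve_right h2
      obtain ⟨p, q, r, t, hp, h⟩ := key (ha.swap_ab hW) hc hb hda hdc hdb _ (hd.swap_bc hW) htd h1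
        h3
      exact ⟨p, q, r, t, hp.trans ((List.Perm.swap _ _ _).cons _), h⟩
  · have h2 : Nd true false true = 0 := hd.quad₃.resolve_right h1
    have h3 : Nd true true false = 0 := hd.quad₂.resolve_right h1
    obtain ⟨p, q, r, t, hp, h⟩ := key (hc.swap_ab hW) (hb.swap_ab hW) (ha.swap_ab hW) hdc hdb hda _
      ((hd.swap_ab hW).swap_bc hW |>.swap_ab hW) htd h3 h2
    exact ⟨p, q, r, t, hp.trans (by
      exact ((List.Perm.swap _ _ _).trans ((List.Perm.swap _ _ _).cons _)).trans
        (List.Perm.swap _ _ _)), h⟩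

/-- The edge weights of a normal surface in the four tetrahedra of a stellar subdivision are those
of one of the standard surfaces. -/
theorem exists_targetWeights {W : V → V → ℕ} (hW : ∀ u v, W u v = W v u) {o a b c d : V}
    {Na Nb Nc Nd : Bool → Bool → Bool → ℕ} (ha : EdgeCounts W o b c d Na)
    (hb : EdgeCounts W o a c d Nb) (hc : EdgeCounts W o a b d Nc) (hd : EdgeCounts W o a b c Nd) :
    ∃ p q r t, [p, q, r, t].Perm [a, b, c, d] ∧ TargetWeights W o p q r t := by
  have ha' : ApexCount W o b c d _ := ⟨Na, ha, rfl⟩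
  have hb' : ApexCount W o a c d _ := ⟨Nb, hb, rfl⟩
  have hc' : ApexCount W o a b d _ := ⟨Nc, hc, rfl⟩
  have hd' : ApexCount W o a b c _ := ⟨Nd, hd, rfl⟩
  set ta := Na true true true
  set tb := Nb true true true
  set tc := Nc true true true
  set td := Nd true true true
  have hmin : (td ≤ ta ∧ td ≤ tb ∧ td ≤ tc) ∨ (tc ≤ ta ∧ tc ≤ tb ∧ tc ≤ td) ∨
      (tb ≤ ta ∧ tb ≤ tc ∧ tb ≤ td) ∨ (ta ≤ tb ∧ ta ≤ tc ∧ ta ≤ td) := by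
    clear ha hb hc hd ha' hb' hc' hd'
    omega
  rcases hmin with ⟨h1, h2, h3⟩ | ⟨h1, h2, h3⟩ | ⟨h1, h2, h3⟩ | ⟨h1, h2, h3⟩
  · exact exists_targetWeights_of_min hW ha' hb' hc' hd' h1 h2 h3
  · obtain ⟨p, q, r, t, hp, h⟩ := exists_targetWeights_of_min hW (ha'.swap_bc hW) (hb'.swap_bc hW)
      hd' hc' h1 h2 h3
    exact ⟨p, q, r, t, hp.trans (((List.Perm.swap _ _ _).cons _).cons _), h⟩
  · obtain ⟨p, q, r, t, hp, h⟩ := exists_targetWeights_of_min hW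
      ((ha'.swap_ab hW).swap_bc hW) (hc'.swap_bc hW) (hd'.swap_bc hW) hb' h1 h2 h3
    refine ⟨p, q, r, t, hp.trans ?_, h⟩
    exact (List.perm_append_comm (l₁ := [c, d]) (l₂ := [b])).cons _
  · obtain ⟨p, q, r, t, hp, h⟩ := exists_targetWeights_of_min hW
      ((hb'.swap_ab hW).swap_bc hW) ((hc'.swap_ab hW).swap_bc hW) ((hd'.swap_ab hW).swap_bc hW) ha'
      h1 h2 h3
    refine ⟨p, q, r, t, hp.trans ?_, h⟩
    exact List.perm_append_comm (l₁ := [b, c, d]) (l₂ := [a])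

end Weights

/-! ### Surfaces with given edge weights -/

section Target

open scoped Matrix

variable {V : Type*} [Fintype V] [DecidableEq V]

theorem dotProduct_sub_const {l x : V → ℝ} {c : ℝ} (hx : x ∈ face (Finset.univ : Finset V)) :
    (fun v => l v - c) ⬝ᵥ x = l ⬝ᵥ x - c := by
  simp only [dotProduct, sub_mul, Finset.sum_sub_distrib, ← Finset.mul_sum, hx.2.1, mul_one]

/-- Parallel families: for each `b`, there are `N b` level sets of the functional `f b`, at levels
between `lo b` and `hi b`. -/
theorem exists_parallelFamilies {n : ℕ} (f : Fin n → V → ℝ) (lo hi : Fin n → ℝ)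
    (N : Fin n → ℕ)
    (hlh : ∀ b, lo b < hi b) (hf : ∀ b v, f b v ≤ lo b ∨ hi b ≤ f b v)
    (hd : ∀ b b', b < b' → ∀ x ∈ face (Finset.univ : Finset V),
      lo b < f b ⬝ᵥ x → f b ⬝ᵥ x < hi b → lo b' < f b' ⬝ᵥ x → f b' ⬝ᵥ x < hi b' → False) :
    ∃ L : (Σ b, Fin (N b)) → V → ℝ, FlatFamily Finset.univ L ∧
      (∀ i, ∃ h, lo i.1 < h ∧ h < hi i.1 ∧ L i = fun v => f i.1 v - h) ∧
      ∀ u v, Nat.card {i // L i u * L i v < 0} =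
        ∑ b, if (hi b ≤ f b u ↔ hi b ≤ f b v) then 0 else N b := by
  set lev : (Σ b, Fin (N b)) → ℝ := fun i =>
    lo i.1 + (hi i.1 - lo i.1) * ((i.2 + 1 : ℝ) / (N i.1 + 1)) with hlev
  have hfrac : ∀ i : Σ b, Fin (N b), 0 < (i.2 + 1 : ℝ) / (N i.1 + 1) ∧
      (i.2 + 1 : ℝ) / (N i.1 + 1) < 1 := by
    intro i
    have : (i.2 : ℝ) < N i.1 := by exact_mod_cast i.2.2
    exact ⟨by positivity, (div_lt_one (by positivity)).2 (by linarith)⟩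
  have hlo : ∀ i, lo i.1 < lev i := fun i => by
    have := mul_pos (sub_pos.2 (hlh i.1)) (hfrac i).1
    simp only [hlev]; linarith
  have hhi : ∀ i, lev i < hi i.1 := fun i => by
    have := mul_lt_mul_of_pos_left (hfrac i).2 (sub_pos.2 (hlh i.1))
    simp only [hlev]; linarith
  have hinj : ∀ i k : Σ b, Fin (N b), i.1 = k.1 → lev i = lev k → i = k := by
    rintro ⟨b, i⟩ ⟨b', k⟩ h hl
    obtain rfl : b = b' := h
    have h1 : hi b - lo b ≠ 0 := (sub_pos.2 (hlh b)).ne'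
    have h2 : (N b + 1 : ℝ) ≠ 0 := by positivity
    simp only [hlev, add_right_inj] at hl
    have h3 := mul_left_cancel₀ h1 hl
    rw [div_left_inj' h2, add_left_inj] at h3
    have : i = k := Fin.ext (by exact_mod_cast h3)
    rw [this]
  set L : (Σ b, Fin (N b)) → V → ℝ := fun i v => f i.1 v - lev i with hL
  have hdot : ∀ i, ∀ x ∈ face (Finset.univ : Finset V), L i ⬝ᵥ x = f i.1 ⬝ᵥ x - lev i :=
    fun i x hx => dotProduct_sub_const hx
  have hpos : ∀ i v, 0 < L i v ↔ hi i.1 ≤ f i.1 v := by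
    intro i v
    simp only [hL, sub_pos]
    constructor
    · intro h
      rcases hf i.1 v with h' | h'
      · exact absurd (hlo i) (by linarith)
      · exact h'
    · exact fun h => (hhi i).trans_le h
  have hne : ∀ i v, L i v ≠ 0 := by
    intro i v h
    simp only [hL] at h
    have h1 := hlo i
    have h2 := hhi i
    rcases hf i.1 v with h' | h' <;> linarith
  refine ⟨L, ⟨fun i v _ => hne i v, ?_⟩, fun i => ⟨lev i, hlo i, hhi i, rfl⟩, fun u v => ?_⟩
  · intro i k hik x hx hk0 hi0
    rw [hdot _ _ hx, sub_eq_zero] at hk0 hi0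
    by_cases hb : i.1 = k.1
    · refine hik (hinj i k hb ?_)
      rw [← hi0, ← hk0, hb]
    · rcases lt_or_gt_of_ne hb with hb | hb
      · exact hd i.1 k.1 hb x hx (hi0 ▸ hlo i) (hi0 ▸ hhi i) (hk0 ▸ hlo k) (hk0 ▸ hhi k)
      · exact hd k.1 i.1 hb x hx (hk0 ▸ hlo k) (hk0 ▸ hhi k) (hi0 ▸ hlo i) (hi0 ▸ hhi i)
  · have hcr : ∀ i, L i u * L i v < 0 ↔ ¬ (hi i.1 ≤ f i.1 u ↔ hi i.1 ≤ f i.1 v) := by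
      intro i
      rw [← hpos, ← hpos]
      have h1 : ¬ 0 < L i u → L i u < 0 := fun h => lt_of_le_of_ne (not_lt.1 h) (hne i u)
      have h2 : ¬ 0 < L i v → L i v < 0 := fun h => lt_of_le_of_ne (not_lt.1 h) (hne i v)
      rw [mul_neg_iff]
      by_cases h : 0 < L i u <;> by_cases h' : 0 < L i v
      · simp [h, h', h.le, h'.le]
      · simp [h, h', h2 h']
      · simp [h, h', h1 h]
      · simp [h, h']
    classical
    rw [Nat.card_congr (Equiv.subtypeEquivRight hcr), Nat.card_eq_fintype_card,
      Fintype.card_subtype, ← Finset.univ_sigma_univ]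
    have : (Finset.univ.sigma fun b => (Finset.univ : Finset (Fin (N b)))).filter
        (fun i => ¬ (hi i.1 ≤ f i.1 u ↔ hi i.1 ≤ f i.1 v)) =
        (Finset.univ.filter fun b => ¬ (hi b ≤ f b u ↔ hi b ≤ f b v)).sigma
          fun b => (Finset.univ : Finset (Fin (N b))) := by
      ext i; simp
    rw [this, Finset.card_sigma, Finset.sum_filter]
    refine Finset.sum_congr rfl fun b _ => ?_
    by_cases h : (hi b ≤ f b u ↔ hi b ≤ f b v) <;> simp [h]

/-- The functional with given values at five vertices. -/
def fiveVec (o a b c : V) (xo xa xb xc xd : ℝ) : V → ℝ := fun v =>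
  if v = o then xo else if v = a then xa else if v = b then xb else if v = c then xc else xd

/-- The functional `l` on the simplex with the additional vertex `o` comes from an affine function
on the face opposite to `o` if `o` is placed at the point `p` of this face: its value at `o` is the
one at `p`. -/
def IsPlanar (o : V) (p l : V → ℝ) : Prop := l o = l ⬝ᵥ p

set_option maxHeartbeats 1000000 in
/-- The surfaces described by `TargetWeights` exist: they consist of planes in the tetrahedron
`abcd` and of small spheres around a point `p` of its interior. -/
theorem exists_targetFamily {W : V → V → ℕ} (hW : ∀ u v, W u v = W v u) {o a b c d : V}
    (hnd : [o, a, b, c, d].Nodup) (huniv : (Finset.univ : Finset V) = {o, a, b, c, d})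
    (h : TargetWeights W o a b c d) :
    ∃ (κ : Type) (_ : Finite κ) (L : κ → V → ℝ) (p : V → ℝ), FlatFamily Finset.univ L ∧
      p ∈ face (Finset.univ.erase o) ∧ (∀ v, v ≠ o → 0 < p v) ∧
      (∀ i, IsPlanar o p (L i) ∨ ∃ h, 0 < h ∧ h < 1 ∧ L i = fun v => Pi.single o (1 : ℝ) v - h) ∧
      ∀ u v, u ≠ v → Nat.card {i // L i u * L i v < 0} = W u v := by
  simp only [List.nodup_cons, List.mem_cons, List.not_mem_nil, or_false, not_or,
    List.nodup_nil, and_true, not_false_eq_true] at hnd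
  obtain ⟨⟨oa, ob, oc, od⟩, ⟨ab, ac, ad⟩, ⟨bc, bd⟩, cd⟩ := hnd
  have hv : ∀ v, v = o ∨ v = a ∨ v = b ∨ v = c ∨ v = d := fun v => by
    have := Finset.mem_univ v
    rw [huniv] at this
    simpa using this
  have hsum : ∀ g : V → ℝ, ∑ v, g v = g o + (g a + (g b + (g c + g d))) := by
    intro g
    rw [huniv, Finset.sum_insert (by simp [oa, ob, oc, od]),
      Finset.sum_insert (by simp [ab, ac, ad]),
      Finset.sum_insert (by simp [bc, bd]), Finset.sum_insert (by simp [cd]), Finset.sum_singleton]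
  have vo : ∀ xo xa xb xc xd, fiveVec o a b c xo xa xb xc xd o = xo := by simp [fiveVec]
  have va : ∀ xo xa xb xc xd, fiveVec o a b c xo xa xb xc xd a = xa := by
    simp [fiveVec, Ne.symm oa]
  have vb : ∀ xo xa xb xc xd, fiveVec o a b c xo xa xb xc xd b = xb := by
    simp [fiveVec, Ne.symm ob, Ne.symm ab]
  have vc : ∀ xo xa xb xc xd, fiveVec o a b c xo xa xb xc xd c = xc := by
    simp [fiveVec, Ne.symm oc, Ne.symm ac, Ne.symm bc]
  have vd : ∀ xo xa xb xc xd, fiveVec o a b c xo xa xb xc xd d = xd := by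
    simp [fiveVec, Ne.symm od, Ne.symm ad, Ne.symm bd, Ne.symm cd]
  have vdot : ∀ xo xa xb xc xd (x : V → ℝ), fiveVec o a b c xo xa xb xc xd ⬝ᵥ x =
      xo * x o + (xa * x a + (xb * x b + (xc * x c + xd * x d))) := by
    intro xo xa xb xc xd x
    rw [dotProduct, hsum, vo, va, vb, vc, vd]
  have hface : ∀ x ∈ face (Finset.univ : Finset V), 0 ≤ x o ∧ 0 ≤ x a ∧ 0 ≤ x b ∧ 0 ≤ x c ∧
      0 ≤ x d ∧ x o + (x a + (x b + (x c + x d))) = 1 := fun x hx =>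
    ⟨hx.1 o, hx.1 a, hx.1 b, hx.1 c, hx.1 d, by rw [← hsum]; exact hx.2.1⟩
  have hpairs : ∀ F : V → V → ℕ, (∀ u v, F u v = F v u) → F o a = W o a → F o b = W o b →
      F o c = W o c → F o d = W o d → F a b = W a b → F a c = W a c → F a d = W a d →
      F b c = W b c → F b d = W b d → F c d = W c d → ∀ u v, u ≠ v → F u v = W u v := by
    intro F hF h1 h2 h3 h4 h5 h6 h7 h8 h9 h10 u v huv
    rcases hv u with rfl | rfl | rfl | rfl | rfl <;>
      rcases hv v with rfl | rfl | rfl | rfl | rfl <;>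
      first
        | exact absurd rfl huv
        | assumption
        | (rw [hF, hW]; assumption)
  have hp : ∀ xa xb xc xd : ℝ, 0 < xa → 0 < xb → 0 < xc → 0 < xd → xa + (xb + (xc + xd)) = 1 →
      fiveVec o a b c 0 xa xb xc xd ∈ face (Finset.univ.erase o) ∧
        ∀ v, v ≠ o → 0 < fiveVec o a b c 0 xa xb xc xd v := by
    intro xa xb xc xd ha hb hc hd h1
    have hpos : ∀ v, v ≠ o → 0 < fiveVec o a b c 0 xa xb xc xd v := by
      intro v hvo
      rcases hv v with rfl | rfl | rfl | rfl | rfl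
      · exact absurd rfl hvo
      · rwa [va]
      · rwa [vb]
      · rwa [vc]
      · rwa [vd]
    refine ⟨⟨fun v => ?_, ?_, fun v hv => ?_⟩, hpos⟩
    · by_cases hvo : v = o
      · rw [hvo, vo]
      · exact (hpos v hvo).le
    · rw [hsum, vo, va, vb, vc, vd, zero_add, h1]
    · have : v = o := by simpa using hv
      rw [this, vo]
  have hsphere : fiveVec o a b c 1 0 0 0 0 = Pi.single o (1 : ℝ) := by
    ext v
    simp [fiveVec, Pi.single_apply]
  obtain ⟨xa, xb, xc, xd, s, m, k₁, k₂, hmk, e1, e2, e3, e4, e5, e6, e7, e8, e9, e10⟩ := h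
  rcases hmk with rfl | rfl
  -- If `m = 0`, `o` is placed at the barycenter. The planes near the vertices do not cut it off,
  -- and there is room on both sides of it for the planes that separate `a, b` from `c, d`.
  · obtain ⟨L, hL, hlev, hcount⟩ := exists_parallelFamilies (V := V) (n := 7)
      ![fiveVec o a b c (1/4) 1 0 0 0, fiveVec o a b c (1/4) 0 1 0 0, fiveVec o a b c (1/4) 0 0 1 0,
        fiveVec o a b c (1/4) 0 0 0 1, fiveVec o a b c (1/2) 1 1 0 0, fiveVec o a b c (1/2) 1 1 0 0,
        fiveVec o a b c 1 0 0 0 0]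
      ![11/12, 11/12, 11/12, 11/12, 7/12, 1/3, 9/10] ![1, 1, 1, 1, 2/3, 5/12, 1]
      ![xa, xb, xc, xd, k₁, k₂, s] (by intro i; fin_cases i <;> norm_num)
      (by
        intro i v
        rcases hv v with rfl | rfl | rfl | rfl | rfl <;> fin_cases i <;>
          norm_num [vo, va, vb, vc, vd])
      (by
        intro i j hij x hx h1 h2 h3 h4
        obtain ⟨x0, x1, x2, x3, x4, hs⟩ := hface x hx
        fin_cases i <;> fin_cases j <;> first | exact absurd hij (by decide) | skip
        all_goals
          clear * - x0 x1 x2 x3 x4 hs h1 h2 h3 h4 vdot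
          simp only [Fin.mk_zero, Fin.mk_one, Fin.isValue, Fin.reduceFinMk,
            Matrix.cons_val, vdot] at h1 h2 h3 h4
          linarith)
    obtain ⟨hpf, hpp⟩ := hp (1/4) (1/4) (1/4) (1/4) (by norm_num) (by norm_num) (by norm_num)
      (by norm_num) (by norm_num)
    refine ⟨_, inferInstance, L, _, hL, hpf, hpp, ?_, hpairs _ (fun u v => ?_) ?_ ?_ ?_ ?_ ?_ ?_ ?_
      ?_ ?_ ?_⟩
    · rintro ⟨i, k⟩
      obtain ⟨h, h1, h2, h3⟩ := hlev ⟨i, k⟩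
      rw [h3]
      fin_cases i
      iterate 6
        left
        rw [IsPlanar, dotProduct_sub_const (face_subset_univ _ hpf)]
        simp only [Fin.mk_zero, Fin.mk_one, Fin.isValue, Fin.reduceFinMk,
            Matrix.cons_val, vdot, vo, va, vb, vc, vd]
        norm_num
      right
      exact ⟨h, lt_trans (by norm_num) h1, h2, funext fun v => by
        rw [← hsphere]; rfl⟩
    · simp only [mul_comm]
    all_goals
      rw [hcount]
      simp [Fin.sum_univ_succ, vo, va, vb, vc, vd]
      norm_num
      omega
  -- If `k₁ = 0`, `o` is placed near `a`. Then some planes that cut off `a` cut off `o` as well, and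
  -- all planes that separate `a, b` from `c, d` have `o` on the side of `a, b`.
  · obtain ⟨L, hL, hlev, hcount⟩ := exists_parallelFamilies (V := V) (n := 7)
      ![fiveVec o a b c (5/6) 1 0 0 0, fiveVec o a b c (1/18) 0 1 0 0,
        fiveVec o a b c (1/18) 0 0 1 0, fiveVec o a b c (1/18) 0 0 0 1,
        fiveVec o a b c (5/6) 1 0 0 0, fiveVec o a b c (8/9) 1 1 0 0, fiveVec o a b c 1 0 0 0 0]
      ![11/12, 11/12, 11/12, 11/12, 2/3, 1/3, 9/10] ![1, 1, 1, 1, 3/4, 2/3, 1]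
      ![xa, xb, xc, xd, m, k₂, s] (by intro i; fin_cases i <;> norm_num)
      (by
        intro i v
        rcases hv v with rfl | rfl | rfl | rfl | rfl <;> fin_cases i <;>
          norm_num [vo, va, vb, vc, vd])
      (by
        intro i j hij x hx h1 h2 h3 h4
        obtain ⟨x0, x1, x2, x3, x4, hs⟩ := hface x hx
        fin_cases i <;> fin_cases j <;> first | exact absurd hij (by decide) | skip
        all_goals
          clear * - x0 x1 x2 x3 x4 hs h1 h2 h3 h4 vdot
          simp only [Fin.mk_zero, Fin.mk_one, Fin.isValue, Fin.reduceFinMk,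
            Matrix.cons_val, vdot] at h1 h2 h3 h4
          linarith)
    obtain ⟨hpf, hpp⟩ := hp (5/6) (1/18) (1/18) (1/18) (by norm_num) (by norm_num) (by norm_num)
      (by norm_num) (by norm_num)
    refine ⟨_, inferInstance, L, _, hL, hpf, hpp, ?_, hpairs _ (fun u v => ?_) ?_ ?_ ?_ ?_ ?_ ?_ ?_
      ?_ ?_ ?_⟩
    · rintro ⟨i, k⟩
      obtain ⟨h, h1, h2, h3⟩ := hlev ⟨i, k⟩
      rw [h3]
      fin_cases i
      iterate 6
        left
        rw [IsPlanar, dotProduct_sub_const (face_subset_univ _ hpf)]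
        simp only [Fin.mk_zero, Fin.mk_one, Fin.isValue, Fin.reduceFinMk,
            Matrix.cons_val, vdot, vo, va, vb, vc, vd]
        norm_num
      right
      exact ⟨h, lt_trans (by norm_num) h1, h2, funext fun v => by
        rw [← hsphere]; rfl⟩
    · simp only [mul_comm]
    all_goals
      rw [hcount]
      simp [Fin.sum_univ_succ, vo, va, vb, vc, vd]
      norm_num
      omega

end Target

/-! ### The model of a normal set in a subdivided tetrahedron -/

section Model

open scoped Matrix

variable {V : Type*} [Fintype V] [DecidableEq V]

/-- The union of the facets at `o` of the standard simplex on `V`. If `V` has five elements, these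
are the four tetrahedra of a subdivision at the interior point `o`. -/
def facetsAt (o : V) : Set (V → ℝ) := {x ∈ face (Finset.univ : Finset V) | ∃ j, j ≠ o ∧ x j = 0}

theorem face_erase_subset_facetsAt {o j : V} (hj : j ≠ o) :
    face (Finset.univ.erase j) ⊆ facetsAt o := fun _ hx =>
  ⟨face_subset_univ _ hx, j, hj, hx.2.2 j (Finset.notMem_erase j _)⟩

theorem mem_facetsAt_iff {o : V} {x : V → ℝ} :
    x ∈ facetsAt o ↔ ∃ j, j ≠ o ∧ x ∈ face (Finset.univ.erase j) := by
  constructor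
  · rintro ⟨hx, j, hj, h0⟩
    refine ⟨j, hj, hx.1, hx.2.1, fun v hv => ?_⟩
    have : v = j := by simpa using hv
    rw [this, h0]
  · rintro ⟨j, hj, hx⟩
    exact face_erase_subset_facetsAt hj hx

theorem isCompact_facetsAt (o : V) : IsCompact (facetsAt o) := by
  have : facetsAt o = ⋃ j ∈ {j | j ≠ o}, face (Finset.univ.erase j) := by
    ext x
    simp [mem_facetsAt_iff]
  rw [this]
  exact (toFinite _).isCompact_biUnion fun j _ => isCompact_face _

theorem iUnion_facetsAt (o : V) :
    (⋃ s ∈ Finset.univ.filter fun s : Finset V => ∃ j, j ≠ o ∧ j ∉ s, face s) = facetsAt o := by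
  ext x
  simp only [mem_facetsAt_iff, Finset.mem_filter, Finset.mem_univ, true_and, mem_iUnion₂,
    exists_prop]
  constructor
  · rintro ⟨s, ⟨j, hj, hjs⟩, hx⟩
    exact ⟨j, hj, face_mono (Finset.subset_erase.2 ⟨Finset.subset_univ s, hjs⟩) hx⟩
  · rintro ⟨j, hj, hx⟩
    exact ⟨_, ⟨j, hj, Finset.notMem_erase j _⟩, hx⟩

/-- A facet at `o` has three further vertices. -/
theorem exists_erase_eq (hV : Fintype.card V = 5) {o j : V} (hj : j ≠ o) :
    ∃ x y z, (Finset.univ.erase j : Finset V) = {o, x, y, z} ∧ o ≠ x ∧ o ≠ y ∧ o ≠ z ∧ x ≠ y ∧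
      x ≠ z ∧ y ≠ z := by
  have ho : o ∈ (Finset.univ.erase j : Finset V) := by simp [hj.symm]
  have hc : ((Finset.univ.erase j).erase o : Finset V).card = 3 := by
    rw [Finset.card_erase_of_mem ho, Finset.card_erase_of_mem (Finset.mem_univ j),
      Finset.card_univ, hV]
  obtain ⟨x, y, z, hxy, hxz, hyz, h⟩ := Finset.card_eq_three.1 hc
  have hne : ∀ w ∈ ({x, y, z} : Finset V), o ≠ w := fun w hw => by
    rw [← h] at hw
    exact (Finset.ne_of_mem_erase hw).symm
  refine ⟨x, y, z, ?_, hne x (by simp), hne y (by simp), hne z (by simp), hxy, hxz, hyz⟩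
  rw [← h, Finset.insert_erase ho]

theorem exists_nodup_five (hV : Fintype.card V = 5) (o : V) :
    ∃ a b c d, [o, a, b, c, d].Nodup ∧ (Finset.univ : Finset V) = {o, a, b, c, d} := by
  have : Nontrivial V := Fintype.one_lt_card_iff_nontrivial.1 (by omega)
  obtain ⟨j, hj⟩ := exists_ne o
  obtain ⟨x, y, z, h, h1, h2, h3, h4, h5, h6⟩ := exists_erase_eq hV hj
  have hne : ∀ w ∈ ({o, x, y, z} : Finset V), j ≠ w := fun w hw => by
    rw [← h] at hw
    exact (Finset.ne_of_mem_erase hw).symm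
  refine ⟨x, y, z, j, ?_, ?_⟩
  · simp [h1, h2, h3, h4, h5, h6, hj.symm, (hne x (by simp)).symm, (hne y (by simp)).symm,
      (hne z (by simp)).symm]
  · rw [← Finset.insert_erase (Finset.mem_univ j), h]
    ext w
    simp only [Finset.mem_insert, Finset.mem_singleton]
    tauto

/-- A subset of a subdivided tetrahedron that is normal in each of the four small tetrahedra is, up
to a homeomorphism, made of planes in the large tetrahedron and of small spheres around the
subdivision point, for a suitable position of this point. -/
theorem exists_model (hV : Fintype.card V = 5) (o : V) {G : Set (V → ℝ)}
    (hG : ∀ j, j ≠ o → NormalOn (Finset.univ.erase j) G) :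
    ∃ (κ : Type) (_ : Finite κ) (L : κ → V → ℝ) (p : V → ℝ), FlatFamily Finset.univ L ∧
      p ∈ face (Finset.univ.erase o) ∧ (∀ v, v ≠ o → 0 < p v) ∧
      (∀ i, IsPlanar o p (L i) ∨ ∃ h, 0 < h ∧ h < 1 ∧ L i = fun v => Pi.single o (1 : ℝ) v - h) ∧
      ∃ Φ, PairHomeoOn (zeros L) G (facetsAt o) Φ := by
  obtain ⟨a, b, c, d, hnd, huniv⟩ := exists_nodup_five hV o
  set W : V → V → ℕ := fun u v => (G ∩ face ({u, v} : Finset V)).ncard with hW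
  have hWs : ∀ u v, W u v = W v u := edgeWeight_comm G
  have hall := hnd
  simp only [List.nodup_cons, List.mem_cons, List.not_mem_nil, or_false, not_or,
    List.nodup_nil, and_true, not_false_eq_true] at hnd
  obtain ⟨⟨oa, ob, oc, od⟩, ⟨ab, ac, ad⟩, ⟨bc, bd⟩, cd⟩ := hnd
  have her : ∀ j ∈ ({a, b, c, d} : Finset V), NormalOn (Finset.univ.erase j) G := by
    intro j hj
    refine hG j ?_
    rintro rfl
    simp only [Finset.mem_insert, Finset.mem_singleton] at hj
    tauto
  have ha : (Finset.univ : Finset V).erase a = {o, b, c, d} := by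
    rw [huniv]; ext w; simp only [Finset.mem_erase, Finset.mem_insert, Finset.mem_singleton]
    grind
  have hb : (Finset.univ : Finset V).erase b = {o, a, c, d} := by
    rw [huniv]; ext w; simp only [Finset.mem_erase, Finset.mem_insert, Finset.mem_singleton]
    grind
  have hc : (Finset.univ : Finset V).erase c = {o, a, b, d} := by
    rw [huniv]; ext w; simp only [Finset.mem_erase, Finset.mem_insert, Finset.mem_singleton]
    grind
  have hd : (Finset.univ : Finset V).erase d = {o, a, b, c} := by
    rw [huniv]; ext w; simp only [Finset.mem_erase, Finset.mem_insert, Finset.mem_singleton]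
    grind
  obtain ⟨Na, hNa⟩ := (ha ▸ her a (by simp)).exists_edgeCounts ob oc od bc bd cd
  obtain ⟨Nb, hNb⟩ := (hb ▸ her b (by simp)).exists_edgeCounts oa oc od ac ad cd
  obtain ⟨Nc, hNc⟩ := (hc ▸ her c (by simp)).exists_edgeCounts oa ob od ab ad bd
  obtain ⟨Nd, hNd⟩ := (hd ▸ her d (by simp)).exists_edgeCounts oa ob oc ab ac bc
  obtain ⟨p, q, r, t, hperm, htw⟩ := exists_targetWeights hWs hNa hNb hNc hNd
  have hnd' : [o, p, q, r, t].Nodup := ((hperm.cons o).nodup_iff).2 hall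
  have huniv' : (Finset.univ : Finset V) = {o, p, q, r, t} := by
    rw [huniv]
    ext w
    have := (hperm.cons o).mem_iff (a := w)
    simpa using this.symm
  obtain ⟨κ, hκ, L, P, hL, hP, hPpos, htype, hcount⟩ := exists_targetFamily hWs hnd' huniv' htw
  refine ⟨κ, hκ, L, P, hL, hP, hPpos, htype, ?_⟩
  obtain ⟨Φ, hΦ⟩ := exists_pairHomeoOn_complex (G₁ := zeros L) (G₂ := G)
    (Finset.univ.filter fun s : Finset V => ∃ j, j ≠ o ∧ j ∉ s)
    (fun s hs r hr => by
      obtain ⟨j, hj, hjs⟩ := (Finset.mem_filter.1 hs).2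
      exact Finset.mem_filter.2 ⟨Finset.mem_univ _, j, hj, fun h => hjs (hr h)⟩)
    (fun s hs φ hφ => by
      obtain ⟨j, hj, hjs⟩ := (Finset.mem_filter.1 hs).2
      have hsj : s ⊆ Finset.univ.erase j := fun v hv =>
        Finset.mem_erase.2 ⟨fun h => hjs (h ▸ hv), Finset.mem_univ v⟩
      obtain ⟨x, y, z, hxyz, ox, oy, oz, xy, xz, yz⟩ := exists_erase_eq hV hj
      obtain ⟨n, l, hl, h, hh⟩ := hG j hj
      rw [hxyz] at hsj hl hh
      obtain ⟨ι, _, m, m', hm, hz, hz'⟩ := exists_samePosition (hL.mono (Finset.subset_univ _)) hl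
        ox oy oz xy xz yz (fun u hu v hv huv => by
          rw [hL.ncard_edge (Finset.mem_univ u) (Finset.mem_univ v) huv, hcount u v huv,
            ← hh.ncard_edge (edge_subset hu hv)])
      have := Fintype.ofFinite ι
      exact exists_pairHomeoOn_face hsj hm hz
        (hh.congr_sets (fun x hx => (hz' x hx).symm) fun _ _ => Iff.rfl) hφ)
  rw [iUnion_facetsAt] at hΦ
  exact ⟨Φ, hΦ⟩

end Model

/-! ### Placing the subdivision point -/

section Collapse

open scoped Matrix

variable {V : Type*} [Fintype V] [DecidableEq V]

/-- The linear map that sends the vertex `o` to `p` and fixes the other vertices. -/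
def collapse (o : V) (p x : V → ℝ) : V → ℝ := x + x o • (p - Pi.single o 1)

/-- `p` is a point of the open face opposite to `o`. -/
structure IsApexImage (o : V) (p : V → ℝ) : Prop where
  mem : p ∈ face (Finset.univ.erase o)
  pos : ∀ v, v ≠ o → 0 < p v

theorem IsApexImage.apply_self {o : V} {p : V → ℝ} (hp : IsApexImage o p) : p o = 0 :=
  hp.mem.2.2 o (Finset.notMem_erase o _)

theorem continuous_collapse (o : V) (p : V → ℝ) : Continuous (collapse o p) := by
  unfold collapse
  fun_prop

theorem collapse_apply {o v : V} {p x : V → ℝ} (hv : v ≠ o) :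
    collapse o p x v = x v + x o * p v := by
  simp [collapse, hv]

theorem IsApexImage.collapse_apply_self {o : V} {p : V → ℝ} (hp : IsApexImage o p) (x : V → ℝ) :
    collapse o p x o = 0 := by
  simp [collapse, hp.apply_self]

theorem collapse_of_zero {o : V} {p x : V → ℝ} (h : x o = 0) : collapse o p x = x := by
  simp [collapse, h]

theorem dotProduct_collapse (o : V) (p l x : V → ℝ) :
    l ⬝ᵥ collapse o p x = l ⬝ᵥ x + x o * (l ⬝ᵥ p - l o) := by
  simp [collapse, dotProduct_add, dotProduct_smul, dotProduct_sub]

theorem IsPlanar.dotProduct_collapse {o : V} {p l : V → ℝ} (h : IsPlanar o p l) (x : V → ℝ) :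
    l ⬝ᵥ collapse o p x = l ⬝ᵥ x := by
  rw [_root_.dotProduct_collapse, ← h, sub_self, mul_zero, add_zero]

theorem IsApexImage.collapse_mem {o : V} {p : V → ℝ} (hp : IsApexImage o p) {x : V → ℝ}
    (hx : x ∈ face (Finset.univ : Finset V)) : collapse o p x ∈ face (Finset.univ.erase o) := by
  refine ⟨fun v => ?_, ?_, fun v hv => ?_⟩
  · by_cases hv : v = o
    · rw [hv, hp.collapse_apply_self]
    · rw [collapse_apply hv]
      exact add_nonneg (hx.1 v) (mul_nonneg (hx.1 o) (hp.mem.1 v))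
  · simp [collapse, Finset.sum_add_distrib, hx.2.1, ← Finset.mul_sum, hp.mem.2.1]
  · have : v = o := by simpa using hv
    rw [this, hp.collapse_apply_self]

theorem IsApexImage.injOn_collapse {o : V} {p : V → ℝ} (hp : IsApexImage o p) :
    InjOn (collapse o p) (facetsAt o) := by
  have key : ∀ x ∈ facetsAt o, ∀ y ∈ facetsAt o, collapse o p x = collapse o p y → x o ≤ y o := by
    rintro x hx y ⟨hy, j, hj, h0⟩ hxy
    have := congrFun hxy j
    rw [collapse_apply hj, collapse_apply hj, h0, zero_add] at this
    have h1 := hx.1.1 j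
    refine le_of_mul_le_mul_right ?_ (hp.pos j hj)
    linarith
  intro x hx y hy hxy
  have h := le_antisymm (key x hx y hy hxy) (key y hy x hx hxy.symm)
  simpa [collapse, h] using hxy

theorem IsApexImage.surjOn_collapse {o : V} {p : V → ℝ} (hp : IsApexImage o p) :
    SurjOn (collapse o p) (facetsAt o) (face (Finset.univ.erase o)) := by
  intro y hy
  obtain ⟨v, hv, -⟩ := face_exists_pos hp.mem
  -- the coordinate of the preimage at `o` is the least of the ratios `y v / p v`
  obtain ⟨j, hj, hmin⟩ := (Finset.univ.erase o).exists_min_image (fun v => y v / p v) ⟨v, hv⟩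
  have hjo := Finset.ne_of_mem_erase hj
  set m := y j / p j with hm
  have hm0 : 0 ≤ m := div_nonneg (hy.1 j) (hp.mem.1 j)
  have hyo : y o = 0 := hy.2.2 o (Finset.notMem_erase o _)
  have hne : ∀ v, v ≠ o → (y - m • (p - Pi.single o 1) : V → ℝ) v = y v - m * p v := by
    intro v hv
    simp [hv]
  have ho : (y - m • (p - Pi.single o 1) : V → ℝ) o = m := by
    simp [hyo, hp.apply_self]
  refine ⟨y - m • (p - Pi.single o 1), ⟨⟨fun v => ?_, ?_,
      fun v hv => absurd (Finset.mem_univ v) hv⟩,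
    j, hjo, ?_⟩, ?_⟩
  · by_cases hv : v = o
    · rw [hv, ho]; exact hm0
    · rw [hne v hv]
      have := hmin v (Finset.mem_erase.2 ⟨hv, Finset.mem_univ v⟩)
      rw [le_div_iff₀ (hp.pos v hv)] at this
      linarith
  · simp [Finset.sum_sub_distrib, ← Finset.mul_sum, hy.2.1, hp.mem.2.1]
  · rw [hne j hjo, hm, div_mul_cancel₀ _ (hp.pos j hjo).ne', sub_self]
  · rw [collapse, ho, sub_add_cancel]

theorem IsApexImage.bijOn_collapse {o : V} {p : V → ℝ} (hp : IsApexImage o p) :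
    BijOn (collapse o p) (facetsAt o) (face (Finset.univ.erase o)) :=
  ⟨fun _ hx => hp.collapse_mem hx.1, hp.injOn_collapse, hp.surjOn_collapse⟩

/-- The coordinates of the image vanish depending only on which coordinates of the point do. -/
theorem IsApexImage.sign_collapse {o : V} {p q : V → ℝ} (hp : IsApexImage o p)
    (hq : IsApexImage o q) {x y : V → ℝ} (hx : x ∈ facetsAt o) (hy : y ∈ facetsAt o)
    (h : ∀ v, SignType.sign (x v) = SignType.sign (y v)) (v : V) :
    SignType.sign (collapse o p x v) = SignType.sign (collapse o q y v) := by
  by_cases hv : v = o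
  · rw [hv, hp.collapse_apply_self, hq.collapse_apply_self]
  rw [collapse_apply hv, collapse_apply hv]
  have hpos : ∀ w, 0 < x w ↔ 0 < y w := fun w => by
    rw [← sign_eq_one_iff, h w, sign_eq_one_iff]
  have hp' := hp.pos v hv
  have hq' := hq.pos v hv
  have hz : ∀ {z r : V → ℝ}, z ∈ facetsAt o → 0 < r v →
      (0 < z v + z o * r v ↔ 0 < z v ∨ 0 < z o) := by
    intro z r hz hr
    have h1 := hz.1.1 v
    have h2 := hz.1.1 o
    constructor
    · intro h
      by_contra! hc
      have e1 : z v = 0 := le_antisymm hc.1 h1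
      have e2 : z o = 0 := le_antisymm hc.2 h2
      rw [e1, e2] at h
      simp at h
    · rintro (h | h)
      · positivity
      · have := mul_pos h hr
        linarith
  by_cases h' : 0 < x v + x o * p v
  · have h2 : 0 < y v + y o * q v := by
      rw [hz hy hq', ← hpos, ← hpos, ← hz hx hp']; exact h'
    rw [sign_pos h', sign_pos h2]
  · have h2 : ¬ 0 < y v + y o * q v := by
      rw [hz hy hq', ← hpos, ← hpos, ← hz hx hp']; exact h'
    have e1 : x v + x o * p v = 0 :=
      le_antisymm (not_lt.1 h') (add_nonneg (hx.1.1 v) (mul_nonneg (hx.1.1 o) hp'.le))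
    have e2 : y v + y o * q v = 0 :=
      le_antisymm (not_lt.1 h2) (add_nonneg (hy.1.1 v) (mul_nonneg (hy.1.1 o) hq'.le))
    rw [e1, e2]

/-- A homeomorphism of the union of the facets at `o` induces one of the opposite face, for any
choice of the images of `o`. -/
theorem PairHomeoOn.exists_collapse {o : V} {p q : V → ℝ} (hp : IsApexImage o p)
    (hq : IsApexImage o q) {G' G K' K : Set (V → ℝ)} {Φ : (V → ℝ) → V → ℝ}
    (hΦ : PairHomeoOn G' G (facetsAt o) Φ)
    (hK' : ∀ x ∈ facetsAt o, (x ∈ G' ↔ collapse o p x ∈ K'))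
    (hK : ∀ x ∈ facetsAt o, (x ∈ G ↔ collapse o q x ∈ K)) :
    ∃ h, PairHomeoOn K' K (face (Finset.univ.erase o)) h ∧
      ∀ x ∈ facetsAt o, h (collapse o p x) = collapse o q (Φ x) := by
  have : Nonempty (V → ℝ) := ⟨p⟩
  set σ := Function.invFunOn (collapse o p) (facetsAt o) with hσ
  have hl : LeftInvOn σ (collapse o p) (facetsAt o) := hp.injOn_collapse.leftInvOn_invFunOn
  have hr : RightInvOn σ (collapse o p) (face (Finset.univ.erase o)) :=
    hp.surjOn_collapse.rightInvOn_invFunOn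
  have hσm : BijOn σ (face (Finset.univ.erase o)) (facetsAt o) :=
    (BijOn.symm ⟨hr, hl⟩ hp.bijOn_collapse)
  have hσc : ContinuousOn σ (face (Finset.univ.erase o)) :=
    (continuous_collapse o p).continuousOn.continuousOn_of_leftInvOn (isCompact_facetsAt o)
      hp.bijOn_collapse hl
  have he : ∀ x ∈ facetsAt o, (fun y => collapse o q (Φ (σ y))) (collapse o p x) =
      collapse o q (Φ x) := fun x hx => by
    change collapse o q (Φ (σ (collapse o p x))) = _
    rw [hl hx]
  refine ⟨fun y => collapse o q (Φ (σ y)), ⟨?_, ?_, ?_, ?_⟩, he⟩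
  · exact (continuous_collapse o q).comp_continuousOn
      (hΦ.continuousOn.comp hσc hσm.mapsTo)
  · exact hq.bijOn_collapse.comp (hΦ.bijOn.comp hσm)
  · intro y hy v
    obtain ⟨x, hx, rfl⟩ := hp.surjOn_collapse hy
    rw [show collapse o q (Φ (σ (collapse o p x))) = _ from he x hx]
    exact hq.sign_collapse hp (hΦ.bijOn.mapsTo hx) hx (hΦ.sign x hx) v
  · intro y hy
    obtain ⟨x, hx, rfl⟩ := hp.surjOn_collapse hy
    rw [show collapse o q (Φ (σ (collapse o p x))) = _ from he x hx,
      ← hK' x hx, ← hK _ (hΦ.bijOn.mapsTo hx)]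
    exact hΦ.mem x hx

end Collapse

/-! ### One step of the subdivision -/

section OneStep

open scoped Matrix

variable {V : Type*} [Fintype V] [DecidableEq V]

/-- A continuous bijection from a compact set onto a set in a Hausdorff space is a homeomorphism. -/
theorem exists_homeomorph_of_bijOn {X Y : Type*} [TopologicalSpace X] [TopologicalSpace Y]
    [T2Space Y] {f : X → Y} {K : Set X} {L : Set Y} (hK : IsCompact K) (hf : ContinuousOn f K)
    (hfL : BijOn f K L) : ∃ φ : K ≃ₜ L, ∀ x : K, (φ x : Y) = f x := by
  have : CompactSpace K := isCompact_iff_compactSpace.1 hK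
  have hc : Continuous (hfL.equiv f) := by
    have := hf.domRestrict
    exact Continuous.subtype_mk this _
  exact ⟨hc.homeoOfEquivCompactToT2, fun x => rfl⟩

theorem isCompact_slice (o : V) (h : ℝ) : IsCompact {x ∈ facetsAt o | x o = h} :=
  (isCompact_facetsAt o).inter_right (isClosed_eq (continuous_apply o) continuous_const)

/-- The section of a subdivided tetrahedron parallel to its boundary is a sphere: it is mapped to
the unit sphere by the radial projection from its centre. -/
theorem nonempty_slice_homeomorph (hV : Fintype.card V = 5) (o : V) {h : ℝ} (h1 : h < 1)
    (h0 : 0 < h) :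
    Nonempty ({x ∈ facetsAt o | x o = h} ≃ₜ Metric.sphere (0 : EuclideanSpace ℝ (Fin 3)) 1) := by
  obtain ⟨a, b, c, d, hnd, huniv⟩ := exists_nodup_five hV o
  simp only [List.nodup_cons, List.mem_cons, List.not_mem_nil, or_false, not_or,
    List.nodup_nil, and_true, not_false_eq_true] at hnd
  obtain ⟨⟨oa, ob, oc, od⟩, ⟨ab, ac, ad⟩, ⟨bc, bd⟩, cd⟩ := hnd
  have hv : ∀ v, v = o ∨ v = a ∨ v = b ∨ v = c ∨ v = d := fun v => by
    have := Finset.mem_univ v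
    rw [huniv] at this
    simpa using this
  have hsum : ∀ g : V → ℝ, ∑ v, g v = g o + (g a + (g b + (g c + g d))) := by
    intro g
    rw [huniv, Finset.sum_insert (by simp [oa, ob, oc, od]),
      Finset.sum_insert (by simp [ab, ac, ad]),
      Finset.sum_insert (by simp [bc, bd]), Finset.sum_insert (by simp [cd]), Finset.sum_singleton]
  set r : ℝ := (1 - h) / 4 with hr
  have hr0 : 0 < r := by rw [hr]; linarith
  set Y : EuclideanSpace ℝ (Fin 3) → V → ℝ := fun z =>
    fiveVec o a b c 0 (z 0) (z 1) (z 2) (-(z 0 + z 1 + z 2)) with hY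
  have Yo : ∀ z, Y z o = 0 := by simp [hY, fiveVec]
  have Ya : ∀ z, Y z a = z 0 := by simp [hY, fiveVec, Ne.symm oa]
  have Yb : ∀ z, Y z b = z 1 := by simp [hY, fiveVec, Ne.symm ob, Ne.symm ab]
  have Yc : ∀ z, Y z c = z 2 := by simp [hY, fiveVec, Ne.symm oc, Ne.symm ac, Ne.symm bc]
  have Yd : ∀ z, Y z d = -(z 0 + z 1 + z 2) := by
    simp [hY, fiveVec, Ne.symm od, Ne.symm ad, Ne.symm bd, Ne.symm cd]
  have Ysmul : ∀ (t : ℝ) z v, Y (t • z) v = t * Y z v := by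
    intro t z v
    rcases hv v with rfl | rfl | rfl | rfl | rfl
    · rw [Yo, Yo, mul_zero]
    · rw [Ya, Ya]; rfl
    · rw [Yb, Yb]; rfl
    · rw [Yc, Yc]; rfl
    · rw [Yd, Yd]; simp only [PiLp.smul_apply, smul_eq_mul]; ring
  set Z : (V → ℝ) → EuclideanSpace ℝ (Fin 3) := fun x => !₂[x a - r, x b - r, x c - r] with hZ
  have Zc : Continuous Z := by
    rw [hZ]
    refine (PiLp.continuous_toLp 2 _).comp (continuous_pi fun i => ?_)
    fin_cases i <;> simp <;> fun_prop
  have hYZ : ∀ x ∈ {x ∈ facetsAt o | x o = h}, ∀ v, v ≠ o → x v = Y (Z x) v + r := by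
    rintro x ⟨⟨⟨-, hx, -⟩, -⟩, hxo⟩ v hvo
    rw [hsum, hxo] at hx
    rcases hv v with rfl | rfl | rfl | rfl | rfl
    · exact absurd rfl hvo
    · rw [Ya]; simp [hZ]
    · rw [Yb]; simp [hZ]
    · rw [Yc]; simp [hZ]
    · rw [Yd]; simp [hZ]; linarith
  have hZ0 : ∀ x ∈ {x ∈ facetsAt o | x o = h}, Z x ≠ 0 := by
    intro x hx h0
    obtain ⟨j, hj, hj0⟩ := hx.1.2
    have := hYZ x hx j hj
    rw [hj0, h0, show (0 : EuclideanSpace ℝ (Fin 3)) = (0 : ℝ) • 0 by simp, Ysmul] at this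
    linarith
  have key : ∀ x ∈ {x ∈ facetsAt o | x o = h}, ∀ y ∈ {x ∈ facetsAt o | x o = h}, ∀ t : ℝ,
      0 < t → Z y = t • Z x → 1 ≤ t := by
    intro x hx y hy t ht0 ht
    obtain ⟨j, hj, hj0⟩ := hy.1.2
    have e1 := hYZ y hy j hj
    have e2 := hYZ x hx j hj
    rw [ht, Ysmul, hj0] at e1
    have e3 := hx.1.1.1 j
    rw [e2] at e3
    by_contra! hlt
    nlinarith [mul_nonneg ht0.le e3, mul_pos (sub_pos.2 hlt) hr0]
  set f : (V → ℝ) → EuclideanSpace ℝ (Fin 3) := fun x => ‖Z x‖⁻¹ • Z x with hf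
  have hfc : ContinuousOn f {x ∈ facetsAt o | x o = h} :=
    (Zc.norm.continuousOn.inv₀ fun x hx => norm_ne_zero_iff.2 (hZ0 x hx)).smul Zc.continuousOn
  refine ⟨(exists_homeomorph_of_bijOn (isCompact_slice o h) hfc ⟨?_, ?_, ?_⟩).choose⟩
  · intro x hx
    rw [mem_sphere_zero_iff_norm, hf]
    exact norm_smul_inv_norm (hZ0 x hx)
  · intro x hx y hy hxy
    have nx := norm_pos_iff.2 (hZ0 x hx)
    have ny := norm_pos_iff.2 (hZ0 y hy)
    have e1 : Z y = (‖Z y‖ * ‖Z x‖⁻¹) • Z x := by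
      rw [mul_smul]
      change _ = ‖Z y‖ • f x
      rw [hxy, hf, smul_smul, mul_inv_cancel₀ ny.ne', one_smul]
    have e2 : Z x = (‖Z x‖ * ‖Z y‖⁻¹) • Z y := by
      rw [mul_smul]
      change _ = ‖Z x‖ • f y
      rw [← hxy, hf, smul_smul, mul_inv_cancel₀ nx.ne', one_smul]
    have h1 := key x hx y hy _ (by positivity) e1
    have h2 := key y hy x hx _ (by positivity) e2
    rw [← div_eq_mul_inv, one_le_div (by assumption)] at h1 h2
    have hxy' : Z y = Z x := by
      rw [e1, le_antisymm h2 h1, mul_inv_cancel₀ nx.ne', one_smul]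
    ext v
    by_cases hvo : v = o
    · rw [hvo, hx.2, hy.2]
    · rw [hYZ x hx v hvo, hYZ y hy v hvo, hxy']
  · intro z hz
    rw [mem_sphere_zero_iff_norm] at hz
    have hz0 : z ≠ 0 := fun h => by simp [h] at hz
    obtain ⟨j, hj, hmin⟩ := (Finset.univ.erase o).exists_min_image (Y z)
      ⟨a, Finset.mem_erase.2 ⟨Ne.symm oa, Finset.mem_univ a⟩⟩
    have hjo := Finset.ne_of_mem_erase hj
    have hmin' : ∀ v, v ≠ o → Y z j ≤ Y z v := fun v hvo =>
      hmin v (Finset.mem_erase.2 ⟨hvo, Finset.mem_univ v⟩)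
    have ma := hmin' a (Ne.symm oa)
    have mb := hmin' b (Ne.symm ob)
    have mc := hmin' c (Ne.symm oc)
    have md := hmin' d (Ne.symm od)
    have hneg : Y z j < 0 := by
      by_contra! hge
      refine hz0 ?_
      rw [Ya] at ma
      rw [Yb] at mb
      rw [Yc] at mc
      rw [Yd] at md
      ext i
      fin_cases i <;> simp <;> linarith
    -- the multiple of `z` that lies on the boundary of the tetrahedron
    set t : ℝ := r / -Y z j with ht
    have ht0 : 0 < t := div_pos hr0 (neg_pos.2 hneg)
    have htj : t * Y z j = -r := by
      rw [ht, div_neg, neg_mul, div_mul_cancel₀ _ hneg.ne]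
    set x : V → ℝ := fun v => if v = o then h else Y (t • z) v + r with hx
    have hxo : x o = h := by simp [hx]
    have hxv : ∀ v, v ≠ o → x v = Y (t • z) v + r := fun v hvo => by simp [hx, hvo]
    have hZx : Z x = t • z := by
      ext i
      fin_cases i
      · simp only [hZ, hxv a (Ne.symm oa), Ya]; simp
      · simp only [hZ, hxv b (Ne.symm ob), Yb]; simp
      · simp only [hZ, hxv c (Ne.symm oc), Yc]; simp
    refine ⟨x, ⟨⟨⟨fun v => ?_, ?_,
      fun v hv => absurd (Finset.mem_univ v) hv⟩, j, hjo, ?_⟩, hxo⟩, ?_⟩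
    · by_cases hvo : v = o
      · rw [hvo, hxo]; exact h0.le
      · rw [hxv v hvo, Ysmul]
        have := mul_le_mul_of_nonneg_left (hmin' v hvo) ht0.le
        linarith
    · rw [hsum, hxo, hxv a (Ne.symm oa), hxv b (Ne.symm ob), hxv c (Ne.symm oc),
        hxv d (Ne.symm od), Ya, Yb, Yc, Yd, hr]
      ring
    · rw [hxv j hjo, Ysmul, htj]; ring
    · change ‖Z x‖⁻¹ • Z x = z
      rw [hZx, norm_smul, hz, mul_one, Real.norm_of_nonneg ht0.le, smul_smul,
        inv_mul_cancel₀ ht0.ne', one_smul]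

/-- Some 2-sphere in `O` is a subset of `G` with compact complement in `G`. Both being compact, the
sphere is then open and closed in `G`. -/
def HasSphere {X : Type*} [TopologicalSpace X] (G O : Set X) : Prop :=
  ∃ S K, IsCompact K ∧ Disjoint S K ∧ S ∪ K = G ∧ S ⊆ O ∧
    Nonempty (S ≃ₜ Metric.sphere (0 : EuclideanSpace ℝ (Fin 3)) 1)

/-- A set that is normal in the four small tetrahedra is normal in the large tetrahedron, unless it
has a spherical component inside. -/
theorem NormalOn.of_facets (hV : Fintype.card V = 5) {o : V} {p : V → ℝ} (hp : IsApexImage o p)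
    {G : Set (V → ℝ)} (hG : ∀ j, j ≠ o → NormalOn (Finset.univ.erase j) (collapse o p ⁻¹' G))
    (hS : ¬ HasSphere (G ∩ face (Finset.univ.erase o)) {x | ∀ v, v ≠ o → 0 < x v}) :
    NormalOn (Finset.univ.erase o) G := by
  obtain ⟨κ, _, L, q, hL, hq, hq', htype, Φ, hΦ⟩ := exists_model hV o hG
  have hq : IsApexImage o q := ⟨hq, hq'⟩
  have hplanar : ∀ i, IsPlanar o q (L i) := by
    intro i
    refine (htype i).resolve_right ?_
    rintro ⟨h, h0, h1, hi⟩
    refine hS ?_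
    have hslice : ∀ x ∈ facetsAt o, (L i ⬝ᵥ x = 0 ↔ x o = h) := fun x hx => by
      rw [hi, dotProduct_sub_const hx.1, single_one_dotProduct, sub_eq_zero]
    set S : Set (V → ℝ) := {x ∈ facetsAt o | x o = h} with hSd
    set R : Set (V → ℝ) := ⋃ k ∈ {k | k ≠ i}, {x ∈ facetsAt o | L k ⬝ᵥ x = 0} with hR
    have hRc : IsCompact R := (toFinite _).isCompact_biUnion fun k _ =>
      (isCompact_facetsAt o).inter_right
        (isClosed_eq (continuous_dotProduct_left (L k)) continuous_const)
    have hRs : R ⊆ facetsAt o := iUnion₂_subset fun k _ x hx => hx.1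
    have hSs : S ⊆ facetsAt o := fun x hx => hx.1
    have hSR : Disjoint S R := by
      rw [disjoint_left]
      rintro x ⟨hx, hxo⟩ hxR
      obtain ⟨k, hk, -, hk0⟩ := mem_iUnion₂.1 hxR
      exact hL.disjoint i k (Ne.symm hk) x hx.1 hk0 ((hslice x hx).2 hxo)
    have hun : S ∪ R = zeros L ∩ facetsAt o := by
      ext x
      constructor
      · rintro (⟨hx, hxo⟩ | hx)
        · exact ⟨⟨i, (hslice x hx).2 hxo⟩, hx⟩
        · obtain ⟨k, -, hx, hk0⟩ := mem_iUnion₂.1 hx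
          exact ⟨⟨k, hk0⟩, hx⟩
      · rintro ⟨⟨k, hk⟩, hx⟩
        by_cases hki : k = i
        · exact Or.inl ⟨hx, (hslice x hx).1 (hki ▸ hk)⟩
        · exact Or.inr (mem_iUnion₂.2 ⟨k, hki, hx, hk⟩)
    have hF : BijOn (collapse o p ∘ Φ) (facetsAt o) (face (Finset.univ.erase o)) :=
      hp.bijOn_collapse.comp hΦ.bijOn
    have hFc : ContinuousOn (collapse o p ∘ Φ) (facetsAt o) :=
      (continuous_collapse o p).comp_continuousOn hΦ.continuousOn
    refine ⟨collapse o p ∘ Φ '' S, collapse o p ∘ Φ '' R, hRc.image_of_continuousOn (hFc.mono hRs),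
      ?_, ?_, ?_, ?_⟩
    · rw [disjoint_iff_inter_eq_empty, ← hF.injOn.image_inter hSs hRs,
        disjoint_iff_inter_eq_empty.1 hSR, image_empty]
    · rw [← image_union, hun]
      ext y
      constructor
      · rintro ⟨x, ⟨hxL, hx⟩, rfl⟩
        exact ⟨(hΦ.mem x hx).1 hxL, hF.mapsTo hx⟩
      · rintro ⟨hy, hyf⟩
        obtain ⟨x, hx, rfl⟩ := hF.surjOn hyf
        exact ⟨x, ⟨(hΦ.mem x hx).2 hy, hx⟩, rfl⟩
    · rintro _ ⟨x, ⟨hx, hxo⟩, rfl⟩ v hv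
      have hΦx := hΦ.bijOn.mapsTo hx
      have : 0 < Φ x o := by
        rw [← sign_eq_one_iff, hΦ.sign x hx, sign_eq_one_iff, hxo]
        exact h0
      simp only [Function.comp, collapse_apply hv]
      have := mul_pos this (hp.pos v hv)
      have := hΦx.1.1 v
      linarith
    · obtain ⟨e₁⟩ := nonempty_slice_homeomorph hV o h1 h0
      obtain ⟨e₂, -⟩ := exists_homeomorph_of_bijOn (isCompact_slice o h) (hFc.mono hSs)
        (hF.injOn.mono hSs).bijOn_image
      exact ⟨e₂.symm.trans e₁⟩
  obtain ⟨h, hh, -⟩ := hΦ.exists_collapse hq hp (K' := zeros L) (K := G)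
    (fun x _ => exists_congr fun i => by rw [(hplanar i).dotProduct_collapse])
    (fun x _ => Iff.rfl)
  exact .of_finite (hL.mono (Finset.subset_univ _)) hh

theorem iUnion_faceBoundary (o : V) :
    (⋃ s ∈ Finset.univ.filter fun s : Finset V => o ∉ s ∧ ∃ j, j ≠ o ∧ j ∉ s, face s) =
      faceBoundary (Finset.univ.erase o) := by
  ext x
  simp only [Finset.mem_filter, Finset.mem_univ, true_and, mem_iUnion₂, exists_prop]
  constructor
  · rintro ⟨s, ⟨ho, j, hj, hjs⟩, hx⟩
    exact ⟨face_mono (Finset.subset_erase.2 ⟨Finset.subset_univ s, ho⟩) hx, j, by simpa using hj,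
      hx.2.2 j hjs⟩
  · rintro ⟨hx, j, hj, h0⟩
    refine ⟨(Finset.univ.erase o).erase j, ⟨by simp, j, Finset.ne_of_mem_erase hj,
      Finset.notMem_erase j _⟩, hx.1, hx.2.1, fun v hv => ?_⟩
    by_cases hvj : v = j
    · rw [hvj, h0]
    · exact hx.2.2 v fun h => hv (Finset.mem_erase.2 ⟨hvj, h⟩)

/-- A face-preserving homeomorphism of the boundary of the face opposite to `o` extends to the
facets at `o`. -/
theorem exists_cone_at {o : V} {h : (V → ℝ) → V → ℝ}
    (hh : PairHomeoOn ∅ ∅ (faceBoundary (Finset.univ.erase o)) h) :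
    ∃ Φ, PairHomeoOn ∅ ∅ (facetsAt o) Φ ∧ EqOn Φ h (faceBoundary (Finset.univ.erase o)) := by
  rw [← iUnion_faceBoundary] at hh ⊢
  rw [← iUnion_facetsAt]
  refine exists_pairHomeoOn_relative (fun s hs r hr => ?_) hh _ (fun s hs => ?_)
    (fun s hs r hr => ?_) fun s hs φ hφ => ?_
  · obtain ⟨h1, j, hj, hjs⟩ := (Finset.mem_filter.1 hs).2
    exact Finset.mem_filter.2 ⟨Finset.mem_univ _, fun h => h1 (hr h), j, hj, fun h => hjs (hr h)⟩
  · exact Finset.mem_filter.2 ⟨Finset.mem_univ _, (Finset.mem_filter.1 hs).2.2⟩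
  · obtain ⟨j, hj, hjs⟩ := (Finset.mem_filter.1 hs).2
    exact Finset.mem_filter.2 ⟨Finset.mem_univ _, j, hj, fun h => hjs (hr h)⟩
  · -- the case of the empty family of sections
    have hz : ∀ x : V → ℝ, x ∈ (∅ : Set (V → ℝ)) ↔ x ∈ zeros (fun (i : Empty) (_ : V) => (0 : ℝ)) :=
      fun x => by simp [zeros]
    have hflat : FlatFamily s (fun (i : Empty) (_ : V) => (0 : ℝ)) :=
      ⟨fun i => i.elim, fun i => i.elim⟩
    refine exists_pairHomeoOn_face (Finset.Subset.refl s) ⟨hflat, hflat, fun i => i.elim,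
      fun i => i.elim⟩ (fun x _ => hz x) (h₀ := id) ?_ hφ
    exact ⟨continuousOn_id, bijOn_id _, fun _ _ _ => rfl, fun x _ => (hz x).symm⟩

/-- A normal set becomes normal in the four small tetrahedra after a homeomorphism of the large
tetrahedron that fixes the boundary. It is obtained by moving the subdivision point close to a
vertex and off the flat sections. -/
theorem NormalOn.exists_image {o : V} {p : V → ℝ} (hp : IsApexImage o p) {G : Set (V → ℝ)}
    (hG : NormalOn (Finset.univ.erase o) G) :
    ∃ g : (V → ℝ) → V → ℝ, ContinuousOn g (face (Finset.univ.erase o)) ∧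
      BijOn g (face (Finset.univ.erase o)) (face (Finset.univ.erase o)) ∧
      (∀ x ∈ faceBoundary (Finset.univ.erase o), g x = x) ∧
      ∀ G', (∀ x ∈ face (Finset.univ.erase o), (x ∈ G ↔ g x ∈ G')) →
        ∀ j, j ≠ o → NormalOn (Finset.univ.erase j) (collapse o p ⁻¹' G') := by
  obtain ⟨n, l, hl, h, hh⟩ := hG
  obtain ⟨u, hu, -⟩ := face_exists_pos hp.mem
  obtain ⟨q, hq, hq', hlq⟩ := exists_interior_near_vertex hu (p := fun x => ∀ i, l i ⬝ᵥ x ≠ 0) (by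
    refine Filter.eventually_all.2 fun i => ?_
    refine (continuous_dotProduct_left (l i)).continuousAt.eventually_ne ?_
    rw [dotProduct_single_one]
    exact hl.ne_zero i u hu)
  have hq : IsApexImage o q := ⟨hq, fun v hv => hq' v (by simpa using hv)⟩
  -- the sections `l i`, as functionals on the complex in which `o` is placed at `q`
  set L : Fin n → V → ℝ := fun i v => if v = o then l i ⬝ᵥ q else l i v with hLd
  have hLl : ∀ i, ∀ x ∈ face (Finset.univ.erase o), L i ⬝ᵥ x = l i ⬝ᵥ x := by
    intro i x hx
    rw [dotProduct_face hx, dotProduct_face hx]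
    refine Finset.sum_congr rfl fun v hv => ?_
    simp [hLd, Finset.ne_of_mem_erase hv]
  have hLo : ∀ i, L i o = l i ⬝ᵥ q := fun i => by simp [hLd]
  have hLp : ∀ i, IsPlanar o q (L i) := fun i => by rw [IsPlanar, hLl i q hq.mem, hLo]
  have hLc : ∀ i, ∀ x ∈ face (Finset.univ : Finset V), L i ⬝ᵥ x = l i ⬝ᵥ collapse o q x := by
    intro i x hx
    rw [← (hLp i).dotProduct_collapse, hLl i _ (hq.collapse_mem hx)]
  have hL : FlatFamily Finset.univ L := by
    refine ⟨fun i v _ => ?_, fun i k hik x hx hk hi => ?_⟩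
    · by_cases hv : v = o
      · rw [hv, hLo]; exact hlq i
      · simpa [hLd, hv] using hl.ne_zero i v (by simpa using hv)
    · rw [hLc _ _ hx] at hk hi
      exact hl.disjoint i k hik _ (hq.collapse_mem hx) hk hi
  have hb := hh.restrict_faceBoundary (face_subset_univ _) faceBoundary_subset
  -- `k` agrees with `h` on the boundary and moves `q` to `p`, mapping the cones at `q` to those at
  -- `p`. So `k ∘ h⁻¹` fixes the boundary, and maps `G` to the image by `k` of the flat sections.
  obtain ⟨Φ, hΦ, hΦe⟩ := exists_cone_at (o := o) (h := h)
    ⟨hb.continuousOn, hb.bijOn, hb.sign, by simp⟩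
  obtain ⟨k, hk, hkΦ⟩ := hΦ.exists_collapse hq hp (K' := ∅) (K := ∅) (by simp) (by simp)
  obtain ⟨ψ, hψ, hψl, hψr⟩ := hh.exists_inverse (isCompact_face _)
  have hψb := hψ.restrict_faceBoundary (face_subset_univ _) faceBoundary_subset
  refine ⟨k ∘ ψ, hk.continuousOn.comp hψ.continuousOn hψ.bijOn.mapsTo, hk.bijOn.comp hψ.bijOn,
    fun x hx => ?_, fun G' hG' j hj => ?_⟩
  · have hy := hψb.bijOn.mapsTo hx
    have h0 : ∀ y ∈ faceBoundary (Finset.univ.erase o), y o = 0 := fun y hy =>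
      hy.1.2.2 o (Finset.notMem_erase o _)
    have hyf : ψ x ∈ facetsAt o := by
      obtain ⟨hy, v, hv, hv0⟩ := hy
      exact ⟨face_subset_univ _ hy, v, Finset.ne_of_mem_erase hv, hv0⟩
    have h1 := hkΦ _ hyf
    rw [collapse_of_zero (h0 _ hy), hΦe hy, hψr hx.1, collapse_of_zero (h0 x hx)] at h1
    exact h1
  · have hmem : PairHomeoOn (zeros L) (collapse o p ⁻¹' G') (facetsAt o) Φ := by
      refine ⟨hΦ.continuousOn, hΦ.bijOn, hΦ.sign, fun x hx => ?_⟩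
      have hc := hq.collapse_mem hx.1
      have h1 : x ∈ zeros L ↔ collapse o q x ∈ zeros l :=
        exists_congr fun i => by rw [hLc i x hx.1]
      rw [h1, hh.mem _ hc, hG' _ (hh.bijOn.mapsTo hc), Function.comp, hψl hc, hkΦ x hx]
      rfl
    exact .of_finite (hL.mono (Finset.subset_univ _))
      (hmem.restrict_face (fun x hx => hx.1) (face_erase_subset_facetsAt hj))

end OneStep

/-! ### Barycentric coordinates in a normed space -/

section Realization

open scoped Matrix

variable {V : Type*} [Fintype V] [DecidableEq V]
variable {E : Type*} [NormedAddCommGroup E] [NormedSpace ℝ E]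

/-- The point with barycentric coordinates `x` with respect to the points `P v`. -/
def realize (P : V → E) (x : V → ℝ) : E := ∑ v, x v • P v

theorem continuous_realize (P : V → E) : Continuous (realize P) := by
  unfold realize
  fun_prop

theorem realize_single (P : V → E) (v : V) : realize P (Pi.single v 1) = P v := by
  simp [realize, Pi.single_apply, ite_smul]

theorem realize_eq_sum (P : V → E) {s : Finset V} {x : V → ℝ} (hx : x ∈ face s) :
    realize P x = ∑ v ∈ s, x v • P v :=
  (Finset.sum_subset (Finset.subset_univ s) fun v _ hv => by rw [hx.2.2 v hv, zero_smul]).symm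

theorem sum_face {s : Finset V} {x : V → ℝ} (hx : x ∈ face s) : ∑ v ∈ s, x v = 1 := by
  rw [← hx.2.1]
  exact Finset.sum_subset (Finset.subset_univ s) fun v _ hv => hx.2.2 v hv

theorem image_realize_face (P : V → E) (s : Finset V) :
    realize P '' face s = convexHull ℝ (P '' (s : Set V)) := by
  apply Subset.antisymm
  · rintro _ ⟨x, hx, rfl⟩
    rw [realize_eq_sum P hx]
    exact (convex_convexHull ℝ _).sum_mem (fun v _ => hx.1 v) (sum_face hx)
      fun v hv => subset_convexHull ℝ _ ⟨v, hv, rfl⟩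
  · refine convexHull_min ?_ ?_
    · rintro _ ⟨v, hv, rfl⟩
      exact ⟨_, single_mem_face hv, realize_single P v⟩
    · exact (convex_face s).linear_image (Fintype.linearCombination ℝ P)

theorem injOn_realize {P : V → E} {s : Finset V} (hP : AffineIndependent ℝ fun v : s => P v) :
    InjOn (realize P) (face s) := by
  intro x hx y hy hxy
  rw [affineIndependent_iff] at hP
  have h := hP Finset.univ (fun v => x v - y v)
    (by
      rw [Finset.sum_coe_sort s (fun v => x v - y v), Finset.sum_sub_distrib, sum_face hx,
        sum_face hy, sub_self])
    (by
      rw [Finset.sum_coe_sort s (fun v => (x v - y v) • P v)]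
      simp only [sub_smul]
      rw [Finset.sum_sub_distrib, ← realize_eq_sum P hx, ← realize_eq_sum P hy, hxy, sub_self])
  ext v
  by_cases hv : v ∈ s
  · exact sub_eq_zero.1 (h ⟨v, hv⟩ (Finset.mem_univ _))
  · rw [hx.2.2 v hv, hy.2.2 v hv]

theorem affineMap_realize (l : E →ᵃ[ℝ] ℝ) (P : V → E) {x : V → ℝ}
    (hx : x ∈ face (Finset.univ : Finset V)) : l (realize P x) = (fun v => l (P v)) ⬝ᵥ x := by
  have h : ∀ y, l y = l.linear y + l 0 := fun y => congrFun l.decomp y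
  rw [h, realize, map_sum, dotProduct]
  simp only [map_smul, smul_eq_mul, h (P _), add_mul, Finset.sum_add_distrib]
  rw [← Finset.mul_sum, hx.2.1, mul_one]
  congr 1
  exact Finset.sum_congr rfl fun v _ => mul_comm _ _

/-- An affine function has arbitrary values at affinely independent points. -/
theorem exists_affineMap_eq {P : V → E} {s : Finset V} (hP : AffineIndependent ℝ fun v : s => P v)
    (m : V → ℝ) : ∃ l : E →ᵃ[ℝ] ℝ, ∀ v ∈ s, l (P v) = m v := by
  obtain ⟨t, hst, ht, htop⟩ := exists_subset_affineIndependent_affineSpan_eq_top hP.range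
  let b : AffineBasis t ℝ E := ⟨(↑), ht, by simpa using htop⟩
  have hmem : ∀ v : s, P v ∈ t := fun v => hst ⟨v, rfl⟩
  refine ⟨∑ v : s, m v • b.coord ⟨P v, hmem v⟩, fun w hw => ?_⟩
  have happ : ∀ y, (∑ v : s, m v • b.coord ⟨P v, hmem v⟩) y =
      ∑ v : s, m v * b.coord ⟨P v, hmem v⟩ y := fun y => by
    exact map_sum (AddMonoidHom.mk' (fun l : E →ᵃ[ℝ] ℝ => l y) fun _ _ => rfl) _ _
  rw [happ, Finset.sum_eq_single ⟨w, hw⟩]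
  · have h1 : b.coord ⟨P w, hmem ⟨w, hw⟩⟩ (P w) = 1 := b.coord_apply_eq ⟨P w, hmem ⟨w, hw⟩⟩
    change m w * b.coord ⟨P w, hmem ⟨w, hw⟩⟩ (P w) = m w
    rw [h1, mul_one]
  · intro v _ hv
    have : P w = b ⟨P w, hmem ⟨w, hw⟩⟩ := rfl
    rw [this, b.coord_apply_ne, mul_zero]
    intro h
    exact hv (hP.injective (congrArg Subtype.val h))
  · simp

theorem exists_function_of_homeomorph {X : Type*} [TopologicalSpace X] {K L : Set X} (k : K ≃ₜ L) :
    ∃ φ : X → X, ContinuousOn φ K ∧ BijOn φ K L ∧ ∀ x : K, φ x = k x := by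
  classical
  have h : ∀ x : K, (fun x => if hx : x ∈ K then (k ⟨x, hx⟩ : X) else x) x = k x :=
    fun x => dif_pos x.2
  refine ⟨fun x => if hx : x ∈ K then (k ⟨x, hx⟩ : X) else x, ?_,
    ⟨fun x hx => ?_, fun x hx y hy hxy => ?_, fun y hy => ?_⟩, h⟩
  · rw [continuousOn_iff_continuous_domRestrict]
    convert continuous_subtype_val.comp k.continuous using 1
    ext x
    exact h x
  · exact (h ⟨x, hx⟩).symm ▸ (k ⟨x, hx⟩).2
  · replace hxy := (h ⟨x, hx⟩).symm.trans (hxy.trans (h ⟨y, hy⟩))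
    exact congrArg Subtype.val (k.injective (Subtype.ext hxy))
  · exact ⟨k.symm ⟨y, hy⟩, (k.symm ⟨y, hy⟩).2, (h _).trans (by simp)⟩

theorem sign_eq_of_zero_iff {a b : ℝ} (ha : 0 ≤ a) (hb : 0 ≤ b) (h : a = 0 ↔ b = 0) :
    SignType.sign a = SignType.sign b := by
  rcases ha.eq_or_lt with h0 | h0
  · rw [← h0, h.1 h0.symm]
  · rw [sign_pos h0, sign_pos (lt_of_le_of_ne hb fun h' => h0.ne' (h.2 h'.symm))]

theorem bijOn_realize {P : V → E} {s : Finset V} (hP : AffineIndependent ℝ fun v : s => P v)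
    {t : Finset E} (ht : (t : Set E) = P '' s) : BijOn (realize P) (face s) (convexHull ℝ t) := by
  rw [ht, ← image_realize_face]
  exact (injOn_realize hP).bijOn_image

theorem realize_mem_convexHull_iff {P : V → E} {s r : Finset V}
    (hP : AffineIndependent ℝ fun v : s => P v) (hr : r ⊆ s) {x : V → ℝ} (hx : x ∈ face s) :
    realize P x ∈ convexHull ℝ (P '' (r : Set V)) ↔ x ∈ face r := by
  rw [← image_realize_face]
  constructor
  · rintro ⟨y, hy, hxy⟩
    exact injOn_realize hP (face_mono hr hy) hx hxy ▸ hy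
  · exact fun h => ⟨x, h, rfl⟩

/-- Normality of a set in a tetrahedron, in barycentric coordinates. -/
theorem meetsInNormalDisks_iff {P : V → E} {s : Finset V}
    (hP : AffineIndependent ℝ fun v : s => P v) (hs : s.Nonempty) {t : Finset E}
    (ht : (t : Set E) = P '' s) {G : Set E} :
    MeetsInNormalDisks t G ↔ NormalOn s (realize P ⁻¹' G) := by
  classical
  have hb := bijOn_realize hP ht
  obtain ⟨e, he⟩ := exists_homeomorph_of_bijOn (isCompact_face s)
    (continuous_realize P).continuousOn hb
  have hsub : ∀ r ⊆ s, r.image P ⊆ t := fun r hr => by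
    rw [← Finset.coe_subset, ht, Finset.coe_image]
    exact image_mono hr
  constructor
  · rintro ⟨𝒟, hfin, hD, hdisj, h, hpres, himg⟩
    choose l hl0 hlpos hlneg hl using hD
    have := hfin.to_subtype
    set m : 𝒟 → V → ℝ := fun D v => l D.1 D.2 (P v) with hm
    have hzero : ∀ (D : 𝒟), ∀ x ∈ face s, (m D ⬝ᵥ x = 0 ↔ realize P x ∈ D.1) := by
      intro D x hx
      conv_rhs => rw [hl D.1 D.2]
      rw [mem_ofPred_eq, affineMap_realize _ _ (face_subset_univ s hx)]
      exact (and_iff_right (hb.mapsTo hx)).symm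
    have hflat : FlatFamily s m := by
      refine ⟨fun D v hv => hl0 D.1 D.2 _ ?_, fun D D' hne x hx h1 h2 => ?_⟩
      · rw [← Finset.mem_coe, ht]; exact ⟨v, hv, rfl⟩
      · exact disjoint_left.1 (hdisj D.2 D'.2 fun h => hne (Subtype.ext h)) ((hzero D x hx).1 h2)
          ((hzero D' x hx).1 h1)
    obtain ⟨φ, hφc, hφb, hφ⟩ := exists_function_of_homeomorph ((e.trans h).trans e.symm)
    have hφe : ∀ x : face s, realize P (φ x) = h (e x) := fun x => by
      rw [hφ, ← he]
      simp
    refine .of_finite hflat (h := φ) ⟨hφc, hφb, fun x hx v => ?_, fun x hx => ?_⟩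
    · by_cases hv : v ∈ s
      · have hface : ∀ y ∈ face s, (y v = 0 ↔ y ∈ face (s.erase v)) := fun y hy => by
          constructor
          · intro h0
            refine ⟨hy.1, hy.2.1, fun w hw => ?_⟩
            by_cases hwv : w = v
            · rw [hwv, h0]
            · exact hy.2.2 w fun hh => hw (Finset.mem_erase.2 ⟨hwv, hh⟩)
          · exact fun h => h.2.2 v (Finset.notMem_erase v s)
        have hp := hpres _ (hsub _ (Finset.erase_subset v s))
        rw [Finset.coe_image] at hp
        refine sign_eq_of_zero_iff ((hφb.mapsTo hx).1 v) (hx.1 v) ?_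
        rw [hface _ (hφb.mapsTo hx), hface _ hx,
          ← realize_mem_convexHull_iff hP (Finset.erase_subset v s) (hφb.mapsTo hx),
          ← realize_mem_convexHull_iff hP (Finset.erase_subset v s) hx, hφe ⟨x, hx⟩,
          ← he ⟨x, hx⟩]
        have := h.injective.mem_set_image (s := Subtype.val ⁻¹' convexHull ℝ
          (P '' (s.erase v : Finset V))) (a := e ⟨x, hx⟩)
        rwa [hp] at this
      · rw [hx.2.2 v hv, (hφb.mapsTo hx).2.2 v hv]
    · have h1 : x ∈ zeros m ↔
          e ⟨x, hx⟩ ∈ (Subtype.val ⁻¹' ⋃₀ 𝒟 : Set (convexHull ℝ (t : Set E))) := by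
        rw [mem_preimage, he, mem_sUnion]
        constructor
        · rintro ⟨D, hD⟩
          exact ⟨D.1, D.2, (hzero D x hx).1 hD⟩
        · rintro ⟨D, hD, hxD⟩
          exact ⟨⟨D, hD⟩, (hzero ⟨D, hD⟩ x hx).2 hxD⟩
      rw [h1, ← h.injective.mem_set_image, himg, mem_preimage, mem_preimage, hφe ⟨x, hx⟩]
  · rintro ⟨n, l, hl, h, hh⟩
    obtain ⟨o, ho⟩ := hs
    obtain ⟨κ, _, m, hm, hneg, hpos, hz⟩ := hl.exists_normalized ho
    replace hh : PairHomeoOn (zeros m) (realize P ⁻¹' G) (face s) h :=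
      hh.congr_sets (fun x hx => (hz x hx).symm) fun _ _ => Iff.rfl
    choose A hA using fun i => exists_affineMap_eq hP (m i)
    have hAm : ∀ i, ∀ x ∈ face s, A i (realize P x) = m i ⬝ᵥ x := by
      intro i x hx
      rw [affineMap_realize _ _ (face_subset_univ s hx), dotProduct_face hx, dotProduct_face hx]
      exact Finset.sum_congr rfl fun v hv => by rw [hA i v hv]
    have hmt : ∀ v ∈ s, P v ∈ t := fun v hv => by
      rw [← Finset.mem_coe, ht]; exact ⟨v, hv, rfl⟩
    obtain ⟨k, hk⟩ := exists_homeomorph_of_bijOn (isCompact_face s) hh.continuousOn hh.bijOn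
    have hk' : ∀ x : face s, ((e.symm.trans (k.trans e)) (e x) : E) = realize P (h x) := by
      intro x
      simp [he, hk]
    refine ⟨range fun i => {x ∈ convexHull ℝ (t : Set E) | A i x = 0}, finite_range _, ?_, ?_,
      e.symm.trans (k.trans e), ?_, ?_⟩
    · rintro _ ⟨i, rfl⟩
      refine ⟨A i, fun y hy => ?_, ?_, ⟨P o, hmt o ho, by rw [hA i o ho]; exact hneg i⟩, rfl⟩
      · rw [← Finset.mem_coe, ht] at hy
        obtain ⟨v, hv, rfl⟩ := hy
        rw [hA i v hv]
        exact hm.ne_zero i v hv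
      · obtain ⟨v, hv, h0⟩ := hpos i
        exact ⟨P v, hmt v hv, by rw [hA i v hv]; exact h0⟩
    · rintro _ ⟨i, rfl⟩ _ ⟨j, rfl⟩ hij
      rw [Function.onFun, id, id, disjoint_left]
      rintro _ ⟨hy, hi⟩ ⟨-, hj⟩
      obtain ⟨x, hx, rfl⟩ := hb.surjOn hy
      rw [hAm _ x hx] at hi hj
      exact hm.disjoint i j (fun h => hij (by rw [h])) x hx hj hi
    · intro t' ht'
      obtain ⟨r, hr, rfl⟩ : ∃ r ⊆ s, r.image P = t' := by
        have : (t' : Set E) ⊆ P '' s := ht ▸ Finset.coe_subset.2 ht'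
        exact Finset.subset_image_iff.1 (by
          rwa [← Finset.coe_subset, Finset.coe_image])
      rw [Finset.coe_image]
      have key : ∀ x : face s, ((e.symm.trans (k.trans e)) (e x) : E) ∈
          convexHull ℝ (P '' (r : Set V)) ↔ (e x : E) ∈ convexHull ℝ (P '' (r : Set V)) := by
        intro x
        rw [hk', he, realize_mem_convexHull_iff hP hr x.2,
          realize_mem_convexHull_iff hP hr (hh.bijOn.mapsTo x.2)]
        exact ⟨mem_face_iff_of_sign (face_subset_univ s x.2) (hh.sign x x.2),
          mem_face_iff_of_sign (face_subset_univ s (hh.bijOn.mapsTo x.2))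
            fun v => (hh.sign x x.2 v).symm⟩
      ext y
      constructor
      · rintro ⟨z, hz, rfl⟩
        obtain ⟨x, rfl⟩ := e.surjective z
        exact (key x).2 hz
      · intro hy
        obtain ⟨z, rfl⟩ := (e.symm.trans (k.trans e)).surjective y
        obtain ⟨x, rfl⟩ := e.surjective z
        exact ⟨_, (key x).1 hy, rfl⟩
    · have key : ∀ x : face s, ((e.symm.trans (k.trans e)) (e x) : E) ∈ G ↔
          (e x : E) ∈ ⋃₀ range fun i => {x ∈ convexHull ℝ (t : Set E) | A i x = 0} := by
        intro x
        rw [hk', ← mem_preimage, ← hh.mem x x.2, he]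
        simp only [sUnion_range, mem_iUnion]
        exact exists_congr fun i => by
          rw [mem_ofPred_eq, hAm i x x.2]
          exact (and_iff_right (hb.mapsTo x.2)).symm
      ext y
      constructor
      · rintro ⟨z, hz, rfl⟩
        obtain ⟨x, rfl⟩ := e.surjective z
        exact (key x).2 hz
      · intro hy
        obtain ⟨z, rfl⟩ := (e.symm.trans (k.trans e)).surjective y
        obtain ⟨x, rfl⟩ := e.surjective z
        exact ⟨_, (key x).1 hy, rfl⟩

end Realization

/-! ### The stellar subdivision of a tetrahedron -/

universe u

section Stellar

open scoped Matrix

variable {V : Type*} [Fintype V] [DecidableEq V]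
variable {E : Type*} [NormedAddCommGroup E] [NormedSpace ℝ E]

theorem realize_collapse {P : V → E} {o : V} {p : V → ℝ} (hp : realize P p = P o) (x : V → ℝ) :
    realize P (collapse o p x) = realize P x := by
  have h : ∀ y, realize P y = Fintype.linearCombination ℝ P y := fun _ => rfl
  have h1 := realize_single P o
  rw [h] at hp h1
  rw [h, h, collapse, map_add, map_smul, map_sub, hp, h1, sub_self, smul_zero, add_zero]

theorem affineIndependent_iff_realize {P : V → E} {s : Finset V} :
    AffineIndependent ℝ (fun v : s => P v) ↔
      ∀ z : V → ℝ, (∀ v, v ∉ s → z v = 0) → ∑ v, z v = 0 → realize P z = 0 → z = 0 := by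
  have hsum : ∀ z : V → ℝ, (∀ v, v ∉ s → z v = 0) → ∑ v : s, z v = ∑ v, z v := fun z hz => by
    rw [Finset.sum_coe_sort s z]
    exact Finset.sum_subset (Finset.subset_univ s) fun v _ hv => hz v hv
  have hsum' : ∀ z : V → ℝ, (∀ v, v ∉ s → z v = 0) → ∑ v : s, z v • P v = realize P z :=
    fun z hz => by
      rw [Finset.sum_coe_sort s (fun v => z v • P v)]
      exact Finset.sum_subset (Finset.subset_univ s) fun v _ hv => by rw [hz v hv, zero_smul]
  rw [affineIndependent_iff_of_fintype]
  constructor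
  · intro h z hz h0 h1
    have := h (fun v => z v) (by rw [hsum z hz, h0]) (by
      rw [Finset.weightedVSub_eq_linear_combination Finset.univ
        (by rw [hsum z hz, h0]), hsum' z hz, h1])
    ext v
    by_cases hv : v ∈ s
    · exact this ⟨v, hv⟩
    · exact hz v hv
  · intro h w h0 h1 i
    rw [Finset.weightedVSub_eq_linear_combination Finset.univ h0] at h1
    set z : V → ℝ := fun v => if hv : v ∈ s then w ⟨v, hv⟩ else 0 with hz
    have hzw : ∀ v : s, z v = w v := fun v => by simp [hz]
    have hz0 : ∀ v, v ∉ s → z v = 0 := fun v hv => by simp [hz, hv]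
    have := h z hz0 (by rw [← hsum z hz0]; simpa [hzw] using h0)
      (by rw [← hsum' z hz0]; simpa [hzw] using h1)
    rw [← hzw i, this]
    rfl

/-- The open simplex consists of the points whose barycentric coordinates are all positive. -/
theorem openSimplex_eq_image {P : V → E} {s : Finset V}
    (hP : AffineIndependent ℝ fun v : s => P v) {t : Finset E} (ht : (t : Set E) = P '' s) :
    openSimplex t = realize P '' {x ∈ face s | ∀ v ∈ s, 0 < x v} := by
  classical
  have hinj : InjOn P s := fun v hv w hw h =>
    congrArg Subtype.val (hP.injective (a₁ := ⟨v, hv⟩) (a₂ := ⟨w, hw⟩) h)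
  obtain rfl : t = s.image P := by
    rw [← Finset.coe_inj, ht, Finset.coe_image]
  ext y
  constructor
  · rintro ⟨w, hw, h1, rfl⟩
    rw [Finset.sum_image hinj] at h1 ⊢
    set x : V → ℝ := fun v => if v ∈ s then w (P v) else 0 with hx
    have hxs : ∀ v ∈ s, x v = w (P v) := fun v hv => by simp [hx, hv]
    have hpos : ∀ v ∈ s, 0 < x v := fun v hv => by
      rw [hxs v hv]; exact hw _ (Finset.mem_image_of_mem P hv)
    have hx0 : ∀ v, v ∉ s → x v = 0 := fun v hv => by simp [hx, hv]
    have hface : x ∈ face s := by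
      refine ⟨fun v => ?_, ?_, hx0⟩
      · by_cases hv : v ∈ s
        · exact (hpos v hv).le
        · rw [hx0 v hv]
      · rw [← h1, ← Finset.sum_subset (Finset.subset_univ s) fun v _ hv => hx0 v hv]
        exact Finset.sum_congr rfl hxs
    refine ⟨x, ⟨hface, hpos⟩, ?_⟩
    rw [realize_eq_sum P hface]
    exact Finset.sum_congr rfl fun v hv => by rw [hxs v hv]
  · rintro ⟨x, ⟨hx, hpos⟩, rfl⟩
    obtain ⟨v, -⟩ := face_exists_pos hx
    have : Nonempty V := ⟨v⟩
    have hg : ∀ v ∈ s, Function.invFunOn P s (P v) = v := fun v hv => hinj.leftInvOn_invFunOn hv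
    refine ⟨fun y => x (Function.invFunOn P s y), ?_, ?_, ?_⟩
    · intro y hy
      obtain ⟨v, hv, rfl⟩ := Finset.mem_image.1 hy
      beta_reduce
      rw [hg v hv]
      exact hpos v hv
    · rw [Finset.sum_image hinj, ← sum_face hx]
      exact Finset.sum_congr rfl fun v hv => by rw [hg v hv]
    · rw [Finset.sum_image hinj, realize_eq_sum P hx]
      exact Finset.sum_congr rfl fun v hv => by beta_reduce; rw [hg v hv]

/-- `t` is the vertex set of a nondegenerate tetrahedron. -/
structure IsTetrahedron (t : Finset E) : Prop where
  card : t.card = 4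
  indep : AffineIndependent ℝ ((↑) : t → E)

/-- A tetrahedron with an interior point `q`, in barycentric coordinates: the points `P v` for
`v ≠ o` are the vertices and `P o = q`, and `p` are the barycentric coordinates of `q`. -/
structure IsFrame (t : Finset E) (q : E) (P : V → E) (o : V) (p : V → ℝ) : Prop where
  card : Fintype.card V = 5
  apex : P o = q
  vertices : (t : Set E) = P '' (Finset.univ.erase o : Finset V)
  indep : AffineIndependent ℝ fun v : (Finset.univ.erase o : Finset V) => P v
  coords : IsApexImage o p
  realize_coords : realize P p = P o

/-- The four tetrahedra of the subdivision correspond to the facets at `o`. -/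
structure IsFacetFrame (s : Finset E) (P : V → E) (j : V) : Prop where
  vertices : (s : Set E) = P '' (Finset.univ.erase j : Finset V)
  indep : AffineIndependent ℝ fun v : (Finset.univ.erase j : Finset V) => P v

/-- Barycentric coordinates of a tetrahedron together with an interior point. The index set consists
of the vertices and one further element for the interior point. -/
theorem IsTetrahedron.exists_frame {E : Type u} [NormedAddCommGroup E] [NormedSpace ℝ E]
    {t : Finset E} (ht : IsTetrahedron t) {q : E} (hq : q ∈ openSimplex t) :
    ∃ (V : Type u) (_ : Fintype V) (_ : DecidableEq V) (P : V → E) (o : V) (p : V → ℝ),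
      IsFrame t q P o p := by
  classical
  obtain ⟨w, hw, h1, hwq⟩ := hq
  refine ⟨Option t, inferInstance, inferInstance, fun v => v.elim q (↑), none,
    fun v => v.elim 0 fun x => w x, ?_⟩
  have hmem : ∀ v, v ∈ ((Finset.univ.erase none : Finset (Option t))) ↔ v ≠ none := by simp
  refine ⟨?_, rfl, ?_, ?_, ⟨⟨?_, ?_, ?_⟩, ?_⟩, ?_⟩
  · simp [ht.card]
  · ext y
    constructor
    · exact fun hy => ⟨some ⟨y, hy⟩, by simp, rfl⟩
    · rintro ⟨v, hv, rfl⟩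
      rcases v with - | v
      · simp at hv
      · exact v.2
  · have hi : Function.Injective fun v : (Finset.univ.erase none : Finset (Option t)) =>
        v.1.get (Option.isSome_iff_ne_none.2 ((hmem v.1).1 v.2)) := by
      intro v v' h
      exact Subtype.ext (Option.get_inj.1 h)
    convert ht.indep.comp_embedding ⟨_, hi⟩ using 1
    ext v
    rcases v with ⟨- | v, hv⟩
    · simp at hv
    · rfl
  · rintro (- | v)
    · exact le_rfl
    · exact (hw v v.2).le
  · rw [Fintype.sum_option]
    simp only [Option.elim]
    rw [zero_add, Finset.sum_coe_sort t w, h1]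
  · intro v hv
    have : v = none := by simpa using hv
    rw [this]; rfl
  · rintro (- | v) hv
    · exact absurd rfl hv
    · exact hw v v.2
  · rw [realize, Fintype.sum_option]
    simp only [Option.elim, zero_smul, zero_add]
    rw [Finset.sum_coe_sort t (fun v => w v • v), hwq]

variable {t : Finset E} {q : E} {P : V → E} {o : V} {p : V → ℝ}

/-- The tetrahedra of the stellar subdivision correspond to facets at `o`. -/
theorem IsFrame.facet (h : IsFrame t q P o p) {s : Finset E} (hs : s ∈ stellarSubdivision q t) :
    ∃ j, j ≠ o ∧ IsFacetFrame s P j := by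
  classical
  obtain ⟨v, hv, rfl⟩ := hs
  have hv' := hv
  rw [← Finset.mem_coe, h.vertices] at hv'
  obtain ⟨j, hj, rfl⟩ := hv'
  have hjo := Finset.ne_of_mem_erase hj
  have hinj : ∀ v w, v ≠ o → w ≠ o → P v = P w → v = w := fun v w hv hw hvw =>
    congrArg Subtype.val (h.indep.injective (a₁ := ⟨v, by simpa using hv⟩)
      (a₂ := ⟨w, by simpa using hw⟩) hvw)
  refine ⟨j, hjo, ?_, ?_⟩
  · ext y
    simp only [Finset.coe_insert, Finset.coe_erase, mem_insert_iff, mem_sdiff, h.vertices,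
      mem_singleton_iff, ← h.apex]
    constructor
    · rintro (rfl | ⟨⟨v, hv, rfl⟩, hne⟩)
      · exact ⟨o, by simp [hjo.symm], rfl⟩
      · exact ⟨v, by simpa using fun hh : v = j => hne (by rw [hh]), rfl⟩
    · rintro ⟨v, hv, rfl⟩
      by_cases hvo : v = o
      · exact Or.inl (by rw [hvo])
      · refine Or.inr ⟨⟨v, by simpa using hvo, rfl⟩, fun hh => ?_⟩
        have := hinj v j hvo hjo hh
        simp [this] at hv
  · rw [affineIndependent_iff_realize]
    intro z hz h0 h1
    have hzj : z j = 0 := hz j (Finset.notMem_erase j _)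
    -- the weight of `q` is distributed over the vertices of `t`
    have hc := affineIndependent_iff_realize.1 h.indep (collapse o p z)
      (fun v hv => by
        have : v = o := by simpa using hv
        rw [this, h.coords.collapse_apply_self])
      (by simp [collapse, Finset.sum_add_distrib, h0, ← Finset.mul_sum, h.coords.mem.2.1])
      (by rw [realize_collapse h.realize_coords, h1])
    have hj := congrFun hc j
    rw [collapse_apply hjo, hzj, zero_add] at hj
    have hzo : z o = 0 := (mul_eq_zero.1 hj).resolve_right (h.coords.pos j hjo).ne'
    rwa [collapse_of_zero hzo] at hc

theorem IsFrame.bijOn (h : IsFrame t q P o p) : BijOn (realize P) (facetsAt o) (convexHull ℝ t) :=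
  ((bijOn_realize h.indep h.vertices).comp h.coords.bijOn_collapse).congr
    fun x _ => realize_collapse h.realize_coords x

theorem IsFacetFrame.bijOn {s : Finset E} {j : V} (h : IsFacetFrame s P j) :
    BijOn (realize P) (face (Finset.univ.erase j)) (convexHull ℝ s) :=
  bijOn_realize h.indep h.vertices

theorem IsFacetFrame.openSimplex {s : Finset E} {j : V} (h : IsFacetFrame s P j) :
    openSimplex s = realize P '' {x ∈ face (Finset.univ.erase j) | ∀ v, v ≠ j → 0 < x v} := by
  rw [openSimplex_eq_image h.indep h.vertices]
  simp

theorem IsFrame.openSimplex (h : IsFrame t q P o p) :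
    openSimplex t = realize P '' {x ∈ face (Finset.univ.erase o) | ∀ v, v ≠ o → 0 < x v} :=
  IsFacetFrame.openSimplex ⟨h.vertices, h.indep⟩

theorem IsFrame.nonempty_erase (h : IsFrame t q P o p) (j : V) :
    (Finset.univ.erase j : Finset V).Nonempty := by
  rw [← Finset.card_pos, Finset.card_erase_of_mem (Finset.mem_univ j), Finset.card_univ, h.card]
  norm_num

theorem IsFrame.subset_biUnion (h : IsFrame t q P o p) :
    convexHull ℝ (t : Set E) ⊆ ⋃ s ∈ stellarSubdivision q t, convexHull ℝ (s : Set E) := by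
  classical
  intro y hy
  obtain ⟨x, hx, rfl⟩ := h.bijOn.surjOn hy
  obtain ⟨j, hj, hxj⟩ := mem_facetsAt_iff.1 hx
  have hPj : P j ∈ t := by
    rw [← Finset.mem_coe, h.vertices]
    exact ⟨j, by simpa using hj, rfl⟩
  refine mem_iUnion₂.2 ⟨_, ⟨P j, hPj, rfl⟩, ?_⟩
  have himg := image_realize_face P (Finset.univ.erase j)
  have : realize P x ∈ convexHull ℝ (P '' ((Finset.univ.erase j : Finset V) : Set V)) :=
    himg ▸ ⟨x, hxj, rfl⟩
  refine convexHull_mono ?_ this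
  rintro _ ⟨v, hv, rfl⟩
  have hinj : ∀ v w, v ≠ o → w ≠ o → P v = P w → v = w := fun v w hv hw hvw =>
    congrArg Subtype.val (h.indep.injective (a₁ := ⟨v, by simpa using hv⟩)
      (a₂ := ⟨w, by simpa using hw⟩) hvw)
  have hvj : v ≠ j := by simpa using hv
  simp only [Finset.coe_insert, Finset.coe_erase, mem_insert_iff, mem_sdiff, h.vertices,
    mem_singleton_iff, ← h.apex]
  by_cases hvo : v = o
  · exact Or.inl (by rw [hvo])
  · exact Or.inr ⟨⟨v, by simpa using hvo, rfl⟩, fun hh => hvj (hinj v j hvo hj hh)⟩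

theorem IsFrame.convexHull_subset (h : IsFrame t q P o p) {s : Finset E} {j : V} (hj : j ≠ o)
    (hs : IsFacetFrame s P j) : convexHull ℝ (s : Set E) ⊆ convexHull ℝ t := by
  intro y hy
  obtain ⟨x, hx, rfl⟩ := hs.bijOn.surjOn hy
  exact h.bijOn.mapsTo (face_erase_subset_facetsAt hj hx)

theorem IsFrame.openSimplex_subset (h : IsFrame t q P o p) {s : Finset E} {j : V} (hj : j ≠ o)
    (hs : IsFacetFrame s P j) : _root_.openSimplex s ⊆ _root_.openSimplex t := by
  rw [hs.openSimplex, h.openSimplex]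
  rintro _ ⟨x, ⟨hx, hpos⟩, rfl⟩
  refine ⟨collapse o p x, ⟨h.coords.collapse_mem (face_subset_univ _ hx), fun v hv => ?_⟩,
    realize_collapse h.realize_coords x⟩
  rw [collapse_apply hv]
  have := mul_pos (hpos o hj.symm) (h.coords.pos v hv)
  have := hx.1 v
  linarith

theorem IsFrame.disjoint (h : IsFrame t q P o p) {s s' : Finset E} {j j' : V} (hj : j ≠ o)
    (hj' : j' ≠ o) (hs : IsFacetFrame s P j) (hs' : IsFacetFrame s' P j') (hne : j ≠ j') :
    Disjoint (_root_.openSimplex s) (convexHull ℝ (s' : Set E)) := by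
  rw [disjoint_left, hs.openSimplex]
  rintro _ ⟨x, ⟨hx, hpos⟩, rfl⟩ hy
  obtain ⟨x', hx', he⟩ := hs'.bijOn.surjOn hy
  have := h.bijOn.injOn (face_erase_subset_facetsAt hj' hx') (face_erase_subset_facetsAt hj hx) he
  have h0 := hpos j' hne.symm
  rw [← this, hx'.2.2 j' (Finset.notMem_erase j' _)] at h0
  exact lt_irrefl _ h0

theorem IsFacetFrame.eq {s s' : Finset E} {j : V} (hs : IsFacetFrame s P j)
    (hs' : IsFacetFrame s' P j) : s = s' := by
  rw [← Finset.coe_inj, hs.vertices, hs'.vertices]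

theorem IsFacetFrame.isTetrahedron (h : IsFrame t q P o p) {s : Finset E} {j : V}
    (hs : IsFacetFrame s P j) : IsTetrahedron s := by
  classical
  have hinj : InjOn P (Finset.univ.erase j : Finset V) := fun v hv w hw hvw =>
    congrArg Subtype.val (hs.indep.injective (a₁ := ⟨v, hv⟩) (a₂ := ⟨w, hw⟩) hvw)
  constructor
  · have : s = (Finset.univ.erase j).image P := by
      rw [← Finset.coe_inj, hs.vertices, Finset.coe_image]
    rw [this, Finset.card_image_of_injOn hinj, Finset.card_erase_of_mem (Finset.mem_univ j),
      Finset.card_univ, h.card]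
  · have := hs.indep.range
    have hr : range (fun v : (Finset.univ.erase j : Finset V) => P v) = s := by
      rw [hs.vertices]
      ext y
      simp
    rw [hr] at this
    exact this

theorem HasSphere.image {X Y : Type*} [TopologicalSpace X] [TopologicalSpace Y] [T2Space Y]
    {G O : Set X} (h : HasSphere G O) {f : X → Y} {K : Set X} (hf : ContinuousOn f K)
    (hi : InjOn f K) (hG : G ⊆ K) {O' : Set Y} (hO : ∀ x ∈ G, x ∈ O → f x ∈ O') :
    HasSphere (f '' G) O' := by
  obtain ⟨S, R, hR, hSR, rfl, hS, ⟨e⟩⟩ := h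
  have hSK : S ⊆ K := subset_union_left.trans hG
  have hRK : R ⊆ K := subset_union_right.trans hG
  have hSc : IsCompact S := by
    have : CompactSpace S := e.symm.compactSpace
    exact isCompact_iff_compactSpace.2 this
  refine ⟨f '' S, f '' R, hR.image_of_continuousOn (hf.mono hRK), ?_, (image_union f S R).symm,
    ?_, ?_⟩
  · rw [disjoint_iff_inter_eq_empty, ← hi.image_inter hSK hRK, disjoint_iff_inter_eq_empty.1 hSR,
      image_empty]
  · rintro _ ⟨x, hx, rfl⟩
    exact hO x (Or.inl hx) (hS hx)
  · obtain ⟨e', -⟩ := exists_homeomorph_of_bijOn hSc (hf.mono hSK) (hi.mono hSK).bijOn_image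
    exact ⟨e'.symm.trans e⟩

/-- `NormalOn.of_facets` for a tetrahedron in a normed space. -/
theorem IsFrame.meetsInNormalDisks (h : IsFrame t q P o p) {G : Set E}
    (hG : ∀ s ∈ stellarSubdivision q t, MeetsInNormalDisks s G)
    (hS : ¬ HasSphere (G ∩ convexHull ℝ (t : Set E)) (_root_.openSimplex t)) :
    MeetsInNormalDisks t G := by
  classical
  rw [meetsInNormalDisks_iff h.indep (h.nonempty_erase o) h.vertices]
  have hb := bijOn_realize h.indep h.vertices
  refine NormalOn.of_facets h.card h.coords (fun j hj => ?_) fun hS' => hS ?_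
  · have hPj : P j ∈ t := by
      rw [← Finset.mem_coe, h.vertices]
      exact ⟨j, by simpa using hj, rfl⟩
    obtain ⟨j', hj', hf⟩ := h.facet ⟨P j, hPj, rfl⟩
    have : j = j' := by
      by_contra hne
      have h1 : P j ∈ insert q (t.erase (P j)) := by
        rw [← Finset.mem_coe, hf.vertices]
        exact ⟨j, by simpa using hne, rfl⟩
      rw [Finset.mem_insert] at h1
      rcases h1 with h1 | h1
      · have h2 : realize P (Pi.single j 1) = realize P p := by
          rw [realize_single, h1, h.realize_coords, h.apex]
        have h3 := hb.injOn (single_mem_face (by simpa using hj)) h.coords.mem h2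
        have h4 := congrFun h3 j'
        rw [Pi.single_apply, if_neg (Ne.symm hne)] at h4
        exact (h.coords.pos j' hj').ne h4
      · exact Finset.notMem_erase _ _ h1
    subst this
    have hN := (meetsInNormalDisks_iff hf.indep (h.nonempty_erase j) hf.vertices).1
      (hG _ ⟨P j, hPj, rfl⟩)
    convert hN using 1
    ext x
    rw [mem_preimage, mem_preimage, realize_collapse h.realize_coords, mem_preimage]
  · have := hS'.image (f := realize P) (K := face (Finset.univ.erase o))
      (continuous_realize P).continuousOn hb.injOn inter_subset_right
      (O' := _root_.openSimplex t) (fun x hx hpos => by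
        rw [h.openSimplex]
        exact ⟨x, ⟨hx.2, hpos⟩, rfl⟩)
    convert this using 1
    rw [image_preimage_inter, hb.image_eq]

/-- `g` is a homeomorphism of the simplex spanned by `t` that fixes the boundary; it is extended by
the identity. -/
structure IsInnerHomeo (t : Finset E) (g : E → E) : Prop where
  continuousOn : ContinuousOn g (convexHull ℝ (t : Set E))
  bijOn : BijOn g (convexHull ℝ (t : Set E)) (convexHull ℝ (t : Set E))
  fix : ∀ x, x ∉ _root_.openSimplex t → g x = x

theorem mem_openSimplex_or_boundary {P : V → E} {s : Finset V}
    (hP : AffineIndependent ℝ fun v : s => P v) {t : Finset E} (ht : (t : Set E) = P '' s)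
    {x : V → ℝ} (hx : x ∈ face s) : realize P x ∈ openSimplex t ∨ x ∈ faceBoundary s := by
  by_cases hb : x ∈ faceBoundary s
  · exact Or.inr hb
  · left
    rw [openSimplex_eq_image hP ht]
    exact ⟨x, ⟨hx, fun v hv => lt_of_le_of_ne (hx.1 v) fun h0 => hb ⟨hx, v, hv, h0.symm⟩⟩, rfl⟩

theorem openSimplex_subset_convexHull (t : Finset E) :
    openSimplex t ⊆ convexHull ℝ (t : Set E) := by
  rintro _ ⟨w, hw, h1, rfl⟩
  exact (convex_convexHull ℝ _).sum_mem (fun v hv => (hw v hv).le) h1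
    fun v hv => subset_convexHull ℝ _ hv

/-- A homeomorphism given in barycentric coordinates. -/
theorem exists_isInnerHomeo {P : V → E} {s : Finset V}
    (hP : AffineIndependent ℝ fun v : s => P v) {t : Finset E} (ht : (t : Set E) = P '' s)
    {g : (V → ℝ) → V → ℝ} (hg : ContinuousOn g (face s)) (hgb : BijOn g (face s) (face s))
    (hfix : ∀ x ∈ faceBoundary s, g x = x) :
    ∃ k : E → E, IsInnerHomeo t k ∧ ∀ x ∈ face s, k (realize P x) = realize P (g x) := by
  classical
  have hb := bijOn_realize hP ht
  obtain ⟨e, he⟩ := exists_homeomorph_of_bijOn (isCompact_face s)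
    (continuous_realize P).continuousOn hb
  obtain ⟨k, hk⟩ := exists_homeomorph_of_bijOn (isCompact_face s) hg hgb
  obtain ⟨φ, hφc, hφb, hφ⟩ := exists_function_of_homeomorph (e.symm.trans (k.trans e))
  have hφe : ∀ x ∈ face s, φ (realize P x) = realize P (g x) := by
    intro x hx
    have := hφ (e ⟨x, hx⟩)
    rw [he] at this
    rw [this]
    simp [he, hk]
  have heq : EqOn (fun x => if x ∈ convexHull ℝ (t : Set E) then φ x else x) φ
      (convexHull ℝ (t : Set E)) := fun x hx => if_pos hx
  refine ⟨fun x => if x ∈ convexHull ℝ (t : Set E) then φ x else x,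
    ⟨hφc.congr heq, hφb.congr heq.symm, fun x hx => ?_⟩, fun x hx => ?_⟩
  · by_cases hxt : x ∈ convexHull ℝ (t : Set E)
    · obtain ⟨y, hy, rfl⟩ := hb.surjOn hxt
      have h1 := hfix y ((mem_openSimplex_or_boundary hP ht hy).resolve_left hx)
      exact (heq hxt).trans ((hφe y hy).trans (by rw [h1]))
    · exact if_neg hxt
  · exact (heq (hb.mapsTo hx)).trans (hφe x hx)

/-- `NormalOn.exists_image` for a tetrahedron in a normed space. -/
theorem IsFrame.exists_image (h : IsFrame t q P o p) {G : Set E} (hG : MeetsInNormalDisks t G) :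
    ∃ g : E → E, IsInnerHomeo t g ∧
      ∀ G', (∀ x ∈ convexHull ℝ (t : Set E), (x ∈ G ↔ g x ∈ G')) →
        ∀ s ∈ stellarSubdivision q t, MeetsInNormalDisks s G' := by
  rw [meetsInNormalDisks_iff h.indep (h.nonempty_erase o) h.vertices] at hG
  obtain ⟨g, hgc, hgb, hfix, hN⟩ := hG.exists_image h.coords
  obtain ⟨k, hk, hkg⟩ := exists_isInnerHomeo h.indep h.vertices hgc hgb hfix
  refine ⟨k, hk, fun G' hG' s hs => ?_⟩
  obtain ⟨j, hj, hf⟩ := h.facet hs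
  rw [meetsInNormalDisks_iff hf.indep (h.nonempty_erase j) hf.vertices]
  convert hN (realize P ⁻¹' G') (fun x hx => ?_) j hj using 1
  · ext x
    rw [mem_preimage, mem_preimage, mem_preimage, realize_collapse h.realize_coords]
  · rw [mem_preimage, hG' _ ((bijOn_realize h.indep h.vertices).mapsTo hx), hkg x hx, mem_preimage]

end Stellar

/-! ### Iterated subdivisions -/

section Recursion

variable {E : Type*} [NormedAddCommGroup E] [NormedSpace ℝ E]

theorem mem_iteratedSubdivision_succ {e : Finset E → E} {n : ℕ} {t s : Finset E} :
    s ∈ iteratedSubdivision e (n + 1) t ↔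
      ∃ r ∈ stellarSubdivision (e t) t, s ∈ iteratedSubdivision e n r := by
  induction n generalizing s with
  | zero => simp [iteratedSubdivision]
  | succ n ih =>
    rw [iteratedSubdivision]
    simp only [mem_ofPred_eq, ih]
    constructor
    · rintro ⟨r, ⟨c, hc, hr⟩, hs⟩
      exact ⟨c, hc, r, hr, hs⟩
    · rintro ⟨c, hc, r, hr, hs⟩
      exact ⟨r, ⟨c, hc, hr⟩, hs⟩

theorem finite_stellarSubdivision (q : E) (t : Finset E) : (stellarSubdivision q t).Finite := by
  classical
  refine (t.finite_toSet.image fun v => insert q (t.erase v)).subset ?_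
  rintro s ⟨v, hv, rfl⟩
  exact ⟨v, hv, by congr⟩

/-- The properties of the subdivision of a tetrahedron that do not refer to coordinates. -/
theorem IsTetrahedron.stellarSubdivision {t : Finset E} (ht : IsTetrahedron t) {q : E}
    (hq : q ∈ openSimplex t) :
    (∀ s ∈ stellarSubdivision q t, IsTetrahedron s ∧ openSimplex s ⊆ openSimplex t ∧
      convexHull ℝ (s : Set E) ⊆ convexHull ℝ (t : Set E)) ∧
    (∀ s ∈ stellarSubdivision q t, ∀ s' ∈ stellarSubdivision q t, s ≠ s' →
      Disjoint (openSimplex s) (convexHull ℝ (s' : Set E))) ∧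
    convexHull ℝ (t : Set E) = ⋃ s ∈ stellarSubdivision q t, convexHull ℝ (s : Set E) := by
  obtain ⟨V, _, _, P, o, p, h⟩ := ht.exists_frame hq
  have h1 : ∀ s ∈ _root_.stellarSubdivision q t, IsTetrahedron s ∧ openSimplex s ⊆ openSimplex t ∧
      convexHull ℝ (s : Set E) ⊆ convexHull ℝ (t : Set E) := fun s hs => by
    obtain ⟨j, hj, hf⟩ := h.facet hs
    exact ⟨hf.isTetrahedron h, h.openSimplex_subset hj hf, h.convexHull_subset hj hf⟩
  refine ⟨h1, fun s hs s' hs' hne => ?_, ?_⟩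
  · obtain ⟨j, hj, hf⟩ := h.facet hs
    obtain ⟨j', hj', hf'⟩ := h.facet hs'
    exact h.disjoint hj hj' hf hf' fun hjj => hne (hf.eq (hjj ▸ hf'))
  · exact Subset.antisymm h.subset_biUnion (iUnion₂_subset fun s hs => (h1 s hs).2.2)

theorem isCompact_convexHull (t : Finset E) : IsCompact (convexHull ℝ (t : Set E)) :=
  t.finite_toSet.isCompact_convexHull (𝕜 := ℝ)

/-- A set that is normal in the tetrahedra of the `n`-th subdivision is normal, unless it has a
spherical component inside the tetrahedron. -/
theorem IsTetrahedron.meetsInNormalDisks {e : Finset E → E} (he : IsInteriorPointChoice e)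
    {G : Set E} (hG : IsCompact G) (n : ℕ) {t : Finset E} (ht : IsTetrahedron t)
    (hN : ∀ s ∈ iteratedSubdivision e n t, MeetsInNormalDisks s G)
    (hS : ¬ HasSphere (G ∩ convexHull ℝ (t : Set E)) (openSimplex t)) :
    MeetsInNormalDisks t G := by
  induction n generalizing t with
  | zero => exact hN t rfl
  | succ n ih =>
    have hq := he t ht.card ht.indep
    obtain ⟨h1, h2, h3⟩ := ht.stellarSubdivision hq
    obtain ⟨V, _, _, P, o, p, h⟩ := ht.exists_frame hq
    refine h.meetsInNormalDisks (fun c hc => ih (h1 c hc).1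
      (fun s hs => hN s (mem_iteratedSubdivision_succ.2 ⟨c, hc, hs⟩)) ?_) hS
    rintro ⟨S, K, hK, hSK, hun, hSO, hsph⟩
    -- the sphere is separated from the rest of `G`, also outside of the small tetrahedron
    refine hS ⟨S, K ∪ G ∩ ⋃ s ∈ _root_.stellarSubdivision (e t) t \ {c},
      convexHull ℝ (s : Set E), ?_, ?_, ?_, hSO.trans (h1 c hc).2.1, hsph⟩
    · refine hK.union (hG.inter ?_)
      exact ((finite_stellarSubdivision _ t).sdiff).isCompact_biUnion
        fun s _ => isCompact_convexHull s
    · refine disjoint_union_right.2 ⟨hSK, disjoint_left.2 fun x hx hx' => ?_⟩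
      obtain ⟨s, ⟨hs, hsc⟩, hxs⟩ := mem_iUnion₂.1 hx'.2
      exact disjoint_left.1 (h2 c hc s hs (Ne.symm hsc)) (hSO hx) hxs
    · rw [← union_assoc, hun, ← inter_union_distrib_left, h3]
      congr 1
      ext x
      simp only [mem_union, mem_iUnion₂, exists_prop, mem_sdiff, mem_singleton_iff]
      constructor
      · rintro (hx | ⟨s, hs, hx⟩)
        · exact ⟨c, hc, hx⟩
        · exact ⟨s, hs.1, hx⟩
      · rintro ⟨s, hs, hx⟩
        by_cases hsc : s = c
        · exact Or.inl (hsc ▸ hx)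
        · exact Or.inr ⟨s, ⟨hs, hsc⟩, hx⟩

/-- The tetrahedra in `R` have disjoint interiors. -/
def HaveDisjointInteriors (R : Set (Finset E)) : Prop :=
  ∀ r ∈ R, ∀ r' ∈ R, r ≠ r' → Disjoint (openSimplex r) (convexHull ℝ (r' : Set E))

open scoped Classical in
/-- The map that is `g r` in the interior of the simplex `r ∈ R`, and the identity elsewhere. -/
noncomputable def glue (R : Set (Finset E)) (g : Finset E → E → E) (x : E) : E :=
  if h : ∃ r ∈ R, x ∈ openSimplex r then g h.choose x else x

theorem IsInnerHomeo.mapsTo_openSimplex {t : Finset E} {g : E → E} (hg : IsInnerHomeo t g) :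
    MapsTo g (openSimplex t) (openSimplex t) := by
  intro x hx
  have hxt := openSimplex_subset_convexHull t hx
  by_contra h
  have := hg.bijOn.injOn (hg.bijOn.mapsTo hxt) hxt (hg.fix _ h)
  exact h (by rwa [this])

theorem IsInnerHomeo.id (t : Finset E) : IsInnerHomeo t (id : E → E) :=
  ⟨continuousOn_id, bijOn_id _, fun _ _ => rfl⟩

theorem IsInnerHomeo.comp {t : Finset E} {g g' : E → E} (hg : IsInnerHomeo t g)
    (hg' : IsInnerHomeo t g') : IsInnerHomeo t (g ∘ g') :=
  ⟨hg.continuousOn.comp hg'.continuousOn hg'.bijOn.mapsTo, hg.bijOn.comp hg'.bijOn,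
    fun x hx => by rw [Function.comp, hg'.fix x hx, hg.fix x hx]⟩

theorem glue_of_notMem {R : Set (Finset E)} {g : Finset E → E → E} {x : E}
    (hx : ∀ r ∈ R, x ∉ openSimplex r) : glue R g x = x :=
  dif_neg fun ⟨r, hr, hxr⟩ => hx r hr hxr

theorem HaveDisjointInteriors.eq_of_mem {R : Set (Finset E)} (hR : HaveDisjointInteriors R)
    {r r' : Finset E} (hr : r ∈ R) (hr' : r' ∈ R) {x : E} (hx : x ∈ openSimplex r)
    (hx' : x ∈ convexHull ℝ (r' : Set E)) : r = r' := by
  by_contra hne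
  exact disjoint_left.1 (hR r hr r' hr' hne) hx hx'

theorem HaveDisjointInteriors.eqOn_glue {R : Set (Finset E)} (hR : HaveDisjointInteriors R)
    {g : Finset E → E → E} (hg : ∀ r ∈ R, IsInnerHomeo r (g r)) {r : Finset E} (hr : r ∈ R) :
    EqOn (glue R g) (g r) (convexHull ℝ (r : Set E)) := by
  intro x hx
  by_cases h : ∃ r ∈ R, x ∈ openSimplex r
  · have h1 := h.choose_spec
    rw [glue, dif_pos h, hR.eq_of_mem h1.1 hr h1.2 hx]
  · rw [glue, dif_neg h, (hg r hr).fix x fun hxr => h ⟨r, hr, hxr⟩]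

/-- The glued map is injective since it preserves the open simplices and is the identity
elsewhere. -/
theorem HaveDisjointInteriors.injective_glue {R : Set (Finset E)} (hR : HaveDisjointInteriors R)
    {g : Finset E → E → E} (hg : ∀ r ∈ R, IsInnerHomeo r (g r)) :
    Function.Injective (glue R g) := by
  have hin : ∀ r ∈ R, ∀ x ∈ openSimplex r, glue R g x = g r x ∧ glue R g x ∈ openSimplex r := by
    intro r hr x hx
    have := hR.eqOn_glue hg hr (openSimplex_subset_convexHull r hx)
    exact ⟨this, this ▸ (hg r hr).mapsTo_openSimplex hx⟩
  have key : ∀ r ∈ R, ∀ x ∈ openSimplex r, ∀ y, glue R g x = glue R g y → x = y := by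
    intro r hr x hx y hxy
    obtain ⟨h1, h2⟩ := hin r hr x hx
    by_cases hy : ∃ r' ∈ R, y ∈ openSimplex r'
    · obtain ⟨r', hr', hy⟩ := hy
      obtain ⟨h3, h4⟩ := hin r' hr' y hy
      obtain rfl := hR.eq_of_mem hr hr' h2 (hxy ▸ openSimplex_subset_convexHull r' h4)
      exact (hg r hr).bijOn.injOn (openSimplex_subset_convexHull r hx)
        (openSimplex_subset_convexHull r hy) (h1.symm.trans (hxy.trans h3))
    · push Not at hy
      rw [glue_of_notMem hy] at hxy
      exact absurd (hxy ▸ h2) (hy r hr)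
  intro x y hxy
  by_cases hx : ∃ r ∈ R, x ∈ openSimplex r
  · obtain ⟨r, hr, hx⟩ := hx
    exact key r hr x hx y hxy
  by_cases hy : ∃ r ∈ R, y ∈ openSimplex r
  · obtain ⟨r, hr, hy⟩ := hy
    exact (key r hr y hy x hxy.symm).symm
  push Not at hx hy
  rwa [glue_of_notMem hx, glue_of_notMem hy] at hxy

theorem HaveDisjointInteriors.bijOn_glue {R : Set (Finset E)} (hR : HaveDisjointInteriors R)
    {g : Finset E → E → E} (hg : ∀ r ∈ R, IsInnerHomeo r (g r)) :
    BijOn (glue R g) (⋃ r ∈ R, convexHull ℝ (r : Set E)) (⋃ r ∈ R, convexHull ℝ (r : Set E)) := by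
  refine ⟨fun x hx => ?_, (hR.injective_glue hg).injOn, fun y hy => ?_⟩
  · obtain ⟨r, hr, hx⟩ := mem_iUnion₂.1 hx
    rw [hR.eqOn_glue hg hr hx]
    exact mem_iUnion₂.2 ⟨r, hr, (hg r hr).bijOn.mapsTo hx⟩
  · obtain ⟨r, hr, hy⟩ := mem_iUnion₂.1 hy
    obtain ⟨x, hx, rfl⟩ := (hg r hr).bijOn.surjOn hy
    exact ⟨x, mem_iUnion₂.2 ⟨r, hr, hx⟩, hR.eqOn_glue hg hr hx⟩

theorem MeetsInNormalDisks.congr {t : Finset E} {G G' : Set E} (h : MeetsInNormalDisks t G)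
    (hG : ∀ x ∈ convexHull ℝ (t : Set E), (x ∈ G ↔ x ∈ G')) : MeetsInNormalDisks t G' := by
  obtain ⟨𝒟, h1, h2, h3, k, h4, h5⟩ := h
  refine ⟨𝒟, h1, h2, h3, k, h4, h5.trans ?_⟩
  ext x
  exact hG x x.2

/-- A normal set becomes normal in all tetrahedra of the `n`-th subdivision after a homeomorphism
that fixes the boundary of the tetrahedron. -/
theorem IsTetrahedron.exists_isInnerHomeo {e : Finset E → E} (he : IsInteriorPointChoice e)
    (n : ℕ) {t : Finset E} (ht : IsTetrahedron t) {G : Set E} (hG : MeetsInNormalDisks t G) :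
    ∃ g : E → E, IsInnerHomeo t g ∧
      ∀ G', (∀ x ∈ convexHull ℝ (t : Set E), (x ∈ G ↔ g x ∈ G')) →
        ∀ s ∈ iteratedSubdivision e n t, MeetsInNormalDisks s G' := by
  induction n generalizing t G with
  | zero =>
    refine ⟨_, .id t, fun G' hG' s hs => ?_⟩
    obtain rfl : s = t := hs
    exact hG.congr hG'
  | succ n ih =>
    have hq := he t ht.card ht.indep
    obtain ⟨h1, h2, h3⟩ := ht.stellarSubdivision hq
    obtain ⟨V, _, _, P, o, p, h⟩ := ht.exists_frame hq
    obtain ⟨g, hg, hgN⟩ := h.exists_image hG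
    have hgN := hgN (g '' (G ∩ convexHull ℝ (t : Set E))) fun x hx =>
      ⟨fun hxG => ⟨x, ⟨hxG, hx⟩, rfl⟩, fun ⟨y, hy, hyx⟩ => hg.bijOn.injOn hy.2 hx hyx ▸ hy.1⟩
    have hc : ∀ c, ∃ k : E → E, c ∈ _root_.stellarSubdivision (e t) t → IsInnerHomeo c k ∧
        ∀ G', (∀ x ∈ convexHull ℝ (c : Set E), (x ∈ g '' (G ∩ convexHull ℝ (t : Set E)) ↔
          k x ∈ G')) → ∀ s ∈ iteratedSubdivision e n c, MeetsInNormalDisks s G' := by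
      intro c
      by_cases hc : c ∈ _root_.stellarSubdivision (e t) t
      · obtain ⟨k, hk, hkN⟩ := ih (h1 c hc).1 (hgN c hc)
        exact ⟨k, fun _ => ⟨hk, hkN⟩⟩
      · exact ⟨_root_.id, fun h => absurd h hc⟩
    choose k hk using hc
    have hki := fun c hc => (hk c hc).1
    have hR : HaveDisjointInteriors (_root_.stellarSubdivision (e t) t) := h2
    have hglue : IsInnerHomeo t (glue (_root_.stellarSubdivision (e t) t) k) := by
      refine ⟨?_, ?_, fun x hx => glue_of_notMem fun c hc hxc => hx ((h1 c hc).2.1 hxc)⟩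
      · rw [h3, biUnion_eq_iUnion]
        have := (finite_stellarSubdivision (e t) t).to_subtype
        refine (locallyFinite_of_finite _).continuousOn_iUnion
          (fun c => (isCompact_convexHull c.1).isClosed) fun c => ?_
        exact (hki c.1 c.2).continuousOn.congr (hR.eqOn_glue hki c.2)
      · rw [h3]
        exact hR.bijOn_glue hki
    refine ⟨_, hglue.comp hg, fun G' hG' s hs => ?_⟩
    obtain ⟨c, hc, hs⟩ := mem_iteratedSubdivision_succ.1 hs
    refine (hk c hc).2 G' (fun x hx => ?_) s hs
    obtain ⟨y, hy, rfl⟩ := hg.bijOn.surjOn ((h1 c hc).2.2 hx)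
    rw [← hR.eqOn_glue hki hc hx]
    refine Iff.trans ⟨?_, fun hyG => ⟨y, ⟨hyG, hy⟩, rfl⟩⟩ (hG' y hy)
    rintro ⟨z, hz, hzy⟩
    exact hg.bijOn.injOn hz.2 hy hzy ▸ hz.1

end Recursion

/-! ### The Alexander trick -/

section Alexander

variable {V : Type*} [Fintype V] [DecidableEq V]

/-- The Alexander trick in a simplex: a homeomorphism that fixes the boundary is isotopic to the
identity. At the time `u` it acts on the copy of the simplex that is shrunk by `u` towards the
barycenter. -/
theorem exists_alexander {s : Finset V} (hs : s.Nonempty) {g : (V → ℝ) → V → ℝ}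
    (hg : ContinuousOn g (face s)) (hb : BijOn g (face s) (face s))
    (hfix : ∀ x ∈ faceBoundary s, g x = x) :
    ∃ H : unitInterval → (V → ℝ) → V → ℝ,
      ContinuousOn (fun p : unitInterval × (V → ℝ) => H p.1 p.2) (univ ×ˢ face s) ∧
      (∀ u, BijOn (H u) (face s) (face s)) ∧ (∀ u, ∀ x ∈ faceBoundary s, H u x = x) ∧
      (∀ x, H 0 x = x) ∧ ∀ x ∈ face s, H 1 x = g x := by
  classical
  set c : V → ℝ := barycenter s with hc
  have hcf : c ∈ face s := barycenter_mem hs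
  set D : (V → ℝ) → V → ℝ := fun y => if y ∈ face s then g y - y else 0 with hD
  have hDin : ∀ y ∈ face s, D y = g y - y := fun y hy => if_pos hy
  have hDout : ∀ y, y ∉ face s → D y = 0 := fun y hy => if_neg hy
  have hDb : ∀ y ∈ faceBoundary s, D y = 0 := fun y hy => by
    rw [hDin y hy.1, hfix y hy, sub_self]
  have hDc : ContinuousOn D (faceSpan s) := by
    have h1 : ContinuousOn D (face s) := (hg.sub continuousOn_id).congr hDin
    have h2 : ContinuousOn D (faceSpan s ∩ {y | ∀ v ∈ s, 0 < y v}ᶜ) := by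
      refine (continuousOn_const (c := (0 : V → ℝ))).congr fun y hy => ?_
      by_cases hyf : y ∈ face s
      · have := hy.2
        simp only [mem_compl_iff, mem_ofPred_eq, not_forall] at this
        obtain ⟨v, hv, h0⟩ := this
        exact hDb y ⟨hyf, v, hv, le_antisymm (not_lt.1 h0) (hyf.1 v)⟩
      · exact hDout y hyf
    have hO : IsOpen {y : V → ℝ | ∀ v ∈ s, 0 < y v} := by
      have : {y : V → ℝ | ∀ v ∈ s, 0 < y v} = ⋂ v ∈ s, {y | 0 < y v} := by ext; simp
      rw [this]
      exact isOpen_biInter_finset fun v _ => isOpen_lt continuous_const (continuous_apply v)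
    refine (h1.union_of_isClosed h2 (isCompact_face s).isClosed
      ((isClosed_faceSpan s).inter hO.isClosed_compl)).mono fun y hy => ?_
    by_cases h : ∀ v ∈ s, 0 < y v
    · refine Or.inl ⟨fun v => ?_, hy.1, hy.2⟩
      by_cases hv : v ∈ s
      · exact (h v hv).le
      · rw [hy.2 v hv]
    · exact Or.inr ⟨hy, h⟩
  obtain ⟨C, hC⟩ : ∃ C, ∀ y, ‖D y‖ ≤ C := by
    obtain ⟨C, hC⟩ := (isCompact_face s).exists_bound_of_continuousOn (hg.sub continuousOn_id)
    refine ⟨max C 0, fun y => ?_⟩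
    by_cases hy : y ∈ face s
    · rw [hDin y hy]
      exact (hC y hy).trans (le_max_left _ _)
    · rw [hDout y hy, norm_zero]
      exact le_max_right _ _
  set Y : ℝ → (V → ℝ) → V → ℝ := fun u x => c + u⁻¹ • (x - c) with hY
  have hYx : ∀ u : ℝ, u ≠ 0 → ∀ x, x = c + u • (Y u x - c) := by
    intro u hu x
    simp only [hY, add_sub_cancel_left, smul_smul, mul_inv_cancel₀ hu, one_smul]
    abel
  have hYs : ∀ u : ℝ, ∀ x ∈ face s, Y u x ∈ faceSpan s := by
    intro u x hx
    refine ⟨?_, fun v hv => ?_⟩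
    · simp [hY, Finset.sum_add_distrib, ← Finset.mul_sum, hcf.2.1, hx.2.1]
    · simp [hY, hcf.2.2 v hv, hx.2.2 v hv]
  have hmix : ∀ u : unitInterval, ∀ y ∈ face s, c + (u : ℝ) • (y - c) ∈ face s := by
    intro u y hy
    have := (convex_face s) hcf hy (sub_nonneg.2 u.2.2) u.2.1 (by ring)
    convert this using 1
    rw [smul_sub, sub_smul, one_smul]
    abel
  set H : unitInterval → (V → ℝ) → V → ℝ := fun u x => x + (u : ℝ) • D (Y u x) with hH
  have H0 : ∀ x, H 0 x = x := fun x => by simp [hH]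
  have hHin : ∀ u : unitInterval, (u : ℝ) ≠ 0 → ∀ y ∈ face s,
      H u (c + (u : ℝ) • (y - c)) = c + (u : ℝ) • (g y - c) := by
    intro u hu y hy
    have : Y u (c + (u : ℝ) • (y - c)) = y := by
      simp [hY, smul_smul, inv_mul_cancel₀ hu]
    simp only [hH, this, hDin y hy]
    rw [smul_sub, smul_sub, smul_sub]
    abel
  have hHout : ∀ u : unitInterval, ∀ x, Y u x ∉ face s → H u x = x := by
    intro u x hx
    simp [hH, hDout _ hx]
  have hYH : ∀ u : unitInterval, (u : ℝ) ≠ 0 → ∀ x, Y u (H u x) = Y u x + D (Y u x) := by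
    intro u hu x
    simp only [hH]
    nth_rewrite 1 [hY]
    nth_rewrite 2 [hY]
    simp only [smul_sub, smul_add, smul_smul, inv_mul_cancel₀ hu, one_smul]
    abel
  have hinj : ∀ y z, y + D y = z + D z → y = z := by
    have h1 : ∀ y ∈ face s, y + D y = g y := fun y hy => by rw [hDin y hy]; abel
    have h2 : ∀ y, y ∉ face s → y + D y = y := fun y hy => by rw [hDout y hy, add_zero]
    intro y z hyz
    by_cases hy : y ∈ face s <;> by_cases hz : z ∈ face s
    · rw [h1 y hy, h1 z hz] at hyz
      exact hb.injOn hy hz hyz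
    · rw [h1 y hy, h2 z hz] at hyz
      exact absurd (hyz ▸ hb.mapsTo hy) hz
    · rw [h2 y hy, h1 z hz] at hyz
      exact absurd (hyz ▸ hb.mapsTo hz) hy
    · rwa [h2 y hy, h2 z hz] at hyz
  refine ⟨H, ?_, fun u => ?_, fun u x hx => ?_, H0, fun x hx => ?_⟩
  · simp only [hH]
    refine continuousOn_snd.add fun p hp => ?_
    by_cases hu : (p.1 : ℝ) = 0
    · -- near the time zero the displacement is small
      have h1 : Filter.Tendsto (fun q : unitInterval × (V → ℝ) => |(q.1 : ℝ)| * C)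
          (𝓝[univ ×ˢ face s] p) (𝓝 0) := by
        have : Continuous fun q : unitInterval × (V → ℝ) => |(q.1 : ℝ)| * C := by fun_prop
        have h := (this.tendsto p).mono_left (nhdsWithin_le_nhds (s := univ ×ˢ face s))
        simpa [hu] using h
      rw [ContinuousWithinAt, hu, zero_smul]
      refine squeeze_zero_norm (fun q => ?_) h1
      rw [norm_smul, Real.norm_eq_abs]
      exact mul_le_mul_of_nonneg_left (hC _) (abs_nonneg _)
    · have hYc : ContinuousAt (fun q : unitInterval × (V → ℝ) => Y q.1 q.2) p := by
        simp only [hY]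
        have h1 : ContinuousAt (fun q : unitInterval × (V → ℝ) => ((q.1 : ℝ))⁻¹) p :=
          (continuous_subtype_val.comp continuous_fst).continuousAt.inv₀ hu
        exact continuousAt_const.add (h1.smul (continuousAt_snd.sub continuousAt_const))
      have h2 := (hDc (Y p.1 p.2) (hYs _ _ hp.2)).comp
        (f := fun q : unitInterval × (V → ℝ) => Y q.1 q.2) (s := univ ×ˢ face s)
        hYc.continuousWithinAt fun q hq => hYs _ _ hq.2
      exact (continuous_subtype_val.comp continuous_fst).continuousWithinAt.smul h2
  · rcases eq_or_ne (u : ℝ) 0 with hu | hu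
    · have : u = 0 := Subtype.ext hu
      subst this
      exact (bijOn_id _).congr fun x _ => (H0 x).symm
    refine ⟨fun x hx => ?_, fun x hx z hz hxz => ?_, fun z hz => ?_⟩
    · by_cases h : Y u x ∈ face s
      · rw [hYx u hu x, hHin u hu _ h]
        exact hmix u _ (hb.mapsTo h)
      · rwa [hHout u x h]
    · have h1 := hYH u hu x
      rw [hxz, hYH u hu z] at h1
      rw [hYx u hu x, hYx u hu z, hinj _ _ h1]
    · by_cases h : Y u z ∈ face s
      · obtain ⟨y, hy, hyz⟩ := hb.surjOn h
        refine ⟨_, hmix u y hy, ?_⟩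
        rw [hHin u hu y hy, hyz, ← hYx u hu z]
      · exact ⟨z, hz, hHout u z h⟩
  · rcases eq_or_ne (u : ℝ) 0 with hu | hu
    · rw [show u = 0 from Subtype.ext hu, H0]
    by_cases h : Y u x ∈ face s
    · obtain ⟨hx, v, hv, h0⟩ := hx
      have h1 := congrFun (hYx u hu x) v
      simp only [Pi.add_apply, Pi.smul_apply, Pi.sub_apply, smul_eq_mul, h0] at h1
      have h2 := mul_nonneg (sub_nonneg.2 u.2.2) (hcf.1 v)
      have h3 := mul_nonneg u.2.1 (h.1 v)
      have h4 : (u : ℝ) * Y u x v = 0 := by linarith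
      simp [hH, hDb (Y u x) ⟨h, v, hv, (mul_eq_zero.1 h4).resolve_left hu⟩]
    · exact hHout u x h
  · have : Y 1 x = x := by simp [hY]
    simp [hH, this, hDin x hx]

variable {E : Type*} [NormedAddCommGroup E] [NormedSpace ℝ E]

/-- The Alexander trick in a tetrahedron of `E`. -/
theorem IsTetrahedron.exists_alexander {t : Finset E} (ht : IsTetrahedron t) {g : E → E}
    (hg : IsInnerHomeo t g) :
    ∃ H : unitInterval → E → E,
      ContinuousOn (fun p : unitInterval × E => H p.1 p.2) (univ ×ˢ convexHull ℝ (t : Set E)) ∧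
      (∀ u, IsInnerHomeo t (H u)) ∧ (∀ x, H 0 x = x) ∧ H 1 = g := by
  classical
  set P : t → E := (↑) with hP
  have hs : (Finset.univ : Finset t).Nonempty := by
    rw [← Finset.card_pos, Finset.card_univ, Fintype.card_coe, ht.card]
    norm_num
  have hPi : AffineIndependent ℝ fun v : (Finset.univ : Finset t) => P v :=
    ht.indep.comp_embedding (Function.Embedding.subtype _)
  have hPt : (t : Set E) = P '' (Finset.univ : Finset t) := by simp [hP]
  have hb := bijOn_realize hPi hPt
  have hrc := (continuous_realize P).continuousOn (s := face (Finset.univ : Finset t))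
  have : Nonempty (t → ℝ) := ⟨0⟩
  set ρ := Function.invFunOn (realize P) (face (Finset.univ : Finset t)) with hρ
  have hl : LeftInvOn ρ (realize P) (face Finset.univ) := hb.injOn.leftInvOn_invFunOn
  have hr : RightInvOn ρ (realize P) (convexHull ℝ (t : Set E)) := hb.surjOn.rightInvOn_invFunOn
  have hρb : BijOn ρ (convexHull ℝ (t : Set E)) (face Finset.univ) := BijOn.symm ⟨hr, hl⟩ hb
  have hρc : ContinuousOn ρ (convexHull ℝ (t : Set E)) :=
    hrc.continuousOn_of_leftInvOn (isCompact_face _) hb hl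
  obtain ⟨K, hKc, hKb, hKfix, hK0, hK1⟩ := _root_.exists_alexander hs
    (g := fun x => ρ (g (realize P x)))
    (hρc.comp (hg.continuousOn.comp hrc hb.mapsTo) (hg.bijOn.mapsTo.comp hb.mapsTo))
    (hρb.comp (hg.bijOn.comp hb)) (fun x hx => by
      have : realize P x ∉ openSimplex t := by
        rw [openSimplex_eq_image hPi hPt]
        rintro ⟨y, ⟨hy, hpos⟩, hyx⟩
        obtain ⟨hxf, v, hv, h0⟩ := hx
        rw [hb.injOn hy hxf hyx] at hpos
        exact (hpos v hv).ne' h0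
      rw [hg.fix _ this, hl hx.1])
  set H : unitInterval → E → E := fun u y =>
    if y ∈ convexHull ℝ (t : Set E) then realize P (K u (ρ y)) else y with hH
  have hHin : ∀ u, ∀ y ∈ convexHull ℝ (t : Set E), H u y = realize P (K u (ρ y)) :=
    fun u y hy => if_pos hy
  have hHc : ContinuousOn (fun p : unitInterval × E => H p.1 p.2)
      (univ ×ˢ convexHull ℝ (t : Set E)) := by
    have h1 : ContinuousOn (fun p : unitInterval × E => (p.1, ρ p.2))
        (univ ×ˢ convexHull ℝ (t : Set E)) :=
      continuousOn_fst.prodMk (hρc.comp continuousOn_snd fun p hp => hp.2)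
    refine ((continuous_realize P).comp_continuousOn
      (hKc.comp h1 fun p hp => ⟨mem_univ _, hρb.mapsTo hp.2⟩)).congr fun p hp => ?_
    exact hHin p.1 p.2 hp.2
  refine ⟨H, hHc, fun u => ⟨?_, ?_, fun y hy => ?_⟩, fun y => ?_, ?_⟩
  · exact hHc.comp (f := fun y => (u, y)) (by fun_prop) fun y hy => ⟨mem_univ _, hy⟩
  · exact (hb.comp ((hKb u).comp hρb)).congr fun y hy => (hHin u y hy).symm
  · by_cases hyt : y ∈ convexHull ℝ (t : Set E)
    · rw [hHin u y hyt]
      have := mem_openSimplex_or_boundary hPi hPt (hρb.mapsTo hyt)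
      rw [hr hyt] at this
      rw [hKfix u _ (this.resolve_left hy), hr hyt]
    · exact if_neg hyt
  · by_cases hyt : y ∈ convexHull ℝ (t : Set E)
    · rw [hHin 0 y hyt, hK0, hr hyt]
    · exact if_neg hyt
  · ext y
    by_cases hyt : y ∈ convexHull ℝ (t : Set E)
    · rw [hHin 1 y hyt, hK1 _ (hρb.mapsTo hyt), hr hyt, hr (hg.bijOn.mapsTo hyt)]
    · rw [hg.fix y fun h => hyt (openSimplex_subset_convexHull t h)]
      exact if_neg hyt

end Alexander

/-! ### Isotopies of a triangulated space -/

namespace Triangulation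

variable {M : Type*} [TopologicalSpace M] {E : Type*} [NormedAddCommGroup E] [NormedSpace ℝ E]

theorem isTetrahedron (τ : Triangulation M E) {t : Finset E} (ht : t ∈ τ.tetrahedra) :
    IsTetrahedron t :=
  ⟨ht.2, τ.complex.indep ht.1⟩

theorem space_eq (τ : Triangulation M E) :
    τ.complex.space = ⋃ t ∈ τ.tetrahedra, convexHull ℝ (t : Set E) := by
  apply Subset.antisymm
  · intro x hx
    obtain ⟨s, hs, hx⟩ := Geometry.SimplicialComplex.mem_space_iff.1 hx
    obtain ⟨t, ht, hst, h4⟩ := τ.exists_tetrahedron s hs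
    exact mem_iUnion₂.2 ⟨t, ⟨ht, h4⟩, convexHull_mono (Finset.coe_subset.2 hst) hx⟩
  · exact iUnion₂_subset fun t ht => τ.complex.convexHull_subset_space ht.1

/-- A face that does not contain the vertices of a tetrahedron misses the interior. -/
theorem disjoint_openSimplex (τ : Triangulation M E) {t s : Finset E} (ht : t ∈ τ.tetrahedra)
    (hs : s ∈ τ.complex.faces) (hts : ¬ t ⊆ s) :
    Disjoint (openSimplex t) (convexHull ℝ (s : Set E)) := by
  classical
  rw [disjoint_left]
  intro x hx hxs
  have h1 := τ.complex.inter_subset_convexHull ht.1 hs ⟨openSimplex_subset_convexHull t hx, hxs⟩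
  obtain ⟨v, hv, hvs⟩ := Finset.not_subset.1 hts
  -- in barycentric coordinates with respect to `t`
  set P : t → E := (↑) with hP
  have hPi : AffineIndependent ℝ fun v : (Finset.univ : Finset t) => P v :=
    (τ.isTetrahedron ht).indep.comp_embedding (Function.Embedding.subtype _)
  have hPt : (t : Set E) = P '' (Finset.univ : Finset t) := by simp [hP]
  rw [openSimplex_eq_image hPi hPt] at hx
  obtain ⟨y, ⟨hy, hpos⟩, rfl⟩ := hx
  have h2 : realize P y ∈ convexHull ℝ (P '' ((Finset.univ.erase ⟨v, hv⟩ : Finset t) : Set t)) := by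
    refine convexHull_mono ?_ h1
    rintro w ⟨hw, hws⟩
    refine ⟨⟨w, hw⟩, ?_, rfl⟩
    simp only [Finset.coe_erase, Finset.coe_univ, mem_sdiff, mem_univ, mem_singleton_iff, true_and]
    intro h
    have hwv : w = v := congrArg Subtype.val h
    exact hvs (hwv ▸ hws)
  rw [realize_mem_convexHull_iff hPi (Finset.subset_univ _) hy] at h2
  exact (hpos ⟨v, hv⟩ (Finset.mem_univ _)).ne' (h2.2.2 _ (Finset.notMem_erase _ _))

theorem card_le (τ : Triangulation M E) {s : Finset E} (hs : s ∈ τ.complex.faces) : s.card ≤ 4 := by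
  obtain ⟨t, -, hst, h4⟩ := τ.exists_tetrahedron s hs
  exact h4 ▸ Finset.card_le_card hst

theorem eq_of_subset (τ : Triangulation M E) {t s : Finset E} (ht : t ∈ τ.tetrahedra)
    (hs : s ∈ τ.complex.faces) (hts : t ⊆ s) : t = s :=
  Finset.eq_of_subset_of_card_le hts (ht.2 ▸ τ.card_le hs)

theorem haveDisjointInteriors (τ : Triangulation M E) : HaveDisjointInteriors τ.tetrahedra :=
  fun _ ht _ hs hne => τ.disjoint_openSimplex ht hs.1 fun h => hne (τ.eq_of_subset ht hs.1 h)

theorem locallyFinite_tetrahedra (τ : Triangulation M E) :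
    LocallyFinite fun t : τ.tetrahedra =>
      (Subtype.val ⁻¹' convexHull ℝ (t.1 : Set E) : Set τ.complex.space) := by
  intro x
  obtain ⟨U, hU, hfin⟩ := τ.locallyFinite x x.2
  refine ⟨Subtype.val ⁻¹' U, continuous_subtype_val.continuousAt hU, ?_⟩
  refine Finite.of_finite_image (f := Subtype.val) (hfin.subset ?_) Subtype.val_injective.injOn
  rintro _ ⟨t, ⟨y, hy⟩, rfl⟩
  exact ⟨t.2.1, y, hy⟩

theorem isClosed_tetrahedron (τ : Triangulation M E) (t : Finset E) :
    IsClosed (Subtype.val ⁻¹' convexHull ℝ (t : Set E) : Set τ.complex.space) :=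
  (isCompact_convexHull t).isClosed.preimage continuous_subtype_val

theorem iUnion_tetrahedra (τ : Triangulation M E) :
    ⋃ t : τ.tetrahedra, (Subtype.val ⁻¹' convexHull ℝ (t.1 : Set E) : Set τ.complex.space) =
      univ := by
  refine eq_univ_of_forall fun x => ?_
  obtain ⟨t, ht, hx⟩ := mem_iUnion₂.1 (τ.space_eq.subset x.2)
  exact mem_iUnion.2 ⟨⟨t, ht⟩, hx⟩

/-- Isotopies of the tetrahedra that fix the boundaries form an isotopy of the underlying space. -/
theorem exists_isotopy_space (τ : Triangulation M E) {K : Finset E → unitInterval → E → E}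
    (hKc : ∀ t ∈ τ.tetrahedra, ContinuousOn (fun p : unitInterval × E => K t p.1 p.2)
      (univ ×ˢ convexHull ℝ (t : Set E)))
    (hK : ∀ t ∈ τ.tetrahedra, ∀ u, IsInnerHomeo t (K t u)) :
    ∃ H : unitInterval → τ.complex.space ≃ₜ τ.complex.space,
      (Continuous fun p : unitInterval × τ.complex.space => H p.1 p.2) ∧
      ∀ u x, (H u x : E) = glue τ.tetrahedra (fun t => K t u) x := by
  have hR := τ.haveDisjointInteriors
  set φ : unitInterval → E → E := fun u => glue τ.tetrahedra fun t => K t u with hφ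
  have hb : ∀ u, BijOn (φ u) τ.complex.space τ.complex.space := fun u => by
    rw [τ.space_eq]
    exact hR.bijOn_glue fun t ht => hK t ht u
  have heq : ∀ u, ∀ t ∈ τ.tetrahedra, EqOn (φ u) (K t u) (convexHull ℝ (t : Set E)) :=
    fun u t ht => hR.eqOn_glue (fun t ht => hK t ht u) ht
  have hjoint : Continuous fun p : unitInterval × τ.complex.space => φ p.1 p.2 := by
    refine (τ.locallyFinite_tetrahedra.preimage_continuous continuous_snd).continuous ?_
      (fun t => (τ.isClosed_tetrahedron t).preimage continuous_snd) fun t => ?_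
    · rw [← preimage_iUnion, τ.iUnion_tetrahedra, preimage_univ]
    · have h1 : Continuous fun p : unitInterval × τ.complex.space => (p.1, (p.2 : E)) := by
        fun_prop
      refine ((hKc t t.2).comp h1.continuousOn fun p hp => ⟨mem_univ _, hp⟩).congr fun p hp => ?_
      exact heq p.1 t t.2 hp
  set ψ : unitInterval → τ.complex.space ≃ τ.complex.space := fun u => (hb u).equiv (φ u) with hψ
  have hψφ : ∀ u x, (ψ u x : E) = φ u x := fun u x => rfl
  have hψc : Continuous fun p : unitInterval × τ.complex.space => ψ p.1 p.2 :=
    hjoint.subtype_mk _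
  have hclosed : ∀ u, IsClosedMap (ψ u) := by
    intro u Z hZ
    have hψu : Continuous (ψ u) := hψc.comp (by fun_prop : Continuous fun x => (u, x))
    have hcell : ∀ t : τ.tetrahedra,
        ψ u '' (Z ∩ Subtype.val ⁻¹' convexHull ℝ (t.1 : Set E)) ⊆
          Subtype.val ⁻¹' convexHull ℝ (t.1 : Set E) := by
      rintro t _ ⟨x, ⟨-, hx⟩, rfl⟩
      rw [mem_preimage, hψφ, heq u t t.2 hx]
      exact (hK t t.2 u).bijOn.mapsTo hx
    have hun : ψ u '' Z = ⋃ t : τ.tetrahedra,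
        ψ u '' (Z ∩ Subtype.val ⁻¹' convexHull ℝ (t.1 : Set E)) := by
      rw [← image_iUnion, ← inter_iUnion, τ.iUnion_tetrahedra, inter_univ]
    rw [hun]
    refine (τ.locallyFinite_tetrahedra.subset hcell).isClosed_iUnion fun t => ?_
    have hcomp : IsCompact (Subtype.val ⁻¹' convexHull ℝ (t.1 : Set E) : Set τ.complex.space) := by
      rw [Subtype.isCompact_iff, Subtype.image_preimage_coe,
        inter_eq_self_of_subset_right (τ.complex.convexHull_subset_space t.2.1)]
      exact isCompact_convexHull t.1
    exact ((hcomp.inter_left hZ).image hψu).isClosed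
  exact ⟨fun u => (ψ u).toHomeomorphOfContinuousClosed
    (hψc.comp (by fun_prop : Continuous fun x => (u, x))) (hclosed u), hψc, fun u x => rfl⟩

end Triangulation

/-! ### Surfaces in a triangulated manifold -/

namespace Triangulation

variable {M : Type*} [TopologicalSpace M] {E : Type*} [NormedAddCommGroup E] [NormedSpace ℝ E]

/-- The inclusion of `F` in `E`. -/
def inclusion (τ : Triangulation M E) (F : Set M) (x : F) : E := τ.homeo.symm x

theorem continuous_inclusion (τ : Triangulation M E) (F : Set M) : Continuous (τ.inclusion F) := by
  unfold inclusion
  fun_prop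

theorem injective_inclusion (τ : Triangulation M E) (F : Set M) :
    Function.Injective (τ.inclusion F) := fun _ _ h =>
  Subtype.ext (τ.homeo.symm.injective (Subtype.ext h))

theorem range_inclusion (τ : Triangulation M E) (F : Set M) : range (τ.inclusion F) = τ.pull F := by
  ext y
  constructor
  · rintro ⟨x, rfl⟩
    exact ⟨τ.homeo.symm x, by simp, rfl⟩
  · rintro ⟨z, hz, rfl⟩
    exact ⟨⟨τ.homeo z, hz⟩, by simp [inclusion]⟩

theorem isCompact_pull (τ : Triangulation M E) (F : Set M) [CompactSpace F] :
    IsCompact (τ.pull F) := by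
  rw [← τ.range_inclusion]
  exact isCompact_range (τ.continuous_inclusion F)

/-- A sphere in the interior of a tetrahedron that is open and closed in `F` is a component. -/
theorem not_hasSphere (τ : Triangulation M E) (F : Set M) [CompactSpace F]
    (hF : ∀ x : F,
      IsEmpty (connectedComponent x ≃ₜ Metric.sphere (0 : EuclideanSpace ℝ (Fin 3)) 1))
    {t : Finset E} (ht : t ∈ τ.tetrahedra) :
    ¬ HasSphere (τ.pull F ∩ convexHull ℝ (t : Set E)) (openSimplex t) := by
  classical
  rintro ⟨S, K, hK, hSK, hun, hSO, ⟨φ⟩⟩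
  have hSc : IsCompact S := by
    have : CompactSpace S := φ.symm.compactSpace
    exact isCompact_iff_compactSpace.2 this
  set j := τ.inclusion F with hj
  have hjc : Continuous j := τ.continuous_inclusion F
  have hSr : S ⊆ range j := by
    rw [τ.range_inclusion]
    exact fun x hx => (hun.subset (Or.inl hx)).1
  have hclosed : IsClosed (j ⁻¹' S) := hSc.isClosed.preimage hjc
  have hopen : IsClosed (j ⁻¹' S)ᶜ := by
    set A : Set τ.complex.space := ⋃ s : τ.tetrahedra,
      (if s.1 = t then ∅ else Subtype.val ⁻¹' convexHull ℝ (s.1 : Set E)) with hA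
    have hAc : IsClosed A := by
      refine (τ.locallyFinite_tetrahedra.subset fun s => ?_).isClosed_iUnion fun s => ?_
      · split_ifs
        · exact empty_subset _
        · exact Subset.rfl
      · split_ifs
        · exact isClosed_empty
        · exact τ.isClosed_tetrahedron s.1
    have hmemA : ∀ z, z ∈ A ↔ ∃ s ∈ τ.tetrahedra, s ≠ t ∧ (z : E) ∈ convexHull ℝ (s : Set E) := by
      intro z
      rw [hA, mem_iUnion]
      constructor
      · rintro ⟨s, hs⟩
        split_ifs at hs with h
        · exact absurd hs (notMem_empty _)
        · exact ⟨s, s.2, h, hs⟩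
      · rintro ⟨s, hs, hst, hz⟩
        refine ⟨⟨s, hs⟩, ?_⟩
        rw [if_neg hst]
        exact hz
    have hcompl : (j ⁻¹' S)ᶜ = j ⁻¹' K ∪ (fun x : F => τ.homeo.symm x) ⁻¹' A := by
      ext x
      have hx : j x ∈ τ.pull F := τ.range_inclusion F ▸ mem_range_self x
      constructor
      · intro hxS
        obtain ⟨s, hs, hxs⟩ := mem_iUnion₂.1 (τ.space_eq.subset (τ.homeo.symm x).2)
        by_cases hst : s = t
        · rcases hun.symm.subset ⟨hx, hst ▸ hxs⟩ with h | h
          · exact absurd h hxS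
          · exact Or.inl h
        · exact Or.inr ((hmemA _).2 ⟨s, hs, hst, hxs⟩)
      · rintro (h | h) hxS
        · exact disjoint_left.1 hSK hxS h
        · obtain ⟨s, hs, hst, hxs⟩ := (hmemA _).1 h
          exact disjoint_left.1 (τ.haveDisjointInteriors t ht s hs (Ne.symm hst)) (hSO hxS) hxs
    rw [hcompl]
    exact (hK.isClosed.preimage hjc).union
      (hAc.preimage (τ.homeo.symm.continuous.comp continuous_subtype_val))
  have hclopen : IsClopen (j ⁻¹' S) := ⟨hclosed, isClosed_compl_iff.1 hopen⟩
  obtain ⟨ψ, -⟩ := exists_homeomorph_of_bijOn hclosed.isCompact hjc.continuousOn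
    (⟨fun x hx => hx, (τ.injective_inclusion F).injOn, fun y hy => by
      obtain ⟨x, rfl⟩ := hSr hy
      exact ⟨x, hy, rfl⟩⟩ : BijOn j (j ⁻¹' S) S)
  have hconn : IsConnected (j ⁻¹' S) := by
    have h1 : IsConnected (Metric.sphere (0 : EuclideanSpace ℝ (Fin 3)) 1) :=
      isConnected_sphere (by
        rw [← Module.finrank_eq_rank, finrank_euclideanSpace_fin]
        norm_num) 0 zero_le_one
    have := isConnected_iff_connectedSpace.1 h1
    refine isConnected_iff_connectedSpace.2 ?_
    exact (ψ.trans φ).symm.surjective.connectedSpace (ψ.trans φ).symm.continuous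
  obtain ⟨x, hx⟩ := hconn.nonempty
  have hcomp : connectedComponent x = j ⁻¹' S :=
    Subset.antisymm (hclopen.connectedComponent_subset hx)
      (hconn.isPreconnected.subset_connectedComponent hx)
  exact (hF x).false ((Homeomorph.setCongr hcomp).trans (ψ.trans φ))

/-- The forward direction: the isotopy is made of Alexander isotopies in the tetrahedra. -/
theorem exists_normalIsotopy (τ : Triangulation M E) (f : τ.tetrahedra → ℕ) {e : Finset E → E}
    (he : IsInteriorPointChoice e) {F : Set M} (hF : IsNormalIn τ.tetrahedra (τ.pull F)) :
    ∃ H : unitInterval → M ≃ₜ M, τ.IsNormalIsotopy H ∧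
      IsNormalIn (τ.refinedTetrahedra f e) (τ.pull (H 1 '' F)) := by
  classical
  have hex : ∀ t, ∃ K : unitInterval → E → E, ∀ ht : t ∈ τ.tetrahedra,
      ContinuousOn (fun p : unitInterval × E => K p.1 p.2) (univ ×ˢ convexHull ℝ (t : Set E)) ∧
      (∀ u, IsInnerHomeo t (K u)) ∧ (∀ x, K 0 x = x) ∧
      ∀ G', (∀ x ∈ convexHull ℝ (t : Set E), (x ∈ τ.pull F ↔ K 1 x ∈ G')) →
        ∀ s ∈ iteratedSubdivision e (f ⟨t, ht⟩) t, MeetsInNormalDisks s G' := by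
    intro t
    by_cases ht : t ∈ τ.tetrahedra
    · obtain ⟨g, hg, hgN⟩ :=
        (τ.isTetrahedron ht).exists_isInnerHomeo he (f ⟨t, ht⟩) (hF t ht)
      obtain ⟨K, hKc, hK, hK0, rfl⟩ := (τ.isTetrahedron ht).exists_alexander hg
      exact ⟨K, fun _ => ⟨hKc, hK, hK0, hgN⟩⟩
    · exact ⟨fun _ => id, fun h => absurd h ht⟩
  choose K hK using hex
  have hR := τ.haveDisjointInteriors
  have hKi : ∀ u, ∀ t ∈ τ.tetrahedra, IsInnerHomeo t (K t u) := fun u t ht => (hK t ht).2.1 u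
  obtain ⟨H, hHc, hH⟩ := τ.exists_isotopy_space (K := K) (fun t ht => (hK t ht).1)
    fun t ht u => hKi u t ht
  have hface : ∀ u, ∀ s ∈ τ.complex.faces, ∀ x : τ.complex.space,
      ((H u x : E) ∈ convexHull ℝ (s : Set E) ↔ (x : E) ∈ convexHull ℝ (s : Set E)) := by
    intro u s hs x
    have hinj := hR.injective_glue (hKi u)
    rw [hH]
    by_cases hst : s ∈ τ.tetrahedra
    · have heq := hR.eqOn_glue (hKi u) hst
      constructor
      · intro hx
        obtain ⟨y, hy, hyx⟩ := (hKi u s hst).bijOn.surjOn hx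
        rw [← heq hy] at hyx
        exact hinj hyx ▸ hy
      · intro hx
        rw [heq hx]
        exact (hKi u s hst).bijOn.mapsTo hx
    · have hfix : ∀ y ∈ convexHull ℝ (s : Set E), glue τ.tetrahedra (fun t => K t u) y = y := by
        refine fun y hy => glue_of_notMem fun t ht hyt => ?_
        exact disjoint_left.1 (τ.disjoint_openSimplex ht hs fun hts =>
          hst (τ.eq_of_subset ht hs hts ▸ ht)) hyt hy
      constructor
      · intro hx
        have := hinj (hfix _ hx)
        rwa [this] at hx
      · intro hx
        rwa [hfix _ hx]
  refine ⟨fun u => τ.homeo.symm.trans ((H u).trans τ.homeo), ⟨?_, fun x => ?_, fun u s hs => ?_⟩,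
    fun s hs => ?_⟩
  · have h1 : Continuous fun p : unitInterval × M => (p.1, τ.homeo.symm p.2) := by fun_prop
    exact τ.homeo.continuous.comp (hHc.comp h1)
  · have h0 : H 0 (τ.homeo.symm x) = τ.homeo.symm x := by
      refine Subtype.ext ?_
      rw [hH]
      by_cases h : ∃ t ∈ τ.tetrahedra, (τ.homeo.symm x : E) ∈ openSimplex t
      · obtain ⟨t, ht, hxt⟩ := h
        rw [hR.eqOn_glue (hKi 0) ht (openSimplex_subset_convexHull t hxt), (hK t ht).2.2.1]
      · push Not at h
        exact glue_of_notMem h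
    change τ.homeo (H 0 (τ.homeo.symm x)) = x
    rw [h0, Homeomorph.apply_symm_apply]
  · ext y
    constructor
    · rintro ⟨_, ⟨x, hx, rfl⟩, rfl⟩
      refine ⟨H u x, (hface u s hs x).2 hx, ?_⟩
      change _ = τ.homeo (H u (τ.homeo.symm (τ.homeo x)))
      rw [Homeomorph.symm_apply_apply]
    · rintro ⟨x, hx, rfl⟩
      refine ⟨τ.homeo ((H u).symm x), ⟨(H u).symm x, ?_, rfl⟩, ?_⟩
      · rw [mem_preimage, ← hface u s hs, Homeomorph.apply_symm_apply]
        exact hx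
      · change τ.homeo (H u (τ.homeo.symm (τ.homeo ((H u).symm x)))) = _
        rw [Homeomorph.symm_apply_apply, Homeomorph.apply_symm_apply]
  · obtain ⟨⟨t, ht⟩, hs⟩ := mem_iUnion.1 hs
    refine (hK t ht).2.2.2 _ (fun x hx => ?_) s hs
    have hxs : x ∈ τ.complex.space := τ.complex.convexHull_subset_space ht.1 hx
    have hval : ∀ z : τ.complex.space, ∀ A : Set M, (z : E) ∈ τ.pull A ↔ τ.homeo z ∈ A := by
      intro z A
      exact Subtype.val_injective.mem_set_image
    rw [← hR.eqOn_glue (hKi 1) ht hx, ← hH 1 ⟨x, hxs⟩, hval, hval ⟨x, hxs⟩]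
    have : τ.homeo (H 1 ⟨x, hxs⟩) =
        (τ.homeo.symm.trans ((H 1).trans τ.homeo)) (τ.homeo ⟨x, hxs⟩) := by simp
    rw [this]
    exact (Homeomorph.injective _).mem_set_image.symm

end Triangulation

theorem theorem1p1
    {M : Type*} [TopologicalSpace M] [T2Space M] [SecondCountableTopology M]
    [ChartedSpace (EuclideanHalfSpace 3) M]
    {E : Type*} [NormedAddCommGroup E] [NormedSpace ℝ E]
    (τ : Triangulation M E) (f : τ.tetrahedra → ℕ)
    (e : Finset E → E) (he : IsInteriorPointChoice e)
    (F : Set M) [CompactSpace F] [ChartedSpace (EuclideanSpace ℝ (Fin 2)) F]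
    (hF : ∀ x : F,
      IsEmpty (connectedComponent x ≃ₜ Metric.sphere (0 : EuclideanSpace ℝ (Fin 3)) 1)) :
    (IsNormalIn (τ.refinedTetrahedra f e) (τ.pull F) → IsNormalIn τ.tetrahedra (τ.pull F)) ∧
    (IsNormalIn τ.tetrahedra (τ.pull F) →
      ∃ H : unitInterval → M ≃ₜ M, τ.IsNormalIsotopy H ∧
        IsNormalIn (τ.refinedTetrahedra f e) (τ.pull (H 1 '' F))) := by
  refine ⟨fun hN t ht => ?_, fun hN => τ.exists_normalIsotopy f he hN⟩
  exact (τ.isTetrahedron ht).meetsInNormalDisks he (τ.isCompact_pull F) (f ⟨t, ht⟩)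
    (fun s hs => hN s (mem_iUnion.2 ⟨⟨t, ht⟩, hs⟩)) (τ.not_hasSphere F hF ht)
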